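/- Let $n\ge 1$, and let $M\subset\mathbb C^{n+1}$ be the germ at $0\in M$ of the hypersurface $r=0$, where $$r(z,z_{n+1})=2\,\mathrm{Re}(z_{n+1})+\rho(z),\qquad \rho(z)=\sum_{j=1}^N|f_j(z)|^2,\quad z=(z_1,\dots,z_n),$$ with $f_1,\dots,f_N$ holomorphic near the origin. Assume that the D'Angelo 1-type of $M$ at $0$, the supremum of $\nu(r\circ\gamma)/\nu(\gamma)$ over nonconstant germs of holomorphic curves $\gamma$ with $\gamma(0)=0$ ($\nu$ being the order of vanishing at $0$), is finite. For a tuple $\Lambda=(\lambda_1,\dots,\lambda_n)$ of positive rationals, $z^\alpha\bar z^\beta$ has weight $\sum_i(\alpha_i+\beta_i)\lambda_i$; the leading polynomial with respect to $\Lambda$, in given coordinates, is the sum of all terms of weight $1$ of the Taylor expansion of $\rho$ at $0$. A $\Lambda$-homogeneous change of variables is an invertible polynomial change $\tilde z_i=z_i+g_i(z)$ in which $g_i$ is homogeneous of weighted degree $\lambda_i$ for each $i$. Kolář's algorithm runs as follows. Let $m$ be the lowest degree of a monomial in the Taylor expansion of $\rho$, and $\Lambda_1=(1/m,\dots,1/m)$.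 At step $t\ge1$, let $P_t$ be the leading polynomial with respect to $\Lambda_t$ in the current coordinates; choose a $\Lambda_t$-homogeneous change of variables after which $P_t$ is independent of the largest possible number $d_t$ of variables, and is a polynomial in $z_1,\dots,z_{n-d_t}$ and their conjugates. If $d_t=0$, stop. Otherwise, with $C_{\alpha\beta}$ the Taylor coefficients of $\rho$ in the new coordinates and $\Lambda_t=(\lambda_1,\dots,\lambda_n)$, keep the first $n-d_t$ entries of $\Lambda_t$ and replace each of the others by the maximum of $$W_t(\alpha,\beta)=\frac{1-\sum_{i\le n-d_t}(\alpha_i+\beta_i)\lambda_i}{\sum_{i>n-d_t}(\alpha_i+\beta_i)}$$ over all $(\alpha,\beta)$ of weight greater than $1$ with $C_{\alpha\beta}\ne0$ and $\sum_{i\le n-d_t}(\alpha_i+\beta_i)\lambda_i<1$; this gives $\Lambda_{t+1}$. Then, for all choices made in the algorithm and for every step $t\ge1$ that is reached, the leading polynomial $P_t$ is a sum of squared moduli of holomorphic polynomials, before the change of variables of step $t$ as well as after it, and in the latter case the polynomials can be taken in $z_1,\dots,z_{n-d_t}$ only. The algorithm never gets stuck and stops after a bounded number of steps. Its final weight is the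 multitype weight of $M$ at $0$, that is, the greatest lower bound in the lexicographic order of all distinguished weights, and the final leading polynomial, which corresponds to this weight, is a sum of squared moduli of holomorphic polynomials in $z_1,\dots,z_n$. Here a weight is a nonincreasing tuple $(\mu_1,\dots,\mu_n)$ of rationals in $[0,\frac12]$ such that for each $t$ either $\mu_t=0$ or $\sum_{j\le t}a_j\mu_j=1$ for some nonnegative integers $a_j$ with $a_t>0$. It is distinguished if in some local holomorphic coordinates $(z,w)$ centred at $0$, $w=u+iv$, the hypersurface is $v=P(z,\bar z)+R(z,\bar z,u)$, with $P$ a real polynomial without pluriharmonic terms all of whose terms have weight $1$, and $R$ smooth with all derivatives at $0$ of weighted order at most $1$ equal to zero ($\partial_{z_i},\partial_{\bar z_i}$ having weight $\mu_i$ and $\partial_u$ weight $1$). -/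

import Mathlib

open scoped ContDiff Topology ENNReal BigOperators

noncomputable section

namespace SumOfSquares

/-! ### Polynomials and Taylor coefficients in `z` and `z̄`

Mixed monomials `z^α z̄^β` are indexed by exponents `e : Fin n ⊕ Fin n →₀ ℕ`, where
`e (Sum.inl i) = α_i` and `e (Sum.inr i) = β_i`. -/

/-- Exponents `(α, β)` of the mixed monomials `z^α z̄^β`. -/
abbrev MixedExp (n : ℕ) := (Fin n ⊕ Fin n) →₀ ℕ

/-- Polynomials in `z` (variables `Sum.inl i`) and `z̄` (variables `Sum.inr i`). -/
abbrev MixedPoly (n : ℕ) := MvPolynomial (Fin n ⊕ Fin n) ℂ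

/-- The value `P(z, z̄)`. -/
def MixedPoly.value {n : ℕ} (P : MixedPoly n) (z : Fin n → ℂ) : ℂ :=
  MvPolynomial.eval (Sum.elim z fun i => starRingEnd ℂ (z i)) P

/-- `∂g/∂z_i = (∂g/∂x_i - i ∂g/∂y_i) / 2`. -/
def dz {n : ℕ} (i : Fin n) (g : (Fin n → ℂ) → ℂ) : (Fin n → ℂ) → ℂ := fun z =>
  (fderiv ℝ g z (Pi.single i 1) - Complex.I * fderiv ℝ g z (Pi.single i Complex.I)) / 2

/-- `∂g/∂z̄_i = (∂g/∂x_i + i ∂g/∂y_i) / 2`. -/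
def dzbar {n : ℕ} (i : Fin n) (g : (Fin n → ℂ) → ℂ) : (Fin n → ℂ) → ℂ := fun z =>
  (fderiv ℝ g z (Pi.single i 1) + Complex.I * fderiv ℝ g z (Pi.single i Complex.I)) / 2

/-- `D^α D̄^β g` for `e = (α, β)`. -/
def mixedDeriv {n : ℕ} (e : MixedExp n) (g : (Fin n → ℂ) → ℂ) : (Fin n → ℂ) → ℂ :=
  (List.finRange n).foldr
    (fun i h => (dz i)^[e (Sum.inl i)] ((dzbar i)^[e (Sum.inr i)] h)) g

/-- The coefficient of `z^α z̄^β` in the Taylor expansion of `ρ` at the origin. -/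
def taylorCoeff {n : ℕ} (ρ : (Fin n → ℂ) → ℝ) (e : MixedExp n) : ℂ :=
  mixedDeriv e (fun z => (ρ z : ℂ)) 0 / ∏ s, ((e s).factorial : ℂ)

/-- The weighted length `|(α, β)|_Λ = ∑ (α_i + β_i) λ_i`. -/
def mixedWeight {n : ℕ} (Λ : Fin n → ℚ) (e : MixedExp n) : ℚ :=
  ∑ i, ((e (Sum.inl i) + e (Sum.inr i) : ℕ) : ℚ) * Λ i

/-- The leading polynomial of `ρ` with respect to `Λ`: all terms of weight one of the Taylor
expansion of `ρ` (a finite sum as soon as the entries of `Λ` are positive). -/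
def leadingPoly {n : ℕ} (ρ : (Fin n → ℂ) → ℝ) (Λ : Fin n → ℚ) : MixedPoly n :=
  ∑ᶠ (e : MixedExp n) (_ : mixedWeight Λ e = 1), MvPolynomial.monomial e (taylorCoeff ρ e)

/-- `P` depends on the `i`-th variable, through `z_i` or through `z̄_i`. -/
def MixedPoly.DependsOn {n : ℕ} (P : MixedPoly n) (i : Fin n) : Prop :=
  Sum.inl i ∈ P.vars ∨ Sum.inr i ∈ P.vars

/-- The number of variables of which `P` is independent. -/
def MixedPoly.numFree {n : ℕ} (P : MixedPoly n) : ℕ :=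
  {i : Fin n | ¬ P.DependsOn i}.ncard

/-- `P = |h_1|² + ⋯ + |h_L|²` with holomorphic polynomials `h_l` in the variables
`z_1, …, z_k` only (the first `k` of the `n` variables). -/
def MixedPoly.IsSumOfSquares {n : ℕ} (P : MixedPoly n) (k : ℕ) : Prop :=
  ∃ (L : ℕ) (h : Fin L → MvPolynomial (Fin n) ℂ),
    (∀ l, ∀ i ∈ (h l).vars, i.val < k) ∧
    P = ∑ l, MvPolynomial.rename Sum.inl (h l) *
      MvPolynomial.rename Sum.inr (MvPolynomial.map (starRingEnd ℂ) (h l))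

/-! ### The hypersurface and its D'Angelo 1-type -/

/-- The tangential part `∑ |f_j(z)|²` of the defining function. -/
def sumSq {n N : ℕ} (f : Fin N → (Fin n → ℂ) → ℂ) (z : Fin n → ℂ) : ℝ :=
  ∑ j, ‖f j z‖ ^ 2

/-- `r(z, z_{n+1}) = 2 Re z_{n+1} + ∑ |f_j(z)|²` on `ℂⁿ × ℂ = ℂⁿ⁺¹`. -/
def definingFunction {n N : ℕ} (f : Fin N → (Fin n → ℂ) → ℂ) (p : (Fin n → ℂ) × ℂ) : ℝ :=
  2 * p.2.re + sumSq f p.1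

/-- The order of vanishing at `0` of a function of one complex variable. -/
def vanishingOrder {E : Type*} [NormedAddCommGroup E] (g : ℂ → E) : ℕ∞ :=
  ⨆ (k : ℕ) (_ : g =O[𝓝 0] fun ζ : ℂ => ‖ζ‖ ^ k), (k : ℕ∞)

/-- The D'Angelo 1-type at the origin of `{r = 0}`: the supremum of `ν(r ∘ γ) / ν(γ)` over all
nonconstant germs `γ` of holomorphic curves with `γ(0) = 0`. -/
def dAngeloOneType {n : ℕ} (r : (Fin n → ℂ) × ℂ → ℝ) : ℝ≥0∞ :=
  ⨆ (γ : ℂ → (Fin n → ℂ) × ℂ)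
    (_ : AnalyticAt ℂ γ 0 ∧ γ 0 = 0 ∧ ¬ ∀ᶠ ζ in 𝓝 0, γ ζ = 0),
    (vanishingOrder (r ∘ γ) : ℝ≥0∞) / (vanishingOrder γ : ℝ≥0∞)

/-! ### Weights, distinguished weights and the multitype -/

/-- Weights `(μ_1, …, μ_n)`: nonincreasing tuples of rational numbers in `[0, 1/2]` such that for
each `t` either `μ_t = 0` or `∑_{j ≤ t} a_j μ_j = 1` for some nonnegative integers with
`a_t > 0`. -/
structure IsWeight {n : ℕ} (Λ : Fin n → ℚ) : Prop where
  nonneg : ∀ i, 0 ≤ Λ i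
  le_half : ∀ i, Λ i ≤ 1 / 2
  antitone : Antitone Λ
  eq_one : ∀ t, Λ t = 0 ∨
    ∃ a : Fin n → ℕ, 0 < a t ∧ ∑ j ∈ Finset.Iic t, (a j : ℚ) * Λ j = 1

/-- A real direction in one of the coordinates of `(z, u)`: `some i` stands for `z_i`, and
`none` for `u`. -/
def coordDir {n : ℕ} (a : Option (Fin n)) (c : ℂ) : (Fin n → ℂ) × ℝ :=
  a.elim (0, c.re) fun i => (Pi.single i c, 0)

/-- The function `R(z, u)` is `o_Λ(1)`: it is smooth and its derivatives of weighted order at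
most one vanish at the origin, where a derivative in the direction of `z_i` (that is, of `x_i`
or `y_i`, equivalently of `z_i` or `z̄_i`) has weight `λ_i` and one in `u` has weight one. -/
def IsLittleOWeighted {n : ℕ} (Λ : Fin n → ℚ) (R : (Fin n → ℂ) × ℝ → ℝ) : Prop :=
  ContDiffAt ℝ ∞ R 0 ∧
  ∀ (k : ℕ) (a : Fin k → Option (Fin n)) (c : Fin k → ℂ),
    ∑ l, (a l).elim 1 Λ ≤ 1 → iteratedFDeriv ℝ k R 0 (fun l => coordDir (a l) (c l)) = 0

/-- `Λ` is distinguished for `{r = 0}` at the origin: there are local holomorphic coordinates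
`(z, w)` centred at the origin, the old coordinates being `Φ(z, w)`, in which the hypersurface is
`v = P(z, z̄) + o_Λ(1)`, `w = u + i v`, with `P` real valued, `Λ`-homogeneous of weighted degree
one and without pluriharmonic terms. -/
def IsDistinguished {n : ℕ} (r : (Fin n → ℂ) × ℂ → ℝ) (Λ : Fin n → ℚ) : Prop :=
  IsWeight Λ ∧
  ∃ (Φ : (Fin n → ℂ) × ℂ → (Fin n → ℂ) × ℂ) (P : MixedPoly n) (R : (Fin n → ℂ) × ℝ → ℝ),
    AnalyticAt ℂ Φ 0 ∧ Φ 0 = 0 ∧ Function.Bijective (fderiv ℂ Φ 0) ∧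
    (∀ e ∈ P.support, mixedWeight Λ e = 1) ∧
    (∀ e ∈ P.support, (∃ i, e (Sum.inl i) ≠ 0) ∧ ∃ i, e (Sum.inr i) ≠ 0) ∧
    (∀ z, (P.value z).im = 0) ∧
    IsLittleOWeighted Λ R ∧
    ∀ᶠ p : (Fin n → ℂ) × ℂ in 𝓝 0, r (Φ p) = 0 ↔ p.2.im = (P.value p.1).re + R (p.1, p.2.re)

/-- `Λ` is the multitype weight `Λ^*` of `{r = 0}` at the origin: the greatest lower bound, for
the lexicographic order, of all distinguished weights. -/
def IsMultitypeWeight {n : ℕ} (r : (Fin n → ℂ) × ℂ → ℝ) (Λ : Fin n → ℚ) : Prop :=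
  IsGLB {L : Lex (Fin n → ℚ) | IsDistinguished r (ofLex L)} (toLex Λ)

/-! ### The algorithm -/

/-- The map given by an `n`-tuple of polynomials. -/
def polyMap {n : ℕ} (ψ : Fin n → MvPolynomial (Fin n) ℂ) (z : Fin n → ℂ) : Fin n → ℂ :=
  fun i => MvPolynomial.eval z (ψ i)

/-- `z = ψ(z̃)` is a `Λ`-homogeneous change of variables: `z̃_i = χ_i(z)`, where
`χ_i = z_i + (χ_i - z_i)` is `Λ`-homogeneous of weighted degree `λ_i`, and `ψ` is the inverse of
`χ`. For positive weights the local inverse of such a `χ` is automatically polynomial and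
`Λ`-homogeneous. -/
def IsHomogeneousChange {n : ℕ} (Λ : Fin n → ℚ) (ψ : Fin n → MvPolynomial (Fin n) ℂ) : Prop :=
  (∀ i, (ψ i).IsWeightedHomogeneous Λ (Λ i)) ∧
  ∃ χ : Fin n → MvPolynomial (Fin n) ℂ,
    (∀ i, (χ i).IsWeightedHomogeneous Λ (Λ i)) ∧
    (∀ i, MvPolynomial.bind₁ ψ (χ i) = MvPolynomial.X i) ∧
    (∀ i, MvPolynomial.bind₁ χ (ψ i) = MvPolynomial.X i)

/-- For the tangential part `ρ` in the current coordinates and the current weight `Λ`: `ψ` is a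
`Λ`-homogeneous change of variables which makes the leading polynomial independent of the largest
possible number `d` of variables, the remaining ones being `z_1, …, z_{n-d}`. -/
def IsReduction {n : ℕ} (ρ : (Fin n → ℂ) → ℝ) (Λ : Fin n → ℚ)
    (ψ : Fin n → MvPolynomial (Fin n) ℂ) : Prop :=
  IsHomogeneousChange Λ ψ ∧
  (∀ ψ', IsHomogeneousChange Λ ψ' →
    (leadingPoly (ρ ∘ polyMap ψ') Λ).numFree ≤ (leadingPoly (ρ ∘ polyMap ψ) Λ).numFree) ∧
  ∀ i : Fin n, (leadingPoly (ρ ∘ polyMap ψ) Λ).DependsOn i →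
    (i : ℕ) < n - (leadingPoly (ρ ∘ polyMap ψ) Λ).numFree

/-- `∑_{i ≤ k} (α_i + β_i) λ_i`. -/
def headWeight {n : ℕ} (k : ℕ) (Λ : Fin n → ℚ) (e : MixedExp n) : ℚ :=
  ∑ i ∈ Finset.univ.filter (fun i : Fin n => i.val < k), ((e (Sum.inl i) + e (Sum.inr i) : ℕ) : ℚ) * Λ i

/-- `∑_{i > k} (α_i + β_i)`. -/
def tailDegree {n : ℕ} (k : ℕ) (e : MixedExp n) : ℕ :=
  ∑ i ∈ Finset.univ.filter (fun i : Fin n => k ≤ i.val), (e (Sum.inl i) + e (Sum.inr i))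

/-- The set `Θ` of the exponents `(α, β)` of the terms of weight greater than one of `ρ` for which
`∑_{i ≤ k} (α_i + β_i) λ_i < 1`. -/
def Theta {n : ℕ} (ρ : (Fin n → ℂ) → ℝ) (k : ℕ) (Λ : Fin n → ℚ) : Set (MixedExp n) :=
  {e | taylorCoeff ρ e ≠ 0 ∧ 1 < mixedWeight Λ e ∧ headWeight k Λ e < 1}

/-- The number `W(α, β)`. -/
def Wvalue {n : ℕ} (k : ℕ) (Λ : Fin n → ℚ) (e : MixedExp n) : ℚ :=
  (1 - headWeight k Λ e) / (tailDegree k e : ℚ)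

/-- `Λ'` is the weight that follows `Λ` when the leading polynomial involves the first `k`
variables: the first `k` entries are kept, the others become the maximum of `W` over `Θ`. -/
def IsNextWeight {n : ℕ} (ρ : (Fin n → ℂ) → ℝ) (k : ℕ) (Λ Λ' : Fin n → ℚ) : Prop :=
  (∀ i : Fin n, (i : ℕ) < k → Λ' i = Λ i) ∧
  ∀ i : Fin n, k ≤ (i : ℕ) → IsGreatest (Wvalue k Λ '' Theta ρ k Λ) (Λ' i)

/-- `KolarStep ρ t Λ φ`: some execution of the algorithm, started from the tangential part `ρ`,
arrives at step `t` at the weight `Λ_t = Λ`, the original coordinates being `φ` of the current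
ones (those in which `Λ_t` was computed). In the first step `Λ_1 = (1/m, …, 1/m)`, where `m` is the
lowest degree of a monomial of `ρ`. Afterwards a `Λ_t`-homogeneous change of variables reduces
the number of variables of the leading polynomial to the least possible number `k = n - d_t`; the
algorithm stops if `d_t = 0` and passes to the next weight otherwise. -/
inductive KolarStep {n : ℕ} (ρ : (Fin n → ℂ) → ℝ) :
    ℕ → (Fin n → ℚ) → ((Fin n → ℂ) → (Fin n → ℂ)) → Prop
  | first (m : ℕ) (hm : IsLeast {k | ∃ e : MixedExp n, taylorCoeff ρ e ≠ 0 ∧ e.degree = k} m) :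
      KolarStep ρ 1 (fun _ => 1 / (m : ℚ)) id
  | next (t : ℕ) (Λ Λ' : Fin n → ℚ) (φ : (Fin n → ℂ) → (Fin n → ℂ))
      (ψ : Fin n → MvPolynomial (Fin n) ℂ)
      (h : KolarStep ρ t Λ φ) (hψ : IsReduction (ρ ∘ φ) Λ ψ)
      (hd : (leadingPoly (ρ ∘ φ ∘ polyMap ψ) Λ).numFree ≠ 0)
      (hΛ' : IsNextWeight (ρ ∘ φ ∘ polyMap ψ)
        (n - (leadingPoly (ρ ∘ φ ∘ polyMap ψ) Λ).numFree) Λ Λ') :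
      KolarStep ρ (t + 1) Λ' (φ ∘ polyMap ψ)

/-- The outcome of step `t`: the weight `Λ_t = Λ` and coordinates, after a reduction (the original
coordinates being `φ` of these), in which the leading polynomial `P_t` has the least number of
variables. -/
def KolarOutcome {n : ℕ} (ρ : (Fin n → ℂ) → ℝ) (t : ℕ) (Λ : Fin n → ℚ)
    (φ : (Fin n → ℂ) → (Fin n → ℂ)) : Prop :=
  ∃ (φ₀ : (Fin n → ℂ) → (Fin n → ℂ)) (ψ : Fin n → MvPolynomial (Fin n) ℂ),
    KolarStep ρ t Λ φ₀ ∧ IsReduction (ρ ∘ φ₀) Λ ψ ∧ φ = φ₀ ∘ polyMap ψ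

end SumOfSquares

end

/-! A mixed coefficient of a sum of squares `∑ |g_j|²` is `∑ c_α(g_j) conj c_β(g_j)`. On the
diagonal `α = β` it is a sum of squared moduli, so nothing cancels: every monomial of every `g_j` is
seen by the real function. Hence all terms weigh at least `1` exactly when all `g_j` have weighted
order at least `1/2`, and then the leading polynomial is `∑ |F_j|²`, with `F_j` the part of weight
`1/2` of `g_j` (`leadingPoly_sumSq`). It is independent of `z_i` if and only if `∂F_j/∂z_i = 0` for
all `j`. The algorithm thus runs on tuples of holomorphic polynomials.

Minimality of the final weight comes from an invariant (`KolarInv`) with a number `k` of settled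
variables. It compares the current weight `L` and coordinates `φ` with every competitor: a weight
`μ` and a biholomorphism `a` for which the `f_j ∘ a` have `μ`-order at least `1/2`. Either `L < μ`
lexicographically, or `μ` agrees with `L` on the settled variables, is at most the tail weight `τ`
afterwards, and `a = φ ∘ b` with `b` not decreasing `L`-weights. The second ingredient is rigidity
(`NoNegField`): no nonzero polynomial vector field of negative weight in the settled directions
annihilates the `F_j`.

The invariant survives a reduction (`KolarInv.reduced`). A competitor with a smaller entry among the
newly settled ones would make the leading part of `b` a homogeneous change leaving fewer variables.
If rigidity failed, an annihilating field of weight `-τ` could be straightened by its flow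
(`exists_flow`), again removing a variable (`NoNegField.of_irreducible`). It survives the passage to
the tail weight `τ' < τ` (`ReducedInv.next`) because a `b` that decreases the new weights would, at
some intermediate tail weight, transport a coordinate field to a field forbidden by rigidity
(`weightNonneg_next`).

Finite type, tested on images of the coordinate axes, forces a pure power of bounded degree of each
variable into some `f_j ∘ φ` (`exists_type_bound`). So the next weight exists, the weights stay
above a positive bound and lie in a finite set; the last entry strictly decreases, so the number of
steps is bounded.

At the end all variables are settled, so `L` is lexicographically at most every competitor. It is
distinguished itself, with `P = ∑ |F_j|²` (`isDistinguished_of_ord`). Conversely every distinguished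
weight is a competitor: restricting `r` to `w = 0` in its coordinates gives `2 Re b + ∑ |f_j ∘ a|²`
of weighted order one, and a lowest part `2 Re B + ∑ |G_j|² = 0` of smaller weight would vanish by
Liouville's theorem (`ordGE_of_isBigO`). -/

noncomputable section

namespace SumOfSquares

open MvPolynomial Filter Asymptotics

section

variable {n N : ℕ}

/-! ### Taylor coefficients of holomorphic functions -/

/-- The complex partial derivative `∂g/∂z_i`. -/
def pd (i : Fin n) (g : (Fin n → ℂ) → ℂ) : (Fin n → ℂ) → ℂ :=
  fun z => fderiv ℂ g z (Pi.single i 1)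

/-- The iterated partial derivative `∂^α g` over the variables in a list. -/
def pdIter (l : List (Fin n)) (α : Fin n → ℕ) (g : (Fin n → ℂ) → ℂ) : (Fin n → ℂ) → ℂ :=
  l.foldr (fun i h => (pd i)^[α i] h) g

/-- The coefficient of `z^α` in the Taylor expansion of `g` at the origin. -/
def coeffAt (g : (Fin n → ℂ) → ℂ) (α : Fin n →₀ ℕ) : ℂ :=
  pdIter (List.finRange n) α g 0 / ∏ i, ((α i).factorial : ℂ)

theorem analyticAt_pd {g : (Fin n → ℂ) → ℂ} {z : Fin n → ℂ} (hg : AnalyticAt ℂ g z) (i : Fin n) :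
    AnalyticAt ℂ (pd i g) z :=
  ((ContinuousLinearMap.apply ℂ ℂ (Pi.single i (1 : ℂ) : Fin n → ℂ)).analyticAt _).comp hg.fderiv

theorem analyticAt_eval (P : MvPolynomial (Fin n) ℂ) (z : Fin n → ℂ) :
    AnalyticAt ℂ (fun z => eval z P) z :=
  AnalyticOnNhd.eval_mvPolynomial P z (Set.mem_univ _)

theorem pd_eval (P : MvPolynomial (Fin n) ℂ) (i : Fin n) :
    pd i (fun z => eval z P) = fun z => eval z (pderiv i P) := by
  funext z
  induction P using MvPolynomial.induction_on with
  | C a => simp [pd]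
  | add p q hp hq =>
    simp only [pd, map_add] at *
    rw [← hp, ← hq, fderiv_fun_add (analyticAt_eval p z).differentiableAt
      (analyticAt_eval q z).differentiableAt]
    rfl
  | mul_X p j hp =>
    simp only [pd, map_mul, eval_X, pderiv_mul, map_add] at *
    have hX : HasFDerivAt (fun z : Fin n → ℂ => z j) (ContinuousLinearMap.proj j) z :=
      (ContinuousLinearMap.proj (R := ℂ) (φ := fun _ : Fin n => ℂ) j).hasFDerivAt
    have := ((analyticAt_eval p z).differentiableAt.hasFDerivAt.mul hX).fderiv
    rw [show (fun z : Fin n → ℂ => eval z p * z j) = (fun z => eval z p) * fun z => z j from rfl,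
      this]
    simp only [add_apply, smul_apply, ContinuousLinearMap.proj_apply,
      smul_eq_mul, hp, pderiv_X]
    by_cases h : i = j
    · subst h; simp; ring
    · simp [Ne.symm h]; ring

/-- Cauchy's estimate on the disc of radius `‖z‖` about `z` in the `i`-th direction. The points
there have norm at most `2‖z‖`, whence the factor `2 ^ (k + 1)`. The radius degenerates at `z = 0`,
which is reached by continuity. -/
theorem isBigO_pd {g : (Fin n → ℂ) → ℂ} (hg : AnalyticAt ℂ g 0) {k : ℕ}
    (h : g =O[𝓝 0] fun z => ‖z‖ ^ (k + 1)) (i : Fin n) : pd i g =O[𝓝 0] fun z => ‖z‖ ^ k := by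
  obtain ⟨C, hC⟩ := h.bound
  obtain ⟨ε, hε, hb⟩ := Metric.eventually_nhds_iff.1 (hC.and hg.eventually_analyticAt)
  refine IsBigO.of_bound (C * 2 ^ (k + 1)) ?_
  have h0 : ∀ᶠ z : Fin n → ℂ in 𝓝 0, ‖z‖ < ε / 2 := by
    have := Metric.ball_mem_nhds (0 : Fin n → ℂ) (half_pos hε)
    filter_upwards [this] with z hz using by simpa using hz
  have key : ∀ z : Fin n → ℂ, ‖z‖ < ε / 2 → z ≠ 0 →
      ‖pd i g z‖ ≤ C * 2 ^ (k + 1) * ‖z‖ ^ k := by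
    intro z hz hz0
    have hzp : 0 < ‖z‖ := norm_pos_iff.2 hz0
    set ℓ : ℂ → (Fin n → ℂ) := fun s => z + s • Pi.single i 1 with hℓ
    have hℓd : ∀ s, HasDerivAt ℓ (Pi.single i 1) s := fun s => by
      simpa [hℓ] using ((hasDerivAt_id s).smul_const (Pi.single i (1 : ℂ))).const_add z
    have hnorm : ∀ s : ℂ, ‖s‖ ≤ ‖z‖ → ‖ℓ s‖ ≤ 2 * ‖z‖ := fun s hs => by
      have h1 : ‖(Pi.single i (1 : ℂ) : Fin n → ℂ)‖ = 1 := by simp [Pi.norm_single]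
      calc ‖ℓ s‖ ≤ ‖z‖ + ‖s • (Pi.single i (1 : ℂ) : Fin n → ℂ)‖ := norm_add_le _ _
        _ ≤ 2 * ‖z‖ := by rw [norm_smul, h1]; linarith
    have hdiff : ∀ s : ℂ, ‖s‖ ≤ ‖z‖ → DifferentiableAt ℂ (g ∘ ℓ) s := fun s hs =>
      DifferentiableAt.comp s (hb (by
        have := hnorm s hs; simp; linarith)).2.differentiableAt (hℓd s).differentiableAt
    have hder : deriv (g ∘ ℓ) 0 = pd i g z := by
      have hgz : DifferentiableAt ℂ g (ℓ 0) := (hb (by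
        have := hnorm 0 (by simp); simp; linarith)).2.differentiableAt
      have := (hgz.hasFDerivAt.comp_hasDerivAt 0 (hℓd 0)).deriv
      rw [this]; simp [pd, hℓ]
    have hdc : DiffContOnCl ℂ (g ∘ ℓ) (Metric.ball 0 ‖z‖) := by
      apply DifferentiableOn.diffContOnCl
      rw [closure_ball _ hzp.ne']
      intro s hs
      exact (hdiff s (by simpa using hs)).differentiableWithinAt
    have := Complex.norm_deriv_le_of_forall_mem_sphere_norm_le hzp hdc
      (C := C * (2 * ‖z‖) ^ (k + 1)) (by
        intro s hs
        have hs' : ‖s‖ = ‖z‖ := by simpa using hs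
        have h2 := hnorm s hs'.le
        have h3 := (hb (y := ℓ s) (by simp; linarith)).1
        have hC0 : 0 ≤ C := by
          by_contra hneg
          have h4 := (hb (y := z) (by simp; linarith)).1
          have : C * ‖‖z‖ ^ (k + 1)‖ < 0 := mul_neg_of_neg_of_pos (not_le.1 hneg)
            (by rw [norm_pow, norm_norm]; exact pow_pos hzp _)
          linarith [norm_nonneg (g z)]
        refine h3.trans ?_
        gcongr
        simpa using pow_le_pow_left₀ (norm_nonneg _) h2 (k + 1))
    rw [hder] at this
    refine this.trans_eq ?_
    rw [mul_pow, pow_succ ‖z‖]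
    field_simp
  filter_upwards [h0] with z hz
  rw [norm_pow, norm_norm]
  by_cases hz0 : z = 0
  · subst hz0
    have hcont : ContinuousAt (pd i g) 0 := (analyticAt_pd hg i).continuousAt
    have : Nontrivial (Fin n → ℂ) := ⟨Pi.single i 1, 0, by simp⟩
    have hne : (𝓝[≠] (0 : Fin n → ℂ)).NeBot := Module.punctured_nhds_neBot ℂ _ _
    have h1 : Tendsto (fun z => ‖pd i g z‖) (𝓝[≠] 0) (𝓝 ‖pd i g 0‖) :=
      hcont.norm.tendsto.mono_left nhdsWithin_le_nhds
    have h2 : Tendsto (fun z : Fin n → ℂ => C * 2 ^ (k + 1) * ‖z‖ ^ k) (𝓝[≠] 0)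
        (𝓝 (C * 2 ^ (k + 1) * ‖(0 : Fin n → ℂ)‖ ^ k)) :=
      (by fun_prop : Continuous fun z : Fin n → ℂ => C * 2 ^ (k + 1) * ‖z‖ ^ k).continuousAt.tendsto
        |>.mono_left nhdsWithin_le_nhds
    refine le_of_tendsto_of_tendsto h1 h2 ?_
    filter_upwards [nhdsWithin_le_nhds h0, self_mem_nhdsWithin] with z hz hz0 using key z hz hz0
  · exact key z hz hz0

theorem isBigO_pow_of_le {E : Type*} [SeminormedAddCommGroup E] {a b : ℕ} (h : a ≤ b) :
    (fun z : E => ‖z‖ ^ b) =O[𝓝 0] fun z => ‖z‖ ^ a := by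
  refine IsBigO.of_bound 1 ?_
  filter_upwards [Metric.ball_mem_nhds (0 : E) one_pos] with z hz
  have hz1 : ‖z‖ ≤ 1 := by simpa using (mem_ball_zero_iff.1 hz).le
  simpa using pow_le_pow_of_le_one (norm_nonneg _) hz1 h

theorem exists_poly_isBigO {g : (Fin n → ℂ) → ℂ} (hg : AnalyticAt ℂ g 0) (k : ℕ) :
    ∃ P : MvPolynomial (Fin n) ℂ, (fun z => g z - eval z P) =O[𝓝 0] fun z => ‖z‖ ^ k := by
  obtain ⟨p, hp⟩ := hg
  refine ⟨∑ m ∈ Finset.range k, ∑ σ : Fin m → Fin n,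
    C (p m fun l => Pi.single (σ l) 1) * ∏ l, X (σ l), ?_⟩
  have h := hp.isBigO_sub_partialSum_pow k
  refine h.congr_left fun z => ?_
  rw [zero_add, FormalMultilinearSeries.partialSum, map_sum]
  congr 1
  refine Finset.sum_congr rfl fun m _ => ?_
  have hz : z = ∑ i, z i • (Pi.single i 1 : Fin n → ℂ) := by
    funext j; simp [Finset.sum_apply, Pi.single_apply]
  conv_lhs => rw [hz]
  rw [ContinuousMultilinearMap.map_sum, map_sum]
  refine Finset.sum_congr rfl fun σ _ => ?_
  rw [ContinuousMultilinearMap.map_smul_univ]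
  simp [map_prod, mul_comm]

theorem pd_iterate_sub_isBigO {g : (Fin n → ℂ) → ℂ} (hg : AnalyticAt ℂ g 0)
    {P : MvPolynomial (Fin n) ℂ} {k : ℕ} (i : Fin n) (m : ℕ)
    (h : (fun z => g z - eval z P) =O[𝓝 0] fun z => ‖z‖ ^ (k + m)) :
    AnalyticAt ℂ ((pd i)^[m] g) 0 ∧
    (fun z => (pd i)^[m] g z - eval z ((pderiv i)^[m] P)) =O[𝓝 0] fun z => ‖z‖ ^ k := by
  induction m generalizing g P with
  | zero => exact ⟨hg, h⟩
  | succ m ih =>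
    rw [Function.iterate_succ_apply, Function.iterate_succ_apply]
    refine ih (analyticAt_pd hg i) ?_
    have h1 := isBigO_pd (hg.sub (analyticAt_eval P 0)) (k := k + m) h i
    refine h1.congr' ?_ EventuallyEq.rfl
    filter_upwards [hg.eventually_analyticAt] with z hz
    have hP := congrFun (pd_eval P i) z
    simp only [pd] at hP ⊢
    rw [← hP, fderiv_sub hz.differentiableAt (analyticAt_eval P z).differentiableAt]
    rfl

/-- The iterated partial derivative of a polynomial over the variables in a list. -/
def pderivIter (l : List (Fin n)) (α : Fin n → ℕ) (P : MvPolynomial (Fin n) ℂ) :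
    MvPolynomial (Fin n) ℂ :=
  l.foldr (fun i h => (pderiv i)^[α i] h) P

theorem pdIter_sub_isBigO {g : (Fin n → ℂ) → ℂ} (hg : AnalyticAt ℂ g 0)
    {P : MvPolynomial (Fin n) ℂ} (l : List (Fin n)) (α : Fin n → ℕ) {k : ℕ}
    (h : (fun z => g z - eval z P) =O[𝓝 0] fun z => ‖z‖ ^ (k + (l.map α).sum)) :
    AnalyticAt ℂ (pdIter l α g) 0 ∧
    (fun z => pdIter l α g z - eval z (pderivIter l α P)) =O[𝓝 0] fun z => ‖z‖ ^ k := by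
  induction l generalizing k with
  | nil => exact ⟨hg, by simpa [pdIter, pderivIter] using h⟩
  | cons i l ih =>
    have h' : (fun z => g z - eval z P) =O[𝓝 0] fun z => ‖z‖ ^ (k + α i + (l.map α).sum) := by
      simpa [add_assoc] using h
    obtain ⟨h1, h2⟩ := ih h'
    exact pd_iterate_sub_isBigO h1 i (α i) h2

theorem analyticAt_pdIter {g : (Fin n → ℂ) → ℂ} (hg : AnalyticAt ℂ g 0) (l : List (Fin n))
    (α : Fin n → ℕ) : AnalyticAt ℂ (pdIter l α g) 0 := by
  obtain ⟨P, hP⟩ := exists_poly_isBigO hg (0 + (l.map α).sum)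
  exact (pdIter_sub_isBigO hg l α hP).1

theorem coeff_iterate_pderiv (P : MvPolynomial (Fin n) ℂ) (i : Fin n) (m : ℕ) (β : Fin n →₀ ℕ)
    (hβ : β i = 0) :
    coeff β ((pderiv i)^[m] P) = m.factorial * coeff (β + Finsupp.single i m) P := by
  -- Each derivative lowers the exponent of `z_i`, so the induction needs an arbitrary exponent `r`
  -- in that variable.
  suffices H : ∀ r, ∀ Q : MvPolynomial (Fin n) ℂ,
      coeff (β + Finsupp.single i r) ((pderiv i)^[m] Q) * r.factorial =
        (r + m).factorial * coeff (β + Finsupp.single i (r + m)) Q by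
    simpa using H 0 P
  induction m with
  | zero => intro r Q; simp [mul_comm]
  | succ m ih =>
    intro r Q
    rw [Function.iterate_succ_apply, ih r, coeff_pderiv]
    have : (β + Finsupp.single i (r + m) + Finsupp.single i 1 : Fin n →₀ ℕ) =
        β + Finsupp.single i (r + (m + 1)) := by
      rw [add_assoc, ← Finsupp.single_add, add_assoc]
    rw [this, ← add_assoc, Nat.factorial_succ]
    simp [hβ]
    ring

theorem coeff_pderivIter (P : MvPolynomial (Fin n) ℂ) (l : List (Fin n)) (hl : l.Nodup)
    (α : Fin n → ℕ) (β : Fin n →₀ ℕ) (hβ : ∀ i ∈ l, β i = 0) :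
    coeff β (pderivIter l α P) = (l.map fun i => ((α i).factorial : ℂ)).prod *
      coeff (β + (l.map fun i => Finsupp.single i (α i)).sum) P := by
  induction l generalizing β with
  | nil => simp [pderivIter]
  | cons i l ih =>
    rw [List.nodup_cons] at hl
    have : pderivIter (i :: l) α P = (pderiv i)^[α i] (pderivIter l α P) := rfl
    rw [this, coeff_iterate_pderiv _ _ _ _ (hβ i (by simp)), ih hl.2]
    · simp [add_assoc, mul_assoc]
    · intro j hj
      have hij : i ≠ j := fun h => hl.1 (h ▸ hj)
      simp [hβ j (by simp [hj]), hij]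

/-- After `|α| < k` derivatives the remainder is still `O(‖z‖)`, hence zero at the origin. Through
this lemma and `exists_poly_isBigO`, computations with `coeffAt` become computations with
polynomials. -/
theorem coeffAt_eq_coeff {g : (Fin n → ℂ) → ℂ} (hg : AnalyticAt ℂ g 0)
    {P : MvPolynomial (Fin n) ℂ} {k : ℕ}
    (h : (fun z => g z - eval z P) =O[𝓝 0] fun z => ‖z‖ ^ k) {α : Fin n →₀ ℕ}
    (hα : α.degree < k) : coeffAt g α = coeff α P := by
  have hsum : ((List.finRange n).map α).sum = α.degree := by
    rw [Finsupp.degree_eq_sum, ← List.ofFn_eq_map, List.sum_ofFn]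
  have h1 : (fun z => g z - eval z P) =O[𝓝 0] fun z =>
      ‖z‖ ^ (1 + ((List.finRange n).map α).sum) :=
    h.trans (isBigO_pow_of_le (by omega))
  obtain ⟨-, h2⟩ := pdIter_sub_isBigO hg (List.finRange n) α h1
  have h3 : pdIter (List.finRange n) α g 0 - eval 0 (pderivIter (List.finRange n) α P) = 0 :=
    (show (fun z => pdIter (List.finRange n) α g z - eval z (pderivIter (List.finRange n) α P))
      =O[𝓝 0] fun z => ‖z - 0‖ ^ 1 by simpa using h2).eq_zero_of_norm_pow one_ne_zero
  rw [coeffAt, sub_eq_zero.1 h3, eval_zero, constantCoeff_eq,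
    coeff_pderivIter _ _ (List.nodup_finRange n) _ _ (by simp), ← List.ofFn_eq_map, List.prod_ofFn,
    ← List.ofFn_eq_map, List.sum_ofFn, zero_add, Finsupp.univ_sum_single, mul_div_cancel_left₀]
  exact Finset.prod_ne_zero_iff.2 fun i _ => by exact_mod_cast (α i).factorial_ne_zero

theorem coeffAt_eval (P : MvPolynomial (Fin n) ℂ) (α : Fin n →₀ ℕ) :
    coeffAt (fun z => eval z P) α = coeff α P :=
  coeffAt_eq_coeff (k := α.degree + 1) (analyticAt_eval P 0) (by simpa using isBigO_zero _ _) (by omega)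

theorem coeffAt_congr {g h : (Fin n → ℂ) → ℂ} (hg : AnalyticAt ℂ g 0) (hgh : g =ᶠ[𝓝 0] h)
    (α : Fin n →₀ ℕ) : coeffAt g α = coeffAt h α := by
  obtain ⟨P, hP⟩ := exists_poly_isBigO hg (α.degree + 1)
  rw [coeffAt_eq_coeff hg hP (Nat.lt_succ_self _), coeffAt_eq_coeff (hg.congr hgh) _
    (Nat.lt_succ_self _)]
  refine hP.congr' ?_ EventuallyEq.rfl
  filter_upwards [hgh] with z hz
  rw [hz]

theorem coeffAt_sub {g h : (Fin n → ℂ) → ℂ} (hg : AnalyticAt ℂ g 0) (hh : AnalyticAt ℂ h 0)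
    (α : Fin n →₀ ℕ) : coeffAt (fun z => g z - h z) α = coeffAt g α - coeffAt h α := by
  obtain ⟨P, hP⟩ := exists_poly_isBigO hg (α.degree + 1)
  obtain ⟨Q, hQ⟩ := exists_poly_isBigO hh (α.degree + 1)
  rw [coeffAt_eq_coeff hg hP (Nat.lt_succ_self _), coeffAt_eq_coeff hh hQ (Nat.lt_succ_self _),
    ← coeff_sub]
  refine coeffAt_eq_coeff (P := P - Q) (hg.sub hh) ?_ (Nat.lt_succ_self _)
  refine (hP.sub hQ).congr_left fun z => ?_
  simp only [map_sub, Pi.sub_apply]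
  ring

theorem coeffAt_const_mul {g : (Fin n → ℂ) → ℂ} (hg : AnalyticAt ℂ g 0) (c : ℂ)
    (α : Fin n →₀ ℕ) : coeffAt (fun z => c * g z) α = c * coeffAt g α := by
  obtain ⟨P, hP⟩ := exists_poly_isBigO hg (α.degree + 1)
  rw [coeffAt_eq_coeff hg hP (Nat.lt_succ_self _),
    ← coeff_C_mul]
  refine coeffAt_eq_coeff (P := C c * P) (analyticAt_const.mul hg) ?_ (Nat.lt_succ_self _)
  refine (hP.const_mul_left c).congr_left fun z => ?_
  simp only [map_mul, eval_C, Pi.mul_apply]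
  ring

theorem coeffAt_pd {g : (Fin n → ℂ) → ℂ} (hg : AnalyticAt ℂ g 0) (i : Fin n) (α : Fin n →₀ ℕ) :
    coeffAt (pd i g) α = coeffAt g (α + Finsupp.single i 1) * (α i + 1) := by
  obtain ⟨P, hP⟩ := exists_poly_isBigO hg (α.degree + 1 + 1)
  rw [coeffAt_eq_coeff hg hP (by simp), coeffAt_eq_coeff (analyticAt_pd hg i)
    (pd_iterate_sub_isBigO hg i 1 hP).2 (Nat.lt_succ_self _)]
  simp [coeff_pderiv]

theorem coeffAt_zero {g : (Fin n → ℂ) → ℂ} (hg : AnalyticAt ℂ g 0) : coeffAt g 0 = g 0 := by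
  obtain ⟨P, hP⟩ := exists_poly_isBigO hg 1
  have h := (show (fun z => g z - eval z P) =O[𝓝 0] fun z => ‖z - 0‖ ^ 1 by
    simpa using hP).eq_zero_of_norm_pow one_ne_zero
  rw [coeffAt_eq_coeff hg hP (by simp), sub_eq_zero.1 h, eval_zero, constantCoeff_eq]

/-! ### Taylor coefficients of sums of products `g h̄` -/

theorem hasFDerivAt_mul_conj {g h : (Fin n → ℂ) → ℂ} {z : Fin n → ℂ} (hg : AnalyticAt ℂ g z)
    (hh : AnalyticAt ℂ h z) : ∃ D : (Fin n → ℂ) →L[ℝ] ℂ,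
    HasFDerivAt (fun z => g z * starRingEnd ℂ (h z)) D z ∧ ∀ i c, D (Pi.single i c) =
      c * pd i g z * starRingEnd ℂ (h z) + g z * starRingEnd ℂ (c * pd i h z) := by
  have h1 := hg.differentiableAt.hasFDerivAt.restrictScalars ℝ
  have h2 := hh.differentiableAt.hasFDerivAt.restrictScalars ℝ
  have h3 : HasFDerivAt (fun z => starRingEnd ℂ (h z)) _ z :=
    (Complex.conjCLE.toContinuousLinearMap.hasFDerivAt (x := h z)).comp z h2
  refine ⟨_, h1.mul h3, fun i c => ?_⟩
  have hs : (Pi.single i c : Fin n → ℂ) = c • Pi.single i 1 := by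
    rw [← Pi.single_smul, smul_eq_mul, mul_one]
  simp only [pd, add_apply, smul_apply, ContinuousLinearMap.comp_apply,
    ContinuousLinearMap.coe_restrictScalars', smul_eq_mul, hs, map_smul]
  simp
  ring

theorem hasFDerivAt_sum_mul_conj {ι : Type*} [Fintype ι] {g h : ι → (Fin n → ℂ) → ℂ}
    {z : Fin n → ℂ} (hg : ∀ l, AnalyticAt ℂ (g l) z) (hh : ∀ l, AnalyticAt ℂ (h l) z) :
    ∃ D : (Fin n → ℂ) →L[ℝ] ℂ,
    HasFDerivAt (fun z => ∑ l, g l z * starRingEnd ℂ (h l z)) D z ∧ ∀ i c, D (Pi.single i c) =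
      ∑ l, (c * pd i (g l) z * starRingEnd ℂ (h l z) +
        g l z * starRingEnd ℂ (c * pd i (h l) z)) := by
  choose D hD hD' using fun l => hasFDerivAt_mul_conj (hg l) (hh l)
  refine ⟨∑ l, D l, HasFDerivAt.fun_sum fun l _ => hD l, fun i c => ?_⟩
  rw [sum_apply]
  exact Finset.sum_congr rfl fun l _ => hD' l i c

section Mixed

variable {ι : Type*} [Fintype ι]

theorem dz_sum_mul_conj {G : (Fin n → ℂ) → ℂ} {g h : ι → (Fin n → ℂ) → ℂ}
    (hg : ∀ l, AnalyticAt ℂ (g l) 0) (hh : ∀ l, AnalyticAt ℂ (h l) 0)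
    (hG : G =ᶠ[𝓝 0] fun z => ∑ l, g l z * starRingEnd ℂ (h l z)) (i : Fin n) :
    dz i G =ᶠ[𝓝 0] fun z => ∑ l, pd i (g l) z * starRingEnd ℂ (h l z) := by
  filter_upwards [hG.fderiv (𝕜 := ℝ), eventually_all.2 fun l => (hg l).eventually_analyticAt,
    eventually_all.2 fun l => (hh l).eventually_analyticAt] with z hz hgz hhz
  obtain ⟨D, hD, hD'⟩ := hasFDerivAt_sum_mul_conj hgz hhz
  rw [dz, hz, hD.fderiv, hD', hD', Finset.mul_sum, ← Finset.sum_sub_distrib, Finset.sum_div]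
  refine Finset.sum_congr rfl fun l _ => ?_
  simp only [map_mul, Complex.conj_I, map_one]
  linear_combination (-(pd i (g l) z * starRingEnd ℂ (h l z)) / 2 +
    (g l z * starRingEnd ℂ (pd i (h l) z)) / 2) * Complex.I_sq

theorem dzbar_sum_mul_conj {G : (Fin n → ℂ) → ℂ} {g h : ι → (Fin n → ℂ) → ℂ}
    (hg : ∀ l, AnalyticAt ℂ (g l) 0) (hh : ∀ l, AnalyticAt ℂ (h l) 0)
    (hG : G =ᶠ[𝓝 0] fun z => ∑ l, g l z * starRingEnd ℂ (h l z)) (i : Fin n) :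
    dzbar i G =ᶠ[𝓝 0] fun z => ∑ l, g l z * starRingEnd ℂ (pd i (h l) z) := by
  filter_upwards [hG.fderiv (𝕜 := ℝ), eventually_all.2 fun l => (hg l).eventually_analyticAt,
    eventually_all.2 fun l => (hh l).eventually_analyticAt] with z hz hgz hhz
  obtain ⟨D, hD, hD'⟩ := hasFDerivAt_sum_mul_conj hgz hhz
  rw [dzbar, hz, hD.fderiv, hD', hD', Finset.mul_sum, ← Finset.sum_add_distrib, Finset.sum_div]
  refine Finset.sum_congr rfl fun l _ => ?_
  simp only [map_mul, Complex.conj_I, map_one]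
  linear_combination ((pd i (g l) z * starRingEnd ℂ (h l z)) / 2 -
    (g l z * starRingEnd ℂ (pd i (h l) z)) / 2) * Complex.I_sq

theorem analyticAt_pd_iterate {g : (Fin n → ℂ) → ℂ} (hg : AnalyticAt ℂ g 0) (i : Fin n) (m : ℕ) :
    AnalyticAt ℂ ((pd i)^[m] g) 0 := by
  induction m with
  | zero => exact hg
  | succ m ih => rw [Function.iterate_succ_apply']; exact analyticAt_pd ih i

theorem dz_iterate_sum_mul_conj {G : (Fin n → ℂ) → ℂ} {g h : ι → (Fin n → ℂ) → ℂ}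
    (hg : ∀ l, AnalyticAt ℂ (g l) 0) (hh : ∀ l, AnalyticAt ℂ (h l) 0)
    (hG : G =ᶠ[𝓝 0] fun z => ∑ l, g l z * starRingEnd ℂ (h l z)) (i : Fin n) (m : ℕ) :
    (dz i)^[m] G =ᶠ[𝓝 0] fun z => ∑ l, (pd i)^[m] (g l) z * starRingEnd ℂ (h l z) := by
  induction m with
  | zero => exact hG
  | succ m ih =>
    simp only [Function.iterate_succ_apply']
    exact dz_sum_mul_conj (fun l => analyticAt_pd_iterate (hg l) i m) hh ih i

theorem dzbar_iterate_sum_mul_conj {G : (Fin n → ℂ) → ℂ} {g h : ι → (Fin n → ℂ) → ℂ}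
    (hg : ∀ l, AnalyticAt ℂ (g l) 0) (hh : ∀ l, AnalyticAt ℂ (h l) 0)
    (hG : G =ᶠ[𝓝 0] fun z => ∑ l, g l z * starRingEnd ℂ (h l z)) (i : Fin n) (m : ℕ) :
    (dzbar i)^[m] G =ᶠ[𝓝 0] fun z => ∑ l, g l z * starRingEnd ℂ ((pd i)^[m] (h l) z) := by
  induction m with
  | zero => exact hG
  | succ m ih =>
    simp only [Function.iterate_succ_apply']
    exact dzbar_sum_mul_conj hg (fun l => analyticAt_pd_iterate (hh l) i m) ih i

/-- The holomorphic part `α` of a mixed exponent `(α, β)`. -/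
def holPart (e : MixedExp n) : Fin n →₀ ℕ := e.comapDomain Sum.inl Sum.inl_injective.injOn

/-- The antiholomorphic part `β` of a mixed exponent `(α, β)`. -/
def antiPart (e : MixedExp n) : Fin n →₀ ℕ := e.comapDomain Sum.inr Sum.inr_injective.injOn

@[simp] theorem holPart_apply (e : MixedExp n) (i : Fin n) : holPart e i = e (Sum.inl i) := rfl

@[simp] theorem antiPart_apply (e : MixedExp n) (i : Fin n) : antiPart e i = e (Sum.inr i) := rfl

/-- The mixed exponent `(α, β)`. -/
def mkExp (α β : Fin n →₀ ℕ) : MixedExp n := Finsupp.sumElim α β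

@[simp] theorem mkExp_inl (α β : Fin n →₀ ℕ) (i : Fin n) : mkExp α β (Sum.inl i) = α i := rfl

@[simp] theorem mkExp_inr (α β : Fin n →₀ ℕ) (i : Fin n) : mkExp α β (Sum.inr i) = β i := rfl

@[simp] theorem holPart_mkExp (α β : Fin n →₀ ℕ) : holPart (mkExp α β) = α := by ext; simp

@[simp] theorem antiPart_mkExp (α β : Fin n →₀ ℕ) : antiPart (mkExp α β) = β := by ext; simp

theorem mkExp_parts (e : MixedExp n) : mkExp (holPart e) (antiPart e) = e := by
  ext i; cases i <;> simp

/-- `∂` acts only on the holomorphic factors and `∂̄` only on the conjugated ones, so each product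
stays of the form `g h̄` along the fold. -/
theorem mixedDeriv_sum_mul_conj {G : (Fin n → ℂ) → ℂ} {g h : ι → (Fin n → ℂ) → ℂ}
    (hg : ∀ l, AnalyticAt ℂ (g l) 0) (hh : ∀ l, AnalyticAt ℂ (h l) 0)
    (hG : G =ᶠ[𝓝 0] fun z => ∑ l, g l z * starRingEnd ℂ (h l z)) (e : MixedExp n) :
    mixedDeriv e G =ᶠ[𝓝 0] fun z => ∑ l, pdIter (List.finRange n) (holPart e) (g l) z *
      starRingEnd ℂ (pdIter (List.finRange n) (antiPart e) (h l) z) := by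
  unfold mixedDeriv
  induction List.finRange n with
  | nil => exact hG
  | cons i l ih =>
    exact dz_iterate_sum_mul_conj (fun l' => analyticAt_pdIter (hg l') l _)
      (fun l' => analyticAt_pd_iterate (analyticAt_pdIter (hh l') l _) i _)
      (dzbar_iterate_sum_mul_conj (fun l' => analyticAt_pdIter (hg l') l _)
        (fun l' => analyticAt_pdIter (hh l') l _) ih i _) i _

theorem taylorCoeff_sumSq {N : ℕ} {g : Fin N → (Fin n → ℂ) → ℂ}
    (hg : ∀ l, AnalyticAt ℂ (g l) 0) (e : MixedExp n) :
    taylorCoeff (sumSq g) e =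
      ∑ j, coeffAt (g j) (holPart e) * starRingEnd ℂ (coeffAt (g j) (antiPart e)) := by
  have hG : (fun z => ((sumSq g z : ℝ) : ℂ)) =ᶠ[𝓝 0]
      fun z => ∑ l, g l z * starRingEnd ℂ (g l z) := by
    refine Eventually.of_forall fun z => ?_
    simp [sumSq, Complex.mul_conj, Complex.normSq_eq_norm_sq]
  rw [taylorCoeff, (mixedDeriv_sum_mul_conj hg hg hG e).eq_of_nhds, Fintype.prod_sum_type,
    Finset.sum_div]
  refine Finset.sum_congr rfl fun j _ => ?_
  simp only [coeffAt, map_div₀, map_prod, map_natCast, holPart_apply, antiPart_apply]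
  rw [div_mul_div_comm]

/-- The diagonal coefficient is `∑ |c_α(g_j)|²`: no cancellation is possible. -/
theorem taylorCoeff_sumSq_diag_ne_zero {N : ℕ} {g : Fin N → (Fin n → ℂ) → ℂ}
    (hg : ∀ l, AnalyticAt ℂ (g l) 0) {j : Fin N} {α : Fin n →₀ ℕ} (h : coeffAt (g j) α ≠ 0) :
    taylorCoeff (sumSq g) (mkExp α α) ≠ 0 := by
  rw [taylorCoeff_sumSq hg]
  simp only [holPart_mkExp, antiPart_mkExp, Complex.mul_conj]
  norm_cast
  refine (Finset.sum_pos' (fun i _ => Complex.normSq_nonneg _) ⟨j, Finset.mem_univ _, ?_⟩).ne'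
  exact Complex.normSq_pos.2 h

end Mixed

end

section

variable {n N : ℕ}

/-! ### Weights and leading polynomials of holomorphic functions -/

theorem weight_eq_sum' {σ : Type*} [Fintype σ] (L : σ → ℚ) (α : σ →₀ ℕ) :
    Finsupp.weight L α = ∑ i, (α i : ℚ) * L i := by
  rw [Finsupp.weight_eq_sum]; simp

theorem weight_nonneg {σ : Type*} [Fintype σ] {L : σ → ℚ} (hL : ∀ i, 0 ≤ L i) (α : σ →₀ ℕ) :
    0 ≤ Finsupp.weight L α := by
  rw [weight_eq_sum']; exact Finset.sum_nonneg fun i _ => mul_nonneg (by positivity) (hL i)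

theorem mul_le_weight {σ : Type*} [Fintype σ] {L : σ → ℚ} (hL : ∀ i, 0 ≤ L i) (α : σ →₀ ℕ)
    (i : σ) : (α i : ℚ) * L i ≤ Finsupp.weight L α := by
  rw [weight_eq_sum']
  exact Finset.single_le_sum (f := fun i => (α i : ℚ) * L i)
    (fun i _ => mul_nonneg (by positivity) (hL i)) (Finset.mem_univ i)

theorem weight_mono {σ : Type*} [Fintype σ] {L M : σ → ℚ} (h : ∀ i, L i ≤ M i) (α : σ →₀ ℕ) :
    Finsupp.weight L α ≤ Finsupp.weight M α := by
  rw [weight_eq_sum', weight_eq_sum']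
  exact Finset.sum_le_sum fun i _ => mul_le_mul_of_nonneg_left (h i) (by positivity)

theorem weight_congr {σ : Type*} [Fintype σ] {L M : σ → ℚ} {α : σ →₀ ℕ}
    (h : ∀ i, α i ≠ 0 → L i = M i) : Finsupp.weight L α = Finsupp.weight M α := by
  rw [weight_eq_sum', weight_eq_sum']
  refine Finset.sum_congr rfl fun i _ => ?_
  by_cases hi : α i = 0
  · simp [hi]
  · rw [h i hi]

/-- If `L ≤ M` and the weights of `α` agree, then `α` only involves variables where `L = M`. -/
theorem eq_zero_of_weight_le {σ : Type*} [Fintype σ] {L M : σ → ℚ} (h : ∀ i, L i ≤ M i)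
    {α : σ →₀ ℕ} (hα : Finsupp.weight M α ≤ Finsupp.weight L α) {i : σ} (hi : L i < M i) :
    α i = 0 := by
  by_contra h0
  refine absurd hα (not_le.2 ?_)
  rw [weight_eq_sum', weight_eq_sum']
  refine Finset.sum_lt_sum (fun i _ => mul_le_mul_of_nonneg_left (h i) (by positivity))
    ⟨i, Finset.mem_univ i, mul_lt_mul_of_pos_left hi (by positivity)⟩

theorem finite_weight_le {σ : Type*} [Fintype σ] {L : σ → ℚ} (hL : ∀ i, 0 < L i) (w : ℚ) :
    {α : σ →₀ ℕ | Finsupp.weight L α ≤ w}.Finite := by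
  classical
  have hfin : {g : σ → ℕ | ∀ i, g i ≤ ⌊w / L i⌋₊}.Finite := by
    have := Set.Finite.pi' (t := fun i : σ => Set.Iic ⌊w / L i⌋₊) fun i => Set.finite_Iic _
    exact this
  refine Set.Finite.of_finite_image (f := fun α : σ →₀ ℕ => (α : σ → ℕ)) (hfin.subset ?_)
    DFunLike.coe_injective.injOn
  rintro _ ⟨α, hα, rfl⟩ i
  refine Nat.le_floor ?_
  rw [le_div_iff₀ (hL i)]
  exact (mul_le_weight (fun i => (hL i).le) α i).trans hα

/-- All terms of the Taylor expansion of `g` at the origin have weight at least `w`. -/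
def OrdGE (L : Fin n → ℚ) (w : ℚ) (g : (Fin n → ℂ) → ℂ) : Prop :=
  ∀ α, coeffAt g α ≠ 0 → w ≤ Finsupp.weight L α

/-- The terms of weight `w` of the Taylor expansion of `g` at the origin. -/
def lead (L : Fin n → ℚ) (w : ℚ) (g : (Fin n → ℂ) → ℂ) : MvPolynomial (Fin n) ℂ :=
  ∑ᶠ (α : Fin n →₀ ℕ) (_ : Finsupp.weight L α = w), monomial α (coeffAt g α)

theorem coeff_finsum_monomial {σ : Type*} {p : (σ →₀ ℕ) → Prop} (hp : {α | p α}.Finite)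
    (c : (σ →₀ ℕ) → ℂ) (β : σ →₀ ℕ) [Decidable (p β)] :
    coeff β (∑ᶠ (α : σ →₀ ℕ) (_ : p α), monomial α (c α)) = if p β then c β else 0 := by
  classical
  have : (∑ᶠ (α : σ →₀ ℕ) (_ : p α), monomial α (c α)) =
      ∑ α ∈ hp.toFinset, monomial α (c α) := by
    rw [← finsum_mem_eq_finite_toFinset_sum]; rfl
  rw [this, coeff_sum]
  simp only [coeff_monomial, Finset.sum_ite_eq', Set.Finite.mem_toFinset, Set.mem_ofPred_eq]

theorem coeff_lead {L : Fin n → ℚ} (hL : ∀ i, 0 < L i) (w : ℚ) (g : (Fin n → ℂ) → ℂ)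
    (α : Fin n →₀ ℕ) :
    coeff α (lead L w g) = if Finsupp.weight L α = w then coeffAt g α else 0 :=
  coeff_finsum_monomial ((finite_weight_le hL w).subset fun _ h => le_of_eq h) _ _

theorem isWeightedHomogeneous_lead {L : Fin n → ℚ} (hL : ∀ i, 0 < L i) (w : ℚ)
    (g : (Fin n → ℂ) → ℂ) : (lead L w g).IsWeightedHomogeneous L w := by
  intro α hα
  rw [coeff_lead hL] at hα
  by_contra h
  simp [h] at hα

/-- The weighted dilation `z_i ↦ t^{λ_i} z_i`. -/
def scale (L : Fin n → ℚ) (t : ℝ) (z : Fin n → ℂ) : Fin n → ℂ :=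
  fun i => ((t ^ (L i : ℝ) : ℝ) : ℂ) * z i

theorem prod_rpow_weight (L : Fin n → ℚ) {t : ℝ} (ht : 0 < t) (α : Fin n →₀ ℕ) :
    ∏ i, (t ^ (L i : ℝ)) ^ α i = t ^ ((Finsupp.weight L α : ℚ) : ℝ) := by
  rw [weight_eq_sum', Rat.cast_sum, Real.rpow_sum_of_pos ht]
  refine Finset.prod_congr rfl fun i _ => ?_
  rw [← Real.rpow_natCast, ← Real.rpow_mul ht.le]
  push_cast
  rw [mul_comm]

theorem eval_scale_eq (L : Fin n → ℚ) {t : ℝ} (ht : 0 < t) (z : Fin n → ℂ)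
    (P : MvPolynomial (Fin n) ℂ) :
    eval (scale L t z) P = ∑ α ∈ P.support,
      ((t ^ ((Finsupp.weight L α : ℚ) : ℝ) : ℝ) : ℂ) * (coeff α P * ∏ i, z i ^ α i) := by
  rw [eval_eq']
  refine Finset.sum_congr rfl fun α _ => ?_
  rw [← prod_rpow_weight L ht]
  simp only [scale, mul_pow, Finset.prod_mul_distrib]
  push_cast
  ring

theorem norm_scale_le {L : Fin n → ℚ} {m : ℚ} (hm : ∀ i, m ≤ L i) {t : ℝ} (ht : 0 < t)
    (ht1 : t ≤ 1) (z : Fin n → ℂ) : ‖scale L t z‖ ≤ t ^ (m : ℝ) * ‖z‖ := by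
  refine (pi_norm_le_iff_of_nonneg (by positivity)).2 fun i => ?_
  rw [scale, norm_mul, Complex.norm_real, Real.norm_of_nonneg (by positivity)]
  exact mul_le_mul (Real.rpow_le_rpow_of_exponent_ge ht ht1 (by exact_mod_cast hm i))
    (norm_le_pi_norm z i) (norm_nonneg _) (by positivity)

theorem exists_pos_le {L : Fin n → ℚ} (hL : ∀ i, 0 < L i) : ∃ m : ℚ, 0 < m ∧ ∀ i, m ≤ L i := by
  by_cases h : Nonempty (Fin n)
  · obtain ⟨i, hi⟩ := Finite.exists_min L
    exact ⟨L i, hL i, hi⟩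
  · exact ⟨1, one_pos, fun i => (h ⟨i⟩).elim⟩

theorem tendsto_rpow_nhdsGT {a : ℝ} (ha : 0 < a) :
    Tendsto (fun t : ℝ => t ^ a) (𝓝[>] 0) (𝓝 0) := by
  have := (Real.continuousAt_rpow_const 0 a (Or.inr ha.le)).tendsto
  rw [Real.zero_rpow ha.ne'] at this
  exact this.mono_left nhdsWithin_le_nhds

theorem tendsto_scale {L : Fin n → ℚ} (hL : ∀ i, 0 < L i) (z₀ : Fin n → ℂ) :
    Tendsto (fun p : ℝ × (Fin n → ℂ) => scale L p.1 p.2) (𝓝[>] 0 ×ˢ 𝓝 z₀) (𝓝 0) := by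
  refine tendsto_pi_nhds.2 fun i => ?_
  have h1 : Tendsto (fun p : ℝ × (Fin n → ℂ) => ((p.1 ^ (L i : ℝ) : ℝ) : ℂ))
      (𝓝[>] 0 ×ˢ 𝓝 z₀) (𝓝 0) := by
    have := (tendsto_rpow_nhdsGT (a := (L i : ℝ)) (by exact_mod_cast hL i)).comp
      (tendsto_fst (f := 𝓝[>] (0 : ℝ)) (g := 𝓝 z₀))
    exact_mod_cast (Complex.continuous_ofReal.tendsto 0).comp this
  have h2 : Tendsto (fun p : ℝ × (Fin n → ℂ) => p.2 i) (𝓝[>] 0 ×ˢ 𝓝 z₀) (𝓝 (z₀ i)) :=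
    ((continuous_apply i).tendsto z₀).comp tendsto_snd
  simpa [scale] using h1.mul h2

/-- The dilations of a holomorphic function of order at least `w` converge to its leading
polynomial. -/
theorem OrdGE.tendsto {L : Fin n → ℚ} (hL : ∀ i, 0 < L i) {w : ℚ} {g : (Fin n → ℂ) → ℂ}
    (hg : AnalyticAt ℂ g 0) (h : OrdGE L w g) (z₀ : Fin n → ℂ) :
    Tendsto (fun p : ℝ × (Fin n → ℂ) => ((p.1 ^ (-w : ℝ) : ℝ) : ℂ) * g (scale L p.1 p.2))
      (𝓝[>] 0 ×ˢ 𝓝 z₀) (𝓝 (eval z₀ (lead L w g))) := by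
  obtain ⟨m, hm, hmL⟩ := exists_pos_le hL
  -- With `k * m > w` the remainder, of size `t ^ (k * m)`, is negligible against `t ^ w`, and every
  -- monomial of weight at most `w` has degree less than `k`.
  obtain ⟨k, hk⟩ := exists_nat_gt (w / m)
  have hkw : w < k * m := by rwa [div_lt_iff₀ hm] at hk
  obtain ⟨P, hP⟩ := exists_poly_isBigO hg k
  have hpos : ∀ᶠ p : ℝ × (Fin n → ℂ) in 𝓝[>] 0 ×ˢ 𝓝 z₀, 0 < p.1 ∧ p.1 ≤ 1 := by
    have h1 : ∀ᶠ t : ℝ in 𝓝[>] 0, 0 < t ∧ t ≤ 1 := Ioc_mem_nhdsGT one_pos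
    exact tendsto_fst.eventually h1
  -- the remainder
  have hR : Tendsto (fun p : ℝ × (Fin n → ℂ) => ((p.1 ^ (-w : ℝ) : ℝ) : ℂ) *
      (g (scale L p.1 p.2) - eval (scale L p.1 p.2) P)) (𝓝[>] 0 ×ˢ 𝓝 z₀) (𝓝 0) := by
    obtain ⟨A, hA⟩ := (hP.comp_tendsto (tendsto_scale hL z₀)).bound
    have hb : ∀ᶠ p : ℝ × (Fin n → ℂ) in 𝓝[>] 0 ×ˢ 𝓝 z₀, ‖p.2‖ ≤ ‖z₀‖ + 1 :=
      tendsto_snd.eventually (((continuous_norm.tendsto z₀).eventually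
        (gt_mem_nhds (lt_add_one _))).mono fun _ h => le_of_lt h)
    refine squeeze_zero_norm' (a := fun p => |A| * (p.1 ^ ((k * m - w : ℚ) : ℝ) *
      (‖z₀‖ + 1) ^ k)) ?_ ?_
    · filter_upwards [hpos, hA, hb] with p hp hp2 hp3
      rw [norm_mul, Complex.norm_real, Real.norm_of_nonneg (Real.rpow_nonneg hp.1.le _)]
      have h1 : ‖scale L p.1 p.2‖ ^ k ≤ (p.1 ^ (m : ℝ) * (‖z₀‖ + 1)) ^ k := by
        gcongr
        refine (norm_scale_le hmL hp.1 hp.2 p.2).trans ?_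
        gcongr
        exact Real.rpow_nonneg hp.1.le _
      have h2 : ‖g (scale L p.1 p.2) - eval (scale L p.1 p.2) P‖ ≤
          |A| * (p.1 ^ (m : ℝ) * (‖z₀‖ + 1)) ^ k := by
        refine hp2.trans ?_
        simp only [Function.comp_apply, norm_pow, norm_norm]
        exact mul_le_mul (le_abs_self A) h1 (by positivity) (abs_nonneg _)
      calc p.1 ^ (-w : ℝ) * ‖g (scale L p.1 p.2) - eval (scale L p.1 p.2) P‖
          ≤ p.1 ^ (-w : ℝ) * (|A| * (p.1 ^ (m : ℝ) * (‖z₀‖ + 1)) ^ k) := by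
            gcongr
            exact Real.rpow_nonneg hp.1.le _
        _ = |A| * (p.1 ^ ((k * m - w : ℚ) : ℝ) * (‖z₀‖ + 1) ^ k) := by
            rw [mul_pow, ← Real.rpow_natCast (p.1 ^ (m : ℝ)), ← Real.rpow_mul hp.1.le]
            push_cast
            rw [sub_eq_add_neg, Real.rpow_add hp.1, mul_comm (k : ℝ)]
            ring
    · have := (tendsto_rpow_nhdsGT (a := ((k * m - w : ℚ) : ℝ))
        (by exact_mod_cast sub_pos.2 hkw)).comp (tendsto_fst (f := 𝓝[>] (0 : ℝ)) (g := 𝓝 z₀))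
      simpa using (this.mul_const ((‖z₀‖ + 1) ^ k)).const_mul |A|
  -- the polynomial part
  have hc : ∀ α : Fin n →₀ ℕ, α.degree < k → coeff α P = coeffAt g α := fun α hα =>
    (coeffAt_eq_coeff hg hP hα).symm
  have hdeg : ∀ α : Fin n →₀ ℕ, Finsupp.weight L α ≤ w → α.degree < k := by
    intro α hα
    by_contra hge
    have h1 : (k : ℚ) * m ≤ Finsupp.weight L α := by
      rw [weight_eq_sum']
      calc (k : ℚ) * m ≤ (α.degree : ℚ) * m := by
            gcongr; exact_mod_cast not_lt.1 hge
        _ = ∑ i, (α i : ℚ) * m := by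
            rw [Finsupp.degree_eq_sum, ← Finset.sum_mul]; push_cast; rfl
        _ ≤ ∑ i, (α i : ℚ) * L i :=
            Finset.sum_le_sum fun i _ => mul_le_mul_of_nonneg_left (hmL i) (by positivity)
    linarith
  have hPt : Tendsto (fun p : ℝ × (Fin n → ℂ) => ((p.1 ^ (-w : ℝ) : ℝ) : ℂ) *
      eval (scale L p.1 p.2) P) (𝓝[>] 0 ×ˢ 𝓝 z₀) (𝓝 (eval z₀ (lead L w g))) := by
    have hlead : eval z₀ (lead L w g) = ∑ α ∈ P.support,
        (if Finsupp.weight L α = w then 1 else 0) * (coeff α P * ∏ i, z₀ i ^ α i) := by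
      have hQ : lead L w g = ∑ α ∈ P.support,
          monomial α (if Finsupp.weight L α = w then coeff α P else 0) := by
        ext β
        rw [coeff_lead hL, coeff_sum]
        simp only [coeff_monomial, Finset.sum_ite_eq', mem_support_iff]
        by_cases hβ : Finsupp.weight L β = w
        · simp only [hβ, if_true]
          rw [hc β (hdeg β hβ.le)]
          split_ifs with h0
          · rfl
          · simpa using h0
        · simp [hβ]
      rw [hQ, map_sum]
      refine Finset.sum_congr rfl fun α _ => ?_
      rw [eval_monomial, Finsupp.prod_fintype _ _ (by simp)]
      split_ifs <;> simp
    rw [hlead]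
    have hev : (fun p : ℝ × (Fin n → ℂ) => ∑ α ∈ P.support,
        ((p.1 ^ ((Finsupp.weight L α - w : ℚ) : ℝ) : ℝ) : ℂ) * (coeff α P * ∏ i, p.2 i ^ α i))
        =ᶠ[𝓝[>] 0 ×ˢ 𝓝 z₀] fun p => ((p.1 ^ (-w : ℝ) : ℝ) : ℂ) * eval (scale L p.1 p.2) P := by
      filter_upwards [hpos] with p hp
      rw [eval_scale_eq L hp.1, Finset.mul_sum]
      refine Finset.sum_congr rfl fun α _ => ?_
      rw [← mul_assoc ((p.1 ^ (-w : ℝ) : ℝ) : ℂ), ← Complex.ofReal_mul, ← Real.rpow_add hp.1]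
      congr 4
      push_cast; ring
    refine Tendsto.congr' hev (tendsto_finsetSum _ fun α hα => ?_)
    have hz : Tendsto (fun p : ℝ × (Fin n → ℂ) => coeff α P * ∏ i, p.2 i ^ α i)
        (𝓝[>] 0 ×ˢ 𝓝 z₀) (𝓝 (coeff α P * ∏ i, z₀ i ^ α i)) := by
      have : Continuous fun z : Fin n → ℂ => coeff α P * ∏ i, z i ^ α i := by fun_prop
      exact (this.tendsto z₀).comp tendsto_snd
    refine Tendsto.mul ?_ hz
    rcases lt_trichotomy (Finsupp.weight L α) w with hlt | heq | hgt
    · exfalso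
      rw [mem_support_iff, hc α (hdeg α hlt.le)] at hα
      exact absurd (h α hα) (not_le.2 hlt)
    · simp [heq]
    · rw [if_neg hgt.ne']
      have := (tendsto_rpow_nhdsGT (a := ((Finsupp.weight L α - w : ℚ) : ℝ))
        (by exact_mod_cast sub_pos.2 hgt)).comp (tendsto_fst (f := 𝓝[>] (0 : ℝ)) (g := 𝓝 z₀))
      exact_mod_cast (Complex.continuous_ofReal.tendsto 0).comp this
  have := hR.add hPt
  rw [zero_add] at this
  refine this.congr fun p => ?_
  ring

theorem OrdGE.tendsto_at {L : Fin n → ℚ} (hL : ∀ i, 0 < L i) {w : ℚ} {g : (Fin n → ℂ) → ℂ}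
    (hg : AnalyticAt ℂ g 0) (h : OrdGE L w g) (z : Fin n → ℂ) :
    Tendsto (fun t : ℝ => ((t ^ (-w : ℝ) : ℝ) : ℂ) * g (scale L t z))
      (𝓝[>] 0) (𝓝 (eval z (lead L w g))) := by
  have h1 : Tendsto (fun t : ℝ => (t, z)) (𝓝[>] 0) (𝓝[>] 0 ×ˢ 𝓝 z) :=
    tendsto_id.prodMk tendsto_const_nhds
  have h2 := (h.tendsto hL hg z).comp h1
  simpa only [Function.comp_def] using h2

theorem poly_eq_of_eval {P Q : MvPolynomial (Fin n) ℂ} (h : ∀ z, eval z P = eval z Q) : P = Q :=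
  MvPolynomial.funext h

/-- If the dilations of a holomorphic function converge, then its order is at least `w` and the
limit is its leading polynomial. -/
theorem ordGE_of_tendsto {L : Fin n → ℚ} (hL : ∀ i, 0 < L i) {w : ℚ} {g : (Fin n → ℂ) → ℂ}
    (hg : AnalyticAt ℂ g 0) {F : MvPolynomial (Fin n) ℂ}
    (h : ∀ z, Tendsto (fun t : ℝ => ((t ^ (-w : ℝ) : ℝ) : ℂ) * g (scale L t z))
      (𝓝[>] 0) (𝓝 (eval z F))) : OrdGE L w g ∧ lead L w g = F := by
  have hord : OrdGE L w g := by
    -- Otherwise let `v < w` be the least weight that occurs. The dilations normalised by `t ^ (-v)`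
    -- tend to the nonzero part of weight `v`, but also to zero, being `t ^ (w - v)` times a
    -- convergent quantity.
    by_contra hcon
    rw [OrdGE] at hcon
    push Not at hcon
    obtain ⟨α₀, hα₀, hw₀⟩ := hcon
    have hfin : {α : Fin n →₀ ℕ | coeffAt g α ≠ 0 ∧ Finsupp.weight L α < w}.Finite :=
      (finite_weight_le hL w).subset fun α h => h.2.le
    obtain ⟨α, hα, hmin⟩ := Set.exists_min_image _ (Finsupp.weight L) hfin ⟨α₀, hα₀, hw₀⟩
    set v := Finsupp.weight L α with hv
    have hvord : OrdGE L v g := by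
      intro β hβ
      by_contra hlt
      exact hlt (hmin β ⟨hβ, (not_le.1 hlt).trans hα.2⟩)
    have hzero : lead L v g = 0 := by
      refine poly_eq_of_eval fun z => ?_
      have h1 := hvord.tendsto_at hL hg z
      have h2 := (((Complex.continuous_ofReal.tendsto 0).comp (tendsto_rpow_nhdsGT
        (a := ((w - v : ℚ) : ℝ)) (by exact_mod_cast sub_pos.2 hα.2))).mul (h z))
      refine (tendsto_nhds_unique h1 (h2.congr' ?_)).trans (by simp)
      filter_upwards [self_mem_nhdsWithin] with t ht
      rw [Function.comp_apply, ← mul_assoc, ← Complex.ofReal_mul, ← Real.rpow_add ht]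
      congr 4
      push_cast; ring
    have := coeff_lead hL v g α
    rw [hzero, if_pos hv.symm, coeff_zero] at this
    exact hα.1 this.symm
  exact ⟨hord, poly_eq_of_eval fun z => tendsto_nhds_unique (hord.tendsto_at hL hg z) (h z)⟩

/-- The map `b` does not decrease weights: `b_i` has order at least `λ_i`. -/
def WeightNonneg (L : Fin n → ℚ) (b : (Fin n → ℂ) → Fin n → ℂ) : Prop :=
  ∀ i, OrdGE L (L i) fun z => b z i

/-- The leading part of a map which does not decrease weights. -/
def leadMap (L : Fin n → ℚ) (b : (Fin n → ℂ) → Fin n → ℂ) : Fin n → MvPolynomial (Fin n) ℂ :=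
  fun i => lead L (L i) fun z => b z i

theorem analyticAt_apply {b : (Fin n → ℂ) → Fin n → ℂ} {z : Fin n → ℂ} (hb : AnalyticAt ℂ b z)
    (i : Fin n) : AnalyticAt ℂ (fun z => b z i) z :=
  analyticAt_pi_iff.1 hb i

/-- Write `b(δ_t z) = δ_t(z_t)` with `δ_t` the dilation. The points `z_t` tend to the value of the
leading map at `z`, and the convergence in `OrdGE.tendsto` is joint in `t` and the point, so it
applies along the moving point. -/
theorem OrdGE.comp {L : Fin n → ℚ} (hL : ∀ i, 0 < L i) {w : ℚ} {g : (Fin n → ℂ) → ℂ}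
    (hg : AnalyticAt ℂ g 0) (h : OrdGE L w g) {b : (Fin n → ℂ) → Fin n → ℂ}
    (hb : AnalyticAt ℂ b 0) (hb0 : b 0 = 0) (hbL : WeightNonneg L b) :
    OrdGE L w (g ∘ b) ∧ lead L w (g ∘ b) = bind₁ (leadMap L b) (lead L w g) := by
  refine ordGE_of_tendsto hL (AnalyticAt.comp (by rwa [hb0]) hb) fun z => ?_
  have h1 : Tendsto (fun t : ℝ => fun i => ((t ^ (-L i : ℝ) : ℝ) : ℂ) * b (scale L t z) i) (𝓝[>] 0)
      (𝓝 (fun i => eval z (leadMap L b i))) :=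
    tendsto_pi_nhds.2 fun i => (hbL i).tendsto_at hL (analyticAt_apply hb i) z
  have h2 := (h.tendsto hL hg (fun i => eval z (leadMap L b i))).comp (tendsto_id.prodMk h1)
  have h3 : eval z (bind₁ (leadMap L b) (lead L w g)) =
      eval (fun i => eval z (leadMap L b i)) (lead L w g) := by
    rw [← aeval_eq_eval, ← aeval_eq_eval]
    simp only [aeval_bind₁]
  rw [h3]
  refine h2.congr' ?_
  filter_upwards [self_mem_nhdsWithin] with t ht
  have ht' : (0 : ℝ) < t := ht
  simp only [Function.comp_apply, id_eq]
  congr 2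
  funext i
  rw [scale, ← mul_assoc, ← Complex.ofReal_mul, ← Real.rpow_add ht']
  simp

end

section

variable {n N : ℕ}

/-! ### Weighted homogeneous polynomials and changes of variables -/

theorem pderiv_bind₁ (ψ : Fin n → MvPolynomial (Fin n) ℂ) (p : MvPolynomial (Fin n) ℂ) (i : Fin n) :
    pderiv i (bind₁ ψ p) = ∑ l, bind₁ ψ (pderiv l p) * pderiv i (ψ l) := by
  induction p using MvPolynomial.induction_on with
  | C a => simp
  | add p q hp hq => simp [hp, hq, add_mul, Finset.sum_add_distrib]
  | mul_X p j hp =>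
    have h1 : ∀ l, bind₁ ψ (pderiv l (p * X j)) * pderiv i (ψ l) =
        bind₁ ψ (pderiv l p) * pderiv i (ψ l) * ψ j +
          if l = j then bind₁ ψ p * pderiv i (ψ l) else 0 := by
      intro l
      rw [pderiv_mul, map_add, map_mul, map_mul, bind₁_X_right]
      split_ifs with h
      · subst h; rw [pderiv_X_self, map_one]; ring
      · rw [pderiv_X_of_ne (Ne.symm h), map_zero]; ring
    rw [Finset.sum_congr rfl fun l _ => h1 l, Finset.sum_add_distrib, ← Finset.sum_mul, ← hp,
      Finset.sum_ite_eq' Finset.univ j, if_pos (Finset.mem_univ j), map_mul, bind₁_X_right,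
      pderiv_mul]

theorem coeff_eq_zero_of_pderiv {p : MvPolynomial (Fin n) ℂ} {i : Fin n} (h : pderiv i p = 0)
    {α : Fin n →₀ ℕ} (hα : α i ≠ 0) : coeff α p = 0 := by
  have h1 := coeff_pderiv (i := i) p (α - Finsupp.single i 1)
  rw [h, coeff_zero, tsub_add_cancel_of_le (by simpa [Nat.one_le_iff_ne_zero] using hα)] at h1
  rcases mul_eq_zero.1 h1.symm with h2 | h2
  · exact h2
  · exact absurd h2 (Nat.cast_add_one_ne_zero _)

theorem mem_vars_iff_pderiv_ne_zero (p : MvPolynomial (Fin n) ℂ) (i : Fin n) :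
    i ∈ p.vars ↔ pderiv i p ≠ 0 := by
  refine ⟨fun h h0 => ?_, fun h => by_contra fun h' => h (pderiv_eq_zero_of_notMem_vars h')⟩
  obtain ⟨d, hd, hid⟩ := (mem_vars_iff_mem_support i).1 h
  exact mem_support_iff.1 hd (coeff_eq_zero_of_pderiv h0 (Finsupp.mem_support_iff.1 hid))

theorem pderiv_eq_zero_of_coeff {p : MvPolynomial (Fin n) ℂ} {i : Fin n}
    (h : ∀ α : Fin n →₀ ℕ, α i ≠ 0 → coeff α p = 0) : pderiv i p = 0 := by
  ext β
  rw [coeff_pderiv, h _ (by simp), coeff_zero, zero_mul]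

theorem isWeightedHomogeneous_bind₁ {L : Fin n → ℚ} {w : ℚ} {ψ : Fin n → MvPolynomial (Fin n) ℂ}
    (hψ : ∀ i, (ψ i).IsWeightedHomogeneous L (L i)) {p : MvPolynomial (Fin n) ℂ}
    (hp : p.IsWeightedHomogeneous L w) : (bind₁ ψ p).IsWeightedHomogeneous L w := by
  rw [p.as_sum, map_sum]
  refine IsWeightedHomogeneous.sum _ _ _ fun α hα => ?_
  rw [bind₁_monomial]
  refine IsWeightedHomogeneous.C_mul ?_ _
  have := IsWeightedHomogeneous.prod α.support (fun i => ψ i ^ α i) (fun i => α i • L i)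
    fun i _ => (hψ i).pow (α i)
  rw [← hp (mem_support_iff.1 hα)]
  exact this

theorem isWeightedHomogeneous_pderiv {L : Fin n → ℚ} {w : ℚ} {p : MvPolynomial (Fin n) ℂ}
    (hp : p.IsWeightedHomogeneous L w) (i : Fin n) :
    (pderiv i p).IsWeightedHomogeneous L (w - L i) := by
  intro α hα
  rw [coeff_pderiv] at hα
  have := hp (left_ne_zero_of_mul hα)
  rw [map_add, Finsupp.weight_single, one_smul] at this
  linarith

/-- All monomials of `p` have weight less than `w`. -/
def SuppLT (L : Fin n → ℚ) (w : ℚ) (p : MvPolynomial (Fin n) ℂ) : Prop :=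
  ∀ α ∈ p.support, Finsupp.weight L α < w

/-- All monomials of `p` have weight at most `w`. -/
def SuppLE (L : Fin n → ℚ) (w : ℚ) (p : MvPolynomial (Fin n) ℂ) : Prop :=
  ∀ α ∈ p.support, Finsupp.weight L α ≤ w

theorem SuppLE.mul {L : Fin n → ℚ} {v w : ℚ} {p q : MvPolynomial (Fin n) ℂ} (hp : SuppLE L v p)
    (hq : SuppLE L w q) : SuppLE L (v + w) (p * q) := by
  classical
  intro α hα
  obtain ⟨a, ha, b, hb, rfl⟩ := Finset.mem_add.1 (support_mul p q hα)
  rw [map_add]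
  exact add_le_add (hp a ha) (hq b hb)

theorem SuppLT.mul {L : Fin n → ℚ} {v w : ℚ} {p q : MvPolynomial (Fin n) ℂ} (hp : SuppLT L v p)
    (hq : SuppLE L w q) : SuppLT L (v + w) (p * q) := by
  classical
  intro α hα
  obtain ⟨a, ha, b, hb, rfl⟩ := Finset.mem_add.1 (support_mul p q hα)
  rw [map_add]
  exact add_lt_add_of_lt_of_le (hp a ha) (hq b hb)

theorem SuppLT.sum {L : Fin n → ℚ} {w : ℚ} {ι : Type*} {s : Finset ι}
    {p : ι → MvPolynomial (Fin n) ℂ} (h : ∀ i ∈ s, SuppLT L w (p i)) :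
    SuppLT L w (∑ i ∈ s, p i) := by
  classical
  intro α hα
  obtain ⟨i, hi, hα'⟩ := Finset.mem_biUnion.1 (support_sum hα)
  exact h i hi α hα'

theorem SuppLE.pow {L : Fin n → ℚ} {v : ℚ} {p : MvPolynomial (Fin n) ℂ} (hp : SuppLE L v p)
    (m : ℕ) : SuppLE L (m • v) (p ^ m) := by
  induction m with
  | zero =>
    intro α hα
    rw [pow_zero, mem_support_iff, coeff_one] at hα
    have : α = 0 := by by_contra h; exact hα (if_neg (Ne.symm h))
    simp [this]
  | succ m ih => rw [pow_succ, succ_nsmul]; exact ih.mul hp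

theorem SuppLE.prod {L : Fin n → ℚ} {ι : Type*} (s : Finset ι) {v : ι → ℚ}
    {p : ι → MvPolynomial (Fin n) ℂ} (h : ∀ i ∈ s, SuppLE L (v i) (p i)) :
    SuppLE L (∑ i ∈ s, v i) (∏ i ∈ s, p i) := by
  classical
  induction s using Finset.induction_on with
  | empty =>
    intro α hα
    rw [Finset.prod_empty, mem_support_iff, coeff_one] at hα
    have : α = 0 := by by_contra h; exact hα (if_neg (Ne.symm h))
    simp [this]
  | insert i s hi ih =>
    rw [Finset.sum_insert hi, Finset.prod_insert hi]
    exact (h i (by simp)).mul (ih fun j hj => h j (by simp [hj]))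

theorem SuppLT.bind₁ {L M : Fin n → ℚ} {w : ℚ} {p : MvPolynomial (Fin n) ℂ} (hp : SuppLT L w p)
    {ψ : Fin n → MvPolynomial (Fin n) ℂ} (hψ : ∀ i, SuppLE M (L i) (ψ i)) :
    SuppLT M w (MvPolynomial.bind₁ ψ p) := by
  rw [p.as_sum, map_sum]
  refine SuppLT.sum fun α hα => ?_
  rw [bind₁_monomial]
  intro β hβ
  have h1 := SuppLE.prod α.support (v := fun i => α i • L i) (p := fun i => ψ i ^ α i)
    fun i _ => (hψ i).pow (α i)
  have h2 : β ∈ (∏ i ∈ α.support, ψ i ^ α i).support := by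
    rw [mem_support_iff] at hβ ⊢
    rw [coeff_C_mul] at hβ
    exact right_ne_zero_of_mul hβ
  exact (h1 β h2).trans_lt (hp α hα)

theorem SuppLE.pderiv {L : Fin n → ℚ} {w : ℚ} {p : MvPolynomial (Fin n) ℂ} (hp : SuppLE L w p)
    (i : Fin n) : SuppLE L (w - L i) (MvPolynomial.pderiv i p) := by
  intro α hα
  rw [mem_support_iff, coeff_pderiv] at hα
  have := hp _ (mem_support_iff.2 (left_ne_zero_of_mul hα))
  rw [map_add, Finsupp.weight_single, one_smul] at this
  linarith

theorem polyMap_bind₁ (ψ χ : Fin n → MvPolynomial (Fin n) ℂ) :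
    polyMap (fun i => bind₁ ψ (χ i)) = polyMap χ ∘ polyMap ψ := by
  funext z i
  simp only [polyMap, Function.comp_apply]
  rw [← aeval_eq_eval, ← aeval_eq_eval]
  simp only [aeval_bind₁]
  rfl

theorem IsHomogeneousChange.comp {L : Fin n → ℚ} {ψ β : Fin n → MvPolynomial (Fin n) ℂ}
    (hψ : IsHomogeneousChange L ψ) (hβ : IsHomogeneousChange L β) :
    IsHomogeneousChange L fun i => bind₁ β (ψ i) := by
  obtain ⟨h1, χ, h2, h3, h4⟩ := hψ
  obtain ⟨k1, η, k2, k3, k4⟩ := hβ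
  refine ⟨fun i => isWeightedHomogeneous_bind₁ k1 (h1 i), fun i => bind₁ χ (η i),
    fun i => isWeightedHomogeneous_bind₁ h2 (k2 i), fun i => ?_, fun i => ?_⟩
  · have hX : (fun i => bind₁ ψ (χ i)) = X := funext h3
    rw [← bind₁_bind₁ ψ β, bind₁_bind₁ χ ψ, hX, bind₁_X_left, AlgHom.id_apply, k3]
  · have hX : (fun i => bind₁ η (β i)) = X := funext k4
    rw [← bind₁_bind₁ η χ, bind₁_bind₁ β η, hX, bind₁_X_left, AlgHom.id_apply, h4]

theorem isHomogeneousChange_id (L : Fin n → ℚ) : IsHomogeneousChange L X :=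
  ⟨fun i => isWeightedHomogeneous_X _ _ i, X, fun i => isWeightedHomogeneous_X _ _ i,
    fun i => by simp, fun i => by simp⟩

theorem analyticAt_polyMap (ψ : Fin n → MvPolynomial (Fin n) ℂ) (z : Fin n → ℂ) :
    AnalyticAt ℂ (polyMap ψ) z :=
  analyticAt_pi_iff.2 fun i => analyticAt_eval (ψ i) z

theorem fderiv_apply_eq {b : (Fin n → ℂ) → Fin n → ℂ} (hb : AnalyticAt ℂ b 0) (v : Fin n → ℂ)
    (i : Fin n) :
    fderiv ℂ b 0 v i = ∑ l, coeffAt (fun z => b z i) (Finsupp.single l 1) * v l := by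
  have h1 : fderiv ℂ b 0 v i = fderiv ℂ (fun z => b z i) 0 v := by
    have := (hasFDerivAt_pi'.1 hb.differentiableAt.hasFDerivAt i).fderiv
    rw [this]; rfl
  have hv : v = ∑ l, v l • (Pi.single l 1 : Fin n → ℂ) := by
    funext j; simp [Finset.sum_apply, Pi.single_apply]
  rw [h1]
  conv_lhs => rw [hv]
  rw [map_sum]
  refine Finset.sum_congr rfl fun l _ => ?_
  have h2 := coeffAt_pd (analyticAt_apply hb i) l 0
  rw [coeffAt_zero (analyticAt_pd (analyticAt_apply hb i) l)] at h2
  simp only [zero_add, Finsupp.coe_zero, Pi.zero_apply, Nat.cast_zero, mul_one] at h2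
  rw [← h2, map_smul, smul_eq_mul, mul_comm]
  rfl

/-- With surjective differential at the fixed point `0`, the map is open there, so `P ∘ β = 0` makes
`P` vanish near the origin. -/
theorem bind₁_injective {β : Fin n → MvPolynomial (Fin n) ℂ} (hβ0 : polyMap β 0 = 0)
    (hβ : Function.Surjective (fderiv ℂ (polyMap β) 0)) : Function.Injective (bind₁ β) := by
  rw [injective_iff_map_eq_zero]
  intro P hP
  have hs : HasStrictFDerivAt (polyMap β) (fderiv ℂ (polyMap β) 0) 0 :=
    (analyticAt_polyMap β 0).hasStrictFDerivAt
  have hmap := hs.map_nhds_eq_of_surj (LinearMap.range_eq_top.2 hβ)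
  have h0 : (fun z => eval z P) =ᶠ[𝓝 0] fun z => eval z (0 : MvPolynomial (Fin n) ℂ) := by
    rw [hβ0] at hmap
    rw [← hmap]
    refine eventually_map.2 (Eventually.of_forall fun z => ?_)
    have : eval z (bind₁ β P) = eval (polyMap β z) P := by
      rw [← aeval_eq_eval, ← aeval_eq_eval]
      simp only [aeval_bind₁]
      rfl
    simp only [map_zero, ← this, hP]
  ext α
  rw [← coeffAt_eval, ← coeffAt_eval, coeffAt_congr (analyticAt_eval P 0) h0]

theorem polyMap_zero_of_homogeneous {L : Fin n → ℚ} (hL : ∀ i, 0 < L i)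
    {β : Fin n → MvPolynomial (Fin n) ℂ} (hβ : ∀ i, (β i).IsWeightedHomogeneous L (L i)) :
    polyMap β 0 = 0 := by
  funext i
  rw [polyMap, eval_zero, constantCoeff_eq]
  by_contra h
  have := hβ i h
  rw [map_zero] at this
  exact (hL i).ne this

/-- A weighted homogeneous polynomial map with invertible linear part has a weighted homogeneous
polynomial inverse. -/
theorem isHomogeneousChange_of_surjective {L : Fin n → ℚ} (hL : ∀ i, 0 < L i)
    {β : Fin n → MvPolynomial (Fin n) ℂ} (hβ : ∀ i, (β i).IsWeightedHomogeneous L (L i))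
    (hs : Function.Surjective (fderiv ℂ (polyMap β) 0)) : IsHomogeneousChange L β := by
  have hinj := bind₁_injective (polyMap_zero_of_homogeneous hL hβ) hs
  have hsurj : ∀ i, ∃ p : MvPolynomial (Fin n) ℂ, p.IsWeightedHomogeneous L (L i) ∧
      bind₁ β p = X i := by
    intro i
    -- Substitution of `β` preserves this finite-dimensional space of polynomials of weight `λ_i`;
    -- being injective, it is onto, and `X i` has a preimage.
    let W := weightedHomogeneousSubmodule ℂ L (L i)
    have hfin : Module.Finite ℂ W := by
      have hf : {α : Fin n →₀ ℕ | Finsupp.weight L α = L i}.Finite :=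
        (finite_weight_le hL (L i)).subset fun _ h => le_of_eq h
      have := hf.to_subtype
      have hW : W.FG := by
        simp only [W]
        rw [weightedHomogeneousSubmodule_eq_finsupp_supported, ← Module.Finite.iff_fg]
        exact Module.Finite.of_basis
          (basisRestrictSupport ℂ {α : Fin n →₀ ℕ | Finsupp.weight L α = L i})
      exact Module.Finite.iff_fg.2 hW
    let T : W →ₗ[ℂ] W := (bind₁ β).toLinearMap.restrict fun p hp =>
      isWeightedHomogeneous_bind₁ hβ hp
    have hT : Function.Injective T := fun p q h => Subtype.ext (hinj (congrArg Subtype.val h))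
    obtain ⟨p, hp⟩ := (LinearMap.injective_iff_surjective.1 hT) ⟨X i, isWeightedHomogeneous_X _ _ i⟩
    exact ⟨p, p.2, congrArg Subtype.val hp⟩
  choose χ hχ1 hχ2 using hsurj
  refine ⟨hβ, χ, hχ1, hχ2, fun i => hinj ?_⟩
  rw [bind₁_bind₁, show (fun i => bind₁ β (χ i)) = X from funext hχ2]
  simp

/-- The leading part of a local biholomorphism which does not decrease weights is a weighted
homogeneous change of variables. -/
theorem isHomogeneousChange_leadMap {L : Fin n → ℚ} (hL : ∀ i, 0 < L i)
    {b : (Fin n → ℂ) → Fin n → ℂ} (hb : AnalyticAt ℂ b 0)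
    (hbij : Function.Bijective (fderiv ℂ b 0)) (hbL : WeightNonneg L b) :
    IsHomogeneousChange L (leadMap L b) := by
  refine isHomogeneousChange_of_surjective hL (fun i => isWeightedHomogeneous_lead hL _ _) ?_
  let J : Matrix (Fin n) (Fin n) ℂ := fun i l => coeffAt (fun z => b z i) (Finsupp.single l 1)
  let K : Matrix (Fin n) (Fin n) ℂ := fun i l => coeff (Finsupp.single l 1) (leadMap L b i)
  have hJ : ∀ v, fderiv ℂ b 0 v = J.mulVec v := fun v => funext fun i => fderiv_apply_eq hb v i
  have hK : ∀ v, fderiv ℂ (polyMap (leadMap L b)) 0 v = K.mulVec v := fun v => funext fun i => by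
    rw [fderiv_apply_eq (analyticAt_polyMap _ 0)]
    exact Finset.sum_congr rfl fun l _ => congrArg (· * v l) (coeffAt_eval _ _)
  have hKJ : ∀ i l, K i l = if L l = L i then J i l else 0 := fun i l => by
    simp only [K, J, leadMap, coeff_lead hL, Finsupp.weight_single, one_smul]
  have hJ0 : ∀ i l, J i l ≠ 0 → L i ≤ L l := fun i l h => by
    have := hbL i _ h
    rwa [Finsupp.weight_single, one_smul] at this
  -- A permutation that contributes to `det J` satisfies `L (σ i) ≤ L i` for all `i`. Both sides
  -- have the same sum, so equality holds throughout, and only entries kept by the leading part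
  -- contribute.
  have hdet : K.det = J.det := by
    rw [Matrix.det_apply, Matrix.det_apply]
    refine Finset.sum_congr rfl fun σ _ => ?_
    congr 1
    by_cases h : ∀ i, J (σ i) i ≠ 0
    · have hle : ∀ i ∈ Finset.univ, L (σ i) ≤ L i := fun i _ => hJ0 _ _ (h i)
      have heq := (Finset.sum_eq_sum_iff_of_le hle).1 (Equiv.sum_comp σ L)
      exact Finset.prod_congr rfl fun i hi => by rw [hKJ, if_pos (heq i hi).symm]
    · push Not at h
      obtain ⟨i, hi⟩ := h
      have hi' : K (σ i) i = 0 := by rw [hKJ, hi, ite_self]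
      exact (Finset.prod_eq_zero (f := fun i => K (σ i) i) (Finset.mem_univ i) hi').trans
        (Finset.prod_eq_zero (f := fun i => J (σ i) i) (Finset.mem_univ i) hi).symm
  have hJu : IsUnit J.det := by
    rw [← Matrix.isUnit_iff_isUnit_det, ← Matrix.mulVec_surjective_iff_isUnit]
    intro v
    obtain ⟨u, hu⟩ := hbij.2 v
    exact ⟨u, by rw [← hJ, hu]⟩
  rw [← hdet, ← Matrix.isUnit_iff_isUnit_det, ← Matrix.mulVec_surjective_iff_isUnit] at hJu
  intro v
  obtain ⟨u, hu⟩ := hJu v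
  exact ⟨u, by rw [hK, hu]⟩

end

section

variable {n N : ℕ}

/-! ### Vector fields of negative weight that annihilate a tuple of polynomials -/

/-- The weight `Λ` restricted to the first `k` variables. -/
def headW (k : ℕ) (L : Fin n → ℚ) : Fin n → ℚ := fun i => if i.val < k then L i else 0

theorem headW_le {L : Fin n → ℚ} (hL : ∀ i, 0 ≤ L i) (k : ℕ) (i : Fin n) : headW k L i ≤ L i := by
  unfold headW; split_ifs <;> simp [hL]

theorem headW_nonneg {L : Fin n → ℚ} (hL : ∀ i, 0 ≤ L i) (k : ℕ) (i : Fin n) :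
    0 ≤ headW k L i := by
  unfold headW; split_ifs <;> simp [hL]

/-- No nonzero polynomial vector field of negative weight in the directions of the first `k`
variables annihilates all the `F_j`. -/
def NoNegField (k : ℕ) (L : Fin n → ℚ) (F : Fin N → MvPolynomial (Fin n) ℂ) : Prop :=
  ∀ Y : Fin n → MvPolynomial (Fin n) ℂ, (∀ i, k ≤ i.val → Y i = 0) →
    (∀ i, SuppLT (headW k L) (L i) (Y i)) → (∀ j, ∑ i, Y i * pderiv i (F j) = 0) → ∀ i, Y i = 0

/-- The number of variables on which none of the `F_j` depends. -/
def freeCount (F : Fin N → MvPolynomial (Fin n) ℂ) : ℕ := {i | ∀ j, pderiv i (F j) = 0}.ncard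

/-- The entries of `L` from the `k`-th on are equal to `τ`, the earlier ones are larger. -/
def TailConst (k : ℕ) (τ : ℚ) (L : Fin n → ℚ) : Prop :=
  (∀ i, k ≤ i.val → L i = τ) ∧ ∀ i, i.val < k → τ < L i

theorem TailConst.le {k : ℕ} {τ : ℚ} {L : Fin n → ℚ} (h : TailConst k τ L) (i : Fin n) :
    τ ≤ L i := by
  rcases lt_or_ge i.val k with hi | hi
  · exact (h.2 i hi).le
  · exact (h.1 i hi).ge

theorem TailConst.eq_zero_of_weight {k : ℕ} {τ : ℚ} {L : Fin n → ℚ} (h : TailConst k τ L)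
    (hτ : 0 < τ) {α : Fin n →₀ ℕ} (hα : Finsupp.weight L α ≤ τ) {i : Fin n} (hi : i.val < k) :
    α i = 0 := by
  by_contra h0
  have h1 := mul_le_weight (fun i => (hτ.trans_le (h.le i)).le) α i
  have h2 : (1 : ℚ) ≤ α i := by exact_mod_cast Nat.one_le_iff_ne_zero.2 h0
  nlinarith [h.2 i hi, h.le i]

/-- Tail variables weigh zero for `headW`. A polynomial of weight `τ` contains no head variable,
since these weigh more than `τ`, so its head weight is zero. Hence homogeneous changes do not raise
head weights. -/
theorem suppLE_headW {k : ℕ} {τ : ℚ} {L : Fin n → ℚ} (h : TailConst k τ L) (hτ : 0 < τ)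
    {i : Fin n} {p : MvPolynomial (Fin n) ℂ} (hp : p.IsWeightedHomogeneous L (L i)) :
    SuppLE (headW k L) (headW k L i) p := by
  intro α hα
  have hw := hp (mem_support_iff.1 hα)
  have hL : ∀ i, 0 ≤ L i := fun i => (hτ.trans_le (h.le i)).le
  rcases lt_or_ge i.val k with hi | hi
  · rw [headW, if_pos hi, ← hw]
    exact weight_mono (headW_le hL k) α
  · rw [headW, if_neg (not_lt.2 hi), weight_eq_sum']
    refine (Finset.sum_eq_zero fun l _ => ?_).le
    rcases lt_or_ge l.val k with hl | hl
    · rw [h.eq_zero_of_weight hτ (hw.trans (h.1 i hi)).le hl]; simp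
    · rw [headW, if_neg (not_lt.2 hl), mul_zero]

theorem pderiv_eq_zero_of_tail {k : ℕ} {τ : ℚ} {L : Fin n → ℚ} (h : TailConst k τ L) (hτ : 0 < τ)
    {i : Fin n} (hi : k ≤ i.val) {p : MvPolynomial (Fin n) ℂ}
    (hp : p.IsWeightedHomogeneous L (L i)) {l : Fin n} (hl : l.val < k) : pderiv l p = 0 :=
  pderiv_eq_zero_of_coeff fun α hα => by
    by_contra h0
    exact hα (h.eq_zero_of_weight hτ ((hp h0).trans (h.1 i hi)).le hl)

theorem pderiv_inverse {ψ χ : Fin n → MvPolynomial (Fin n) ℂ}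
    (h : ∀ i, bind₁ ψ (χ i) = X i) (i m : Fin n) :
    ∑ l, bind₁ ψ (pderiv l (χ m)) * pderiv i (ψ l) = if i = m then 1 else 0 := by
  rw [← pderiv_bind₁, h]
  split_ifs with him
  · rw [him, pderiv_X_self]
  · rw [pderiv_X_of_ne (Ne.symm him)]

/-- Vector fields are transported by changes of variables. -/
theorem sum_transport {ψ χ : Fin n → MvPolynomial (Fin n) ℂ} (h : ∀ i, bind₁ χ (ψ i) = X i)
    (Y : Fin n → MvPolynomial (Fin n) ℂ) (F : MvPolynomial (Fin n) ℂ) :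
    ∑ l, (∑ i, bind₁ χ (Y i * pderiv i (ψ l))) * pderiv l F =
      bind₁ χ (∑ i, Y i * pderiv i (bind₁ ψ F)) := by
  have hX : (fun i => bind₁ χ (ψ i)) = X := funext h
  simp only [pderiv_bind₁, Finset.mul_sum, map_sum, map_mul, bind₁_bind₁, hX, bind₁_X_left,
    AlgHom.id_apply, Finset.sum_mul]
  rw [Finset.sum_comm]
  exact Finset.sum_congr rfl fun i _ => Finset.sum_congr rfl fun l _ => by ring

/-- The push-forward of `Y` by `ψ` annihilates `F` and keeps both the negative weight and the head
directions, so it vanishes. The Jacobian matrix of `ψ` is invertible, so `Y` vanishes too. -/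
theorem NoNegField.bind₁ {k : ℕ} {τ : ℚ} {L : Fin n → ℚ} (h : TailConst k τ L) (hτ : 0 < τ)
    {F : Fin N → MvPolynomial (Fin n) ℂ} (hF : NoNegField k L F)
    {ψ : Fin n → MvPolynomial (Fin n) ℂ} (hψ : IsHomogeneousChange L ψ) :
    NoNegField k L fun j => MvPolynomial.bind₁ ψ (F j) := by
  obtain ⟨h1, χ, h2, h3, h4⟩ := hψ
  intro Y hY0 hY hYF
  have hZ : ∀ l, ∑ i, MvPolynomial.bind₁ χ (Y i * MvPolynomial.pderiv i (ψ l)) = 0 := by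
    refine hF (fun l => ∑ i, MvPolynomial.bind₁ χ (Y i * MvPolynomial.pderiv i (ψ l))) ?_ ?_ ?_
    · intro l hl
      refine Finset.sum_eq_zero fun i _ => ?_
      rcases lt_or_ge i.val k with hi | hi
      · rw [pderiv_eq_zero_of_tail h hτ hl (h1 l) hi]; simp
      · rw [hY0 i hi]; simp
    · intro l
      refine SuppLT.sum fun i _ => SuppLT.bind₁ (L := headW k L) ?_
        fun m => suppLE_headW h hτ (h2 m)
      rcases lt_or_ge i.val k with hi | hi
      · have hd := (hY i).mul ((suppLE_headW h hτ (h1 l)).pderiv i)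
        intro α hα
        have h5 := hd α hα
        have h6 : headW k L i = L i := if_pos hi
        have h7 := headW_le (fun i => (hτ.trans_le (h.le i)).le) k l
        linarith
      · rw [hY0 i hi, zero_mul]; intro α hα; simp at hα
    · intro j
      rw [sum_transport h4, hYF j, map_zero]
  have hZ' : ∀ l, ∑ i, Y i * MvPolynomial.pderiv i (ψ l) = 0 := by
    intro l
    have hX : (fun i => MvPolynomial.bind₁ ψ (χ i)) = X := funext h3
    have := congrArg (MvPolynomial.bind₁ ψ) (hZ l)
    rwa [← map_sum, bind₁_bind₁, hX, bind₁_X_left, AlgHom.id_apply, map_zero] at this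
  intro m
  have h5 : ∑ l, MvPolynomial.bind₁ ψ (MvPolynomial.pderiv l (χ m)) *
      ∑ i, Y i * MvPolynomial.pderiv i (ψ l) = Y m := by
    simp only [Finset.mul_sum]
    rw [Finset.sum_comm]
    have : ∀ i, ∑ l, MvPolynomial.bind₁ ψ (MvPolynomial.pderiv l (χ m)) *
        (Y i * MvPolynomial.pderiv i (ψ l)) = if i = m then Y i else 0 := fun i => by
      have h6 := congrArg (Y i * ·) (pderiv_inverse h3 i m)
      simp only [Finset.mul_sum, mul_ite, mul_one, mul_zero] at h6
      rw [← h6]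
      exact Finset.sum_congr rfl fun l _ => by ring
    rw [Finset.sum_congr rfl fun i _ => this i]
    simp
  rw [← h5]
  exact Finset.sum_eq_zero fun l _ => by rw [hZ' l, mul_zero]

/-- If no vector field of negative weight annihilates `F`, then `F` depends on the first `k`
variables after every homogeneous change of variables. -/
theorem NoNegField.depends {k : ℕ} {τ : ℚ} {L : Fin n → ℚ} (h : TailConst k τ L) (hτ : 0 < τ)
    {F : Fin N → MvPolynomial (Fin n) ℂ} (hF : NoNegField k L F) {i : Fin n} (hi : i.val < k) :
    ∃ j, MvPolynomial.pderiv i (F j) ≠ 0 := by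
  by_contra hcon
  push Not at hcon
  have := hF (Pi.single i 1) (fun l hl => Pi.single_eq_of_ne (by rintro rfl; omega) _) (fun l => ?_)
    (fun j => ?_) i
  · simp at this
  · by_cases hl : l = i
    · subst hl
      intro α hα
      rw [Pi.single_eq_same, mem_support_iff, coeff_one] at hα
      have h0 : α = 0 := by by_contra h; exact hα (if_neg (Ne.symm h))
      rw [h0, map_zero]
      exact hτ.trans_le (h.le _)
    · rw [Pi.single_eq_of_ne hl]; intro α hα; simp at hα
  · rw [Finset.sum_eq_single i]
    · simp [hcon j]
    · intro l _ hl; simp [Pi.single_eq_of_ne hl]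
    · simp

/-- The hypothesis says that only the pair of weights `(a, b)` reaches `a + b`. It holds when `q` is
homogeneous, and when `a` and `b` are the lowest possible weights. -/
theorem component_mul {M : Type*} [AddCommMonoid M] (u : Fin n → M) (a b : M)
    {p q : MvPolynomial (Fin n) ℂ}
    (h : ∀ x ∈ p.support, ∀ y ∈ q.support, Finsupp.weight u x + Finsupp.weight u y = a + b →
      Finsupp.weight u x = a ∧ Finsupp.weight u y = b) :
    weightedHomogeneousComponent u (a + b) (p * q) =
      weightedHomogeneousComponent u a p * weightedHomogeneousComponent u b q := by
  classical
  ext d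
  rw [coeff_weightedHomogeneousComponent, coeff_mul, coeff_mul]
  have key : ∀ x ∈ Finset.HasAntidiagonal.antidiagonal d,
      coeff x.1 (weightedHomogeneousComponent u a p) * coeff x.2 (weightedHomogeneousComponent u b q)
      = if Finsupp.weight u d = a + b then coeff x.1 p * coeff x.2 q else 0 := by
    rintro ⟨x, y⟩ hxy
    rw [Finset.HasAntidiagonal.mem_antidiagonal] at hxy
    simp only [coeff_weightedHomogeneousComponent]
    have hd : Finsupp.weight u d = Finsupp.weight u x + Finsupp.weight u y := by
      rw [← hxy, map_add]
    by_cases hx : coeff x p = 0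
    · simp [hx]
    by_cases hy : coeff y q = 0
    · simp [hy]
    by_cases hw : Finsupp.weight u d = a + b
    · obtain ⟨h1, h2⟩ := h x (mem_support_iff.2 hx) y (mem_support_iff.2 hy) (hd ▸ hw)
      rw [if_pos hw, if_pos h1, if_pos h2]
    · rw [if_neg hw]
      by_cases h1 : Finsupp.weight u x = a
      · by_cases h2 : Finsupp.weight u y = b
        · exact absurd (hd.trans (by rw [h1, h2])) hw
        · simp [h2]
      · simp [h1]
  rw [Finset.sum_congr rfl key]
  split_ifs <;> simp

/-- The property of having no annihilating vector fields passes from the part of `G` that does not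
involve the last variables to `G`. -/
theorem NoNegField.extend {k : ℕ} {L L' : Fin n → ℚ} (hLL : ∀ i, i.val < k → L' i = L i)
    {F G : Fin N → MvPolynomial (Fin n) ℂ} (hF : NoNegField k L F)
    (hFG : ∀ j α, (∀ i : Fin n, k ≤ i.val → α i = 0) → coeff α (G j) = coeff α (F j))
    (hFt : ∀ j i, k ≤ i.val → MvPolynomial.pderiv i (F j) = 0) : NoNegField k L' G := by
  classical
  have hhead : headW k L' = headW k L := by
    funext i; unfold headW; split_ifs with h
    · exact hLL i h
    · rfl
  intro Y hY0 hY hYG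
  by_contra hcon
  push Not at hcon
  obtain ⟨i₀, hi₀⟩ := hcon
  -- `u` counts the degree in the last variables. The part of `Y` of lowest such degree `m` will be
  -- shown to annihilate `F`.
  let u : Fin n → ℕ := fun i => if i.val < k then 0 else 1
  have hu : ∀ α : Fin n →₀ ℕ, Finsupp.weight u α = 0 ↔ ∀ i : Fin n, k ≤ i.val → α i = 0 := by
    intro α
    rw [Finsupp.weight_eq_sum, Finset.sum_eq_zero_iff]
    refine forall_congr' fun i => ?_
    by_cases hi : i.val < k
    · simp [u, hi]
    · simp [u, hi, not_lt.1 hi]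
  let S : Set ℕ := {m | ∃ i, ∃ α ∈ (Y i).support, Finsupp.weight u α = m}
  have hS : S.Nonempty := by
    obtain ⟨α, hα⟩ := support_nonempty.2 hi₀
    exact ⟨_, i₀, α, hα, rfl⟩
  obtain ⟨i₁, α₁, hα₁, hm⟩ := Nat.sInf_mem hS
  set m := sInf S with hmdef
  have hmin : ∀ i, ∀ α ∈ (Y i).support, m ≤ Finsupp.weight u α := fun i α hα =>
    Nat.sInf_le ⟨i, α, hα, rfl⟩
  have hZ := hF (fun i => weightedHomogeneousComponent u m (Y i)) (fun i hi => by
      simp [hY0 i hi]) (fun i α hα => by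
      have hα' : α ∈ (Y i).support := by
        rw [mem_support_iff, coeff_weightedHomogeneousComponent] at hα
        rw [mem_support_iff]
        intro h0; simp [h0] at hα
      have := hY i α hα'
      rw [hhead] at this
      by_cases hi : i.val < k
      · rwa [hLL i hi] at this
      · rw [hY0 i (not_lt.1 hi)] at hα'; simp at hα') (fun j => by
      -- In `u`-degree `m + 0` only the lowest part of `Y i` and the part of `∂_i G_j` free of the
      -- last variables meet; the latter is `∂_i F_j`.
      have h1 := congrArg (weightedHomogeneousComponent u (m + 0)) (hYG j)
      rw [map_zero, map_sum] at h1
      rw [← h1]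
      refine Finset.sum_congr rfl fun i _ => ?_
      rcases lt_or_ge i.val k with hi | hi
      · rw [component_mul u m 0]
        · congr 1
          ext α
          rw [coeff_weightedHomogeneousComponent, coeff_pderiv, coeff_pderiv]
          have hshift : (∀ l : Fin n, k ≤ l.val → (α + Finsupp.single i 1 : Fin n →₀ ℕ) l = 0) ↔
              ∀ l : Fin n, k ≤ l.val → α l = 0 := by
            refine forall_congr' fun l => forall_congr' fun hl => ?_
            have : i ≠ l := by rintro rfl; omega
            simp [this]
          split_ifs with h0
          · rw [hFG j _ (hshift.2 ((hu α).1 h0))]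
          · rw [hu, ← hshift] at h0
            push Not at h0
            obtain ⟨l, hl, hl0⟩ := h0
            rw [coeff_eq_zero_of_pderiv (hFt j l hl) hl0, zero_mul]
        · intro x hx y _ hxy
          have := hmin i x hx
          omega
      · simp [hY0 i hi])
  have := congrArg (coeff α₁) (hZ i₁)
  rw [coeff_weightedHomogeneousComponent, if_pos hm, coeff_zero] at this
  exact mem_support_iff.1 hα₁ this

end

section

variable {n N : ℕ}

/-! ### Flows of vector fields of negative weight -/

/-- A primitive of a polynomial with respect to the `i`-th variable. -/
def primitive (i : Fin n) (p : MvPolynomial (Fin n) ℂ) : MvPolynomial (Fin n) ℂ :=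
  ∑ α ∈ p.support, monomial (α + Finsupp.single i 1) (coeff α p / (α i + 1))

theorem pderiv_primitive (i : Fin n) (p : MvPolynomial (Fin n) ℂ) :
    pderiv i (primitive i p) = p := by
  conv_rhs => rw [p.as_sum]
  rw [primitive, map_sum]
  refine Finset.sum_congr rfl fun α _ => ?_
  rw [pderiv_monomial, add_tsub_cancel_right]
  congr 1
  have : ((α i : ℂ) + 1) ≠ 0 := Nat.cast_add_one_ne_zero _
  simp
  field_simp

theorem support_primitive (i : Fin n) (p : MvPolynomial (Fin n) ℂ) {β : Fin n →₀ ℕ}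
    (h : coeff β (primitive i p) ≠ 0) : ∃ α ∈ p.support, β = α + Finsupp.single i 1 := by
  rw [primitive, coeff_sum] at h
  obtain ⟨α, hα, hne⟩ := Finset.exists_ne_zero_of_sum_ne_zero h
  rw [coeff_monomial] at hne
  exact ⟨α, hα, by by_contra h'; exact hne (if_neg (Ne.symm h'))⟩

theorem isWeightedHomogeneous_primitive {L : Fin n → ℚ} {w : ℚ} {p : MvPolynomial (Fin n) ℂ}
    (i : Fin n) (hp : p.IsWeightedHomogeneous L (w - L i)) :
    (primitive i p).IsWeightedHomogeneous L w := by
  intro β hβ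
  obtain ⟨α, hα, rfl⟩ := support_primitive i p hβ
  rw [map_add, hp (mem_support_iff.1 hα), Finsupp.weight_single, one_smul, sub_add_cancel]

theorem pderiv_primitive_of_ne {i l : Fin n} (hil : l ≠ i) {p : MvPolynomial (Fin n) ℂ}
    (hp : pderiv l p = 0) : pderiv l (primitive i p) = 0 := by
  refine pderiv_eq_zero_of_coeff fun β hβ => ?_
  by_contra h
  obtain ⟨α, hα, rfl⟩ := support_primitive i p h
  refine mem_support_iff.1 hα (coeff_eq_zero_of_pderiv hp (i := l) ?_)
  simpa [hil.symm] using hβ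

theorem bind₁_congr_of_vars {ψ ψ' : Fin n → MvPolynomial (Fin n) ℂ} {p : MvPolynomial (Fin n) ℂ}
    (h : ∀ i ∈ p.vars, ψ i = ψ' i) : bind₁ ψ p = bind₁ ψ' p :=
  eval₂Hom_congr' rfl (fun i hi _ => h i hi) rfl

/-- Straightening of a vector field `Z` of weight `-τ` with `Z_{i₀} = 1`. -/
theorem exists_flow {L : Fin n → ℚ} (hL : ∀ i, 0 < L i) {i₀ : Fin n}
    {Z : Fin n → MvPolynomial (Fin n) ℂ}
    (hZ : ∀ i, (Z i).IsWeightedHomogeneous L (L i - L i₀)) (hZi : Z i₀ = 1)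
    {k : ℕ} (hik : i₀.val < k)
    (hZv : ∀ i l : Fin n, k ≤ l.val → pderiv l (Z i) = 0) :
    ∃ ψ : Fin n → MvPolynomial (Fin n) ℂ, IsHomogeneousChange L ψ ∧
      (∀ i, pderiv i₀ (ψ i) = bind₁ ψ (Z i)) ∧
      ∀ i l : Fin n, i.val < k → k ≤ l.val → pderiv l (ψ i) = 0 := by
  -- `Z i` has weight `λ_i - λ_{i₀} < λ_i`, so it only involves variables of weight less than `λ_i`.
  -- The equations of the flow are therefore integrated one after another, by recursion on the
  -- weight.
  have : IsTrans (Fin n) fun i j => L i < L j := ⟨fun _ _ _ => lt_trans⟩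
  have : Std.Irrefl fun i j : Fin n => L i < L j := ⟨fun i => lt_irrefl (L i)⟩
  have hwf : WellFounded fun i j : Fin n => L i < L j := Finite.wellFounded_of_trans_of_irrefl _
  -- The variable `z_{i₀}` serves as time and `X i` is the initial value on `z_{i₀} = 0`. The
  -- default `0` under the binder is never used, by `hvars`.
  let step : ∀ i : Fin n, (∀ l, L l < L i → MvPolynomial (Fin n) ℂ) → MvPolynomial (Fin n) ℂ :=
    fun i rec => (if i = i₀ then 0 else X i) +
      primitive i₀ (bind₁ (fun l => if h : L l < L i then rec l h else 0) (Z i))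
  let ψ : Fin n → MvPolynomial (Fin n) ℂ := hwf.fix step
  have hvars : ∀ i, ∀ l ∈ (Z i).vars, L l < L i := by
    intro i l hl
    obtain ⟨α, hα, hαl⟩ := (mem_vars_iff_mem_support l).1 hl
    have h1 := hZ i (mem_support_iff.1 hα)
    have h2 := mul_le_weight (fun i => (hL i).le) α l
    have h3 : (1 : ℚ) ≤ α l := by
      exact_mod_cast Nat.one_le_iff_ne_zero.2 (Finsupp.mem_support_iff.1 hαl)
    nlinarith [hL l, hL i₀]
  have hψ : ∀ i, ψ i = (if i = i₀ then 0 else X i) + primitive i₀ (bind₁ ψ (Z i)) := by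
    intro i
    have h1 : ψ i = step i fun l _ => ψ l := hwf.fix_eq step i
    rw [h1]
    simp only [step]
    congr 2
    refine bind₁_congr_of_vars fun l hl => ?_
    rw [dif_pos (hvars i l hl)]
  have hψhom : ∀ i, (ψ i).IsWeightedHomogeneous L (L i) := by
    intro i
    induction i using hwf.induction with
    | _ i ih =>
      rw [hψ i]
      refine IsWeightedHomogeneous.add ?_ (isWeightedHomogeneous_primitive i₀ ?_)
      · split_ifs
        · exact isWeightedHomogeneous_zero _ _ _
        · exact isWeightedHomogeneous_X _ _ _
      · let ψ' : Fin n → MvPolynomial (Fin n) ℂ := fun l => if L l < L i then ψ l else 0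
        have h1 : bind₁ ψ (Z i) = bind₁ ψ' (Z i) :=
          bind₁_congr_of_vars fun l hl => (if_pos (hvars i l hl)).symm
        rw [h1]
        refine isWeightedHomogeneous_bind₁ (fun l => ?_) (hZ i)
        by_cases hl : L l < L i
        · simp only [ψ', if_pos hl]; exact ih l hl
        · simp only [ψ', if_neg hl]; exact isWeightedHomogeneous_zero _ _ _
  have hψ₀ : ψ i₀ = X i₀ := by
    rw [hψ, if_pos rfl, hZi, map_one, zero_add, primitive]
    have : (1 : MvPolynomial (Fin n) ℂ).support = {0} := by
      rw [← C_1, ← monomial_zero', support_monomial, if_neg one_ne_zero]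
    rw [this]
    simp [X]
  refine ⟨ψ, isHomogeneousChange_of_surjective hL hψhom ?_, fun i => ?_, fun i l hi hl => ?_⟩
  -- The primitives are divisible by `z_{i₀}` and `ψ i₀ = X i₀`. So the Jacobian at `0` differs from
  -- the identity only in column `i₀`, where the diagonal entry is `1`.
  · have hcoeff : ∀ i l, l ≠ i₀ → coeffAt (fun z => polyMap ψ z i) (Finsupp.single l 1) =
        if l = i then 1 else 0 := by
      intro i l hl
      have h1 : coeffAt (fun z => polyMap ψ z i) (Finsupp.single l 1) =
        coeff (Finsupp.single l 1) (ψ i) := coeffAt_eval _ _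
      have h2 : coeff (Finsupp.single l 1) (primitive i₀ (bind₁ ψ (Z i))) = 0 := by
        by_contra h
        obtain ⟨α, -, hα⟩ := support_primitive _ _ h
        have := DFunLike.congr_fun hα i₀
        simp [hl] at this
      rw [h1, hψ, coeff_add, h2, add_zero]
      split_ifs with h3 h4 h5
      · exact absurd (h4.trans h3) hl
      · exact coeff_zero _
      · rw [h5, coeff_X, if_pos rfl]
      · rw [coeff_X, if_neg]
        intro h6
        exact h5 (Finsupp.single_left_injective one_ne_zero h6).symm
    have hinj : Function.Injective (fderiv ℂ (polyMap ψ) 0) := by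
      rw [injective_iff_map_eq_zero]
      intro v hv
      have hrow : ∀ i, ∑ l, coeffAt (fun z => polyMap ψ z i) (Finsupp.single l 1) * v l = 0 :=
        fun i => by rw [← fderiv_apply_eq (analyticAt_polyMap ψ 0), hv]; rfl
      have hv₀ : v i₀ = 0 := by
        have h1 := hrow i₀
        have h2 : ∀ l, coeffAt (fun z => polyMap ψ z i₀) (Finsupp.single l 1) =
            if l = i₀ then 1 else 0 := by
          intro l
          have h3 : coeffAt (fun z => polyMap ψ z i₀) (Finsupp.single l 1) =
            coeff (Finsupp.single l 1) (ψ i₀) := coeffAt_eval _ _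
          rw [h3, hψ₀, coeff_X]
          simp [Finsupp.single_left_inj, eq_comm]
        simpa [h2] using h1
      funext i
      by_cases hi : i = i₀
      · rw [hi, hv₀]; rfl
      · have h1 := hrow i
        rw [Finset.sum_eq_single i] at h1
        · rw [hcoeff i i hi, if_pos rfl, one_mul] at h1
          exact h1
        · intro l _ hl
          by_cases hl₀ : l = i₀
          · rw [hl₀, hv₀, mul_zero]
          · rw [hcoeff i l hl₀, if_neg hl, zero_mul]
        · simp
    exact LinearMap.injective_iff_surjective (f := (fderiv ℂ (polyMap ψ) 0).toLinearMap).1 hinj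
  · rw [hψ i, map_add, pderiv_primitive]
    split_ifs with h
    · rw [map_zero, zero_add]
    · rw [pderiv_X_of_ne h, zero_add]
  · induction i using hwf.induction with
    | _ i ih =>
      have hl₀ : l ≠ i₀ := by rintro rfl; omega
      rw [hψ i, map_add, pderiv_primitive_of_ne hl₀, add_zero]
      · split_ifs
        · exact map_zero _
        · exact pderiv_X_of_ne (by rintro rfl; omega)
      · rw [pderiv_bind₁]
        refine Finset.sum_eq_zero fun m _ => ?_
        by_cases hm : m ∈ (Z i).vars
        · have hmk : m.val < k := by
            by_contra hge
            exact (mem_vars_iff_pderiv_ne_zero _ _).1 hm (hZv i m (not_lt.1 hge))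
          rw [ih m (hvars i m hm) hmk, mul_zero]
        · rw [pderiv_eq_zero_of_notMem_vars hm, map_zero, zero_mul]

theorem weight_headW_of_tail {k : ℕ} (L : Fin n → ℚ) {α : Fin n →₀ ℕ}
    (h : ∀ i : Fin n, k ≤ i.val → α i = 0) : Finsupp.weight (headW k L) α = Finsupp.weight L α :=
  weight_congr fun i hi => if_pos (by by_contra hk; exact hi (h i (not_lt.1 hk)))

theorem ncard_le_val {k : ℕ} (hk : k ≤ n) : {i : Fin n | k ≤ i.val}.ncard = n - k := by
  rw [Set.ncard_eq_toFinset_card']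
  have h1 := Fin.card_filter_val_lt (n := n) (m := k)
  have h2 := Finset.card_filter_add_card_filter_not (s := (Finset.univ : Finset (Fin n)))
    (fun i : Fin n => i.val < k)
  simp only [Finset.card_univ, Fintype.card_fin, not_lt] at h2
  simp only [Set.toFinset_ofPred]
  omega

theorem le_freeCount {k : ℕ} (hk : k ≤ n) {F : Fin N → MvPolynomial (Fin n) ℂ}
    (h : ∀ i : Fin n, k ≤ i.val → ∀ j, pderiv i (F j) = 0) : n - k ≤ freeCount F := by
  rw [← ncard_le_val hk]
  exact Set.ncard_le_ncard (fun i hi => h i hi) (Set.toFinite _)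

/-- If `F` depends on the first `k'` variables only and no homogeneous change of variables reduces
this number, then no vector field of negative weight annihilates `F`. -/
theorem NoNegField.of_irreducible {k k' : ℕ} {τ : ℚ} {L : Fin n → ℚ} (h : TailConst k τ L)
    (hτ : 0 < τ) (hkk : k ≤ k') (hk'n : k' ≤ n) {F : Fin N → MvPolynomial (Fin n) ℂ} {w : ℚ}
    (hFw : ∀ j, (F j).IsWeightedHomogeneous L w)
    (hFt : ∀ j i, k' ≤ i.val → MvPolynomial.pderiv i (F j) = 0) (hF : NoNegField k L F)
    (hirr : ∀ ψ, IsHomogeneousChange L ψ →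
      freeCount (fun j => MvPolynomial.bind₁ ψ (F j)) ≤ n - k') : NoNegField k' L F := by
  classical
  have hL : ∀ i, 0 < L i := fun i => hτ.trans_le (h.le i)
  intro Y hY0 hY hYF
  -- A field without components from `k` on is excluded by the hypothesis for `k`, because `headW k
  -- ≤ headW k'`.
  by_cases hB : ∀ i : Fin n, k ≤ i.val → Y i = 0
  · refine hF Y hB (fun i α hα => ?_) hYF
    refine lt_of_le_of_lt (weight_mono (fun l => ?_) α) (hY i α hα)
    unfold headW
    split_ifs with h1 h2 h2
    · exact le_rfl
    · omega
    · exact (hL l).le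
    · exact le_rfl
  exfalso
  push Not at hB
  obtain ⟨i₀, hi₀, hYi₀⟩ := hB
  have hi₀k : i₀.val < k' := by
    by_contra hge; exact hYi₀ (hY0 i₀ (not_lt.1 hge))
  have hLi₀ : L i₀ = τ := h.1 i₀ hi₀
  obtain ⟨c, hc⟩ : ∃ c, eval c (Y i₀) ≠ 0 := by
    by_contra hcon
    push Not at hcon
    exact hYi₀ (poly_eq_of_eval fun z => by rw [hcon z, map_zero])
  -- The variables from `k'` on are frozen at `c`. `F` and its derivatives do not contain them, so
  -- the frozen field still annihilates `F`.
  let θ : Fin n → MvPolynomial (Fin n) ℂ := fun l => if l.val < k' then X l else C (c l)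
  have hθ : ∀ p : MvPolynomial (Fin n) ℂ, (∀ l : Fin n, k' ≤ l.val → MvPolynomial.pderiv l p = 0) →
      MvPolynomial.bind₁ θ p = p := by
    intro p hp
    have h1 : MvPolynomial.bind₁ θ p = MvPolynomial.bind₁ X p :=
      bind₁_congr_of_vars fun l hl => if_pos (by
        by_contra hge
        exact (mem_vars_iff_pderiv_ne_zero _ _).1 hl (hp l (not_lt.1 hge)))
    rw [h1, bind₁_X_left, AlgHom.id_apply]
  have hθt : ∀ (p : MvPolynomial (Fin n) ℂ) (l : Fin n), k' ≤ l.val →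
      MvPolynomial.pderiv l (MvPolynomial.bind₁ θ p) = 0 := by
    intro p l hl
    rw [pderiv_bind₁]
    refine Finset.sum_eq_zero fun m _ => ?_
    have : MvPolynomial.pderiv l (θ m) = 0 := by
      simp only [θ]
      split_ifs with hm
      · exact pderiv_X_of_ne (by rintro rfl; omega)
      · exact pderiv_C
    rw [this, mul_zero]
  have hFt' : ∀ j i l, k' ≤ l.val → MvPolynomial.pderiv l (MvPolynomial.pderiv i (F j)) = 0 := by
    intro j i l hl
    refine pderiv_eq_zero_of_coeff fun α hα => ?_
    rw [coeff_pderiv, coeff_eq_zero_of_pderiv (hFt j l hl) (by simp [hα]), zero_mul]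
  -- `Y i₀` has head weight less than `τ`, while each of the first `k'` variables weighs at least
  -- `τ`. Only frozen variables occur in it, so it becomes a nonzero constant.
  have hconst : MvPolynomial.bind₁ θ (Y i₀) = C (eval c (Y i₀)) := by
    have h1 : MvPolynomial.bind₁ θ (Y i₀) = MvPolynomial.bind₁ (fun l => C (c l)) (Y i₀) := by
      refine bind₁_congr_of_vars fun l hl => if_neg fun hlk => ?_
      obtain ⟨α, hα, hαl⟩ := (mem_vars_iff_mem_support l).1 hl
      have h1 := hY i₀ α hα
      have h2 := mul_le_weight (fun i => headW_nonneg (fun i => (hL i).le) k' i) α l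
      have h3 : (1 : ℚ) ≤ α l := by
        exact_mod_cast Nat.one_le_iff_ne_zero.2 (Finsupp.mem_support_iff.1 hαl)
      have h4 : headW k' L l = L l := if_pos hlk
      rw [h4] at h2
      nlinarith [h.le l, hL l]
    rw [h1]
    induction Y i₀ using MvPolynomial.induction_on with
    | C a => simp
    | add p q hp hq => simp [hp, hq]
    | mul_X p j hp => simp [hp]
  set c₀ := eval c (Y i₀) with hc₀
  -- The homogeneous part of weight `-τ` of the frozen field, normalised to `Z i₀ = 1`. As `F` is
  -- homogeneous, each homogeneous part of an annihilating field annihilates `F`.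
  let Z : Fin n → MvPolynomial (Fin n) ℂ := fun i =>
    C c₀⁻¹ * weightedHomogeneousComponent L (L i - τ) (MvPolynomial.bind₁ θ (Y i))
  have hZhom : ∀ i, (Z i).IsWeightedHomogeneous L (L i - L i₀) := fun i => by
    rw [hLi₀]
    exact (weightedHomogeneousComponent_isWeightedHomogeneous _ _).C_mul _
  have hZi₀ : Z i₀ = 1 := by
    simp only [Z]
    rw [hconst, hLi₀, sub_self, IsWeightedHomogeneous.weightedHomogeneousComponent_same
      (isWeightedHomogeneous_C L c₀), ← C_mul, inv_mul_cancel₀ hc, C_1]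
  have hZv : ∀ i l : Fin n, k' ≤ l.val → MvPolynomial.pderiv l (Z i) = 0 := by
    intro i l hl
    refine pderiv_eq_zero_of_coeff fun α hα => ?_
    simp only [Z]
    rw [coeff_C_mul, coeff_weightedHomogeneousComponent, coeff_eq_zero_of_pderiv (hθt _ l hl) hα,
      ite_self, mul_zero]
  have hZF : ∀ j, ∑ i, Z i * MvPolynomial.pderiv i (F j) = 0 := by
    intro j
    have h1 : ∑ i, MvPolynomial.bind₁ θ (Y i) * MvPolynomial.pderiv i (F j) = 0 := by
      have h2 := congrArg (MvPolynomial.bind₁ θ) (hYF j)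
      rw [map_sum, map_zero] at h2
      rw [← h2]
      refine Finset.sum_congr rfl fun i _ => ?_
      rw [map_mul, hθ _ (hFt' j i)]
    have h2 := congrArg (weightedHomogeneousComponent L (w - τ)) h1
    rw [map_zero, map_sum] at h2
    have h3 : ∀ i, weightedHomogeneousComponent L (w - τ)
        (MvPolynomial.bind₁ θ (Y i) * MvPolynomial.pderiv i (F j)) =
        weightedHomogeneousComponent L (L i - τ) (MvPolynomial.bind₁ θ (Y i)) *
          MvPolynomial.pderiv i (F j) := by
      intro i
      have h4 := isWeightedHomogeneous_pderiv (hFw j) i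
      have h5 : w - τ = (L i - τ) + (w - L i) := by ring
      rw [h5, component_mul L, h4.weightedHomogeneousComponent_same]
      intro x _ y hy hxy
      have h6 := h4 (mem_support_iff.1 hy)
      exact ⟨by linarith, h6⟩
    simp only [Z, mul_assoc]
    rw [← Finset.mul_sum, ← Finset.sum_congr rfl fun i _ => h3 i, h2, mul_zero]
  obtain ⟨ψ, hψ, hflow, hψt⟩ := exists_flow hL hZhom hZi₀ hi₀k hZv
  -- After straightening, `z_{i₀}` is free in addition to the `n - k'` last variables, one more than
  -- `hirr` allows.
  have hfree : insert i₀ {i : Fin n | k' ≤ i.val} ⊆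
      {i | ∀ j, MvPolynomial.pderiv i (MvPolynomial.bind₁ ψ (F j)) = 0} := by
    rintro l (rfl | hl) j
    · rw [pderiv_bind₁]
      have h1 := congrArg (MvPolynomial.bind₁ ψ) (hZF j)
      rw [map_sum, map_zero] at h1
      rw [← h1]
      exact Finset.sum_congr rfl fun i _ => by
        rw [hflow, mul_comm, ← map_mul]
    · rw [pderiv_bind₁]
      refine Finset.sum_eq_zero fun i _ => ?_
      rcases lt_or_ge i.val k' with hi | hi
      · rw [hψt i l hi hl, mul_zero]
      · rw [hFt j i hi, map_zero, zero_mul]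
  have hcard := Set.ncard_le_ncard hfree (Set.toFinite _)
  rw [Set.ncard_insert_of_notMem (by simpa using hi₀k) (Set.toFinite _)] at hcard
  have hcount := ncard_le_val (n := n) hk'n
  have hle : {i | ∀ j, MvPolynomial.pderiv i (MvPolynomial.bind₁ ψ (F j)) = 0}.ncard ≤ n - k' :=
    hirr ψ hψ
  omega

end

section

variable {n N : ℕ}

/-! ### The leading polynomial of a sum of squares -/

theorem mixedWeight_eq (L : Fin n → ℚ) (e : MixedExp n) :
    mixedWeight L e = Finsupp.weight L (holPart e) + Finsupp.weight L (antiPart e) := by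
  rw [weight_eq_sum', weight_eq_sum', ← Finset.sum_add_distrib]
  refine Finset.sum_congr rfl fun i _ => ?_
  simp; ring

theorem mixedWeight_eq_weight (L : Fin n → ℚ) (e : MixedExp n) :
    mixedWeight L e = Finsupp.weight (Sum.elim L L) e := by
  rw [mixedWeight_eq, weight_eq_sum', weight_eq_sum', weight_eq_sum', Fintype.sum_sum_type]
  rfl

theorem finite_mixedWeight_le {L : Fin n → ℚ} (hL : ∀ i, 0 < L i) (w : ℚ) :
    {e : MixedExp n | mixedWeight L e ≤ w}.Finite := by
  simp only [mixedWeight_eq_weight]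
  exact finite_weight_le (by rintro (i | i) <;> exact hL i) w

theorem coeff_leadingPoly (ρ : (Fin n → ℂ) → ℝ) {L : Fin n → ℚ} (hL : ∀ i, 0 < L i)
    (e : MixedExp n) :
    coeff e (leadingPoly ρ L) = if mixedWeight L e = 1 then taylorCoeff ρ e else 0 :=
  coeff_finsum_monomial ((finite_mixedWeight_le hL 1).subset fun _ h => le_of_eq h) _ _

theorem coeff_rename_mul_rename (p q : MvPolynomial (Fin n) ℂ) (e : MixedExp n) :
    coeff e (rename Sum.inl p * rename Sum.inr q) =
      coeff (holPart e) p * coeff (antiPart e) q := by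
  classical
  induction p using MvPolynomial.induction_on' with
  | add p₁ p₂ h₁ h₂ => simp [add_mul, h₁, h₂]
  | monomial α a =>
    induction q using MvPolynomial.induction_on' with
    | add q₁ q₂ h₁ h₂ => simp [mul_add, h₁, h₂]
    | monomial β b =>
      have hmk : Finsupp.mapDomain Sum.inl α + Finsupp.mapDomain Sum.inr β = mkExp α β := by
        ext i
        cases i with
        | inl i => simp [Finsupp.mapDomain_apply Sum.inl_injective, Finsupp.mapDomain_of_notMem_range]
        | inr i => simp [Finsupp.mapDomain_apply Sum.inr_injective, Finsupp.mapDomain_of_notMem_range]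
      rw [rename_monomial, rename_monomial, monomial_mul, hmk, coeff_monomial, coeff_monomial,
        coeff_monomial]
      by_cases h : mkExp α β = e
      · subst h; simp
      · rw [if_neg h]
        by_cases h1 : α = holPart e
        · rw [if_neg (c := β = antiPart e), mul_zero]
          intro h2
          exact h (by rw [h1, h2, mkExp_parts])
        · rw [if_neg h1, zero_mul]

/-- The polynomial `∑ |F_j|²`. -/
def sqPoly (F : Fin N → MvPolynomial (Fin n) ℂ) : MixedPoly n :=
  ∑ j, rename Sum.inl (F j) * rename Sum.inr (MvPolynomial.map (starRingEnd ℂ) (F j))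

theorem coeff_sqPoly (F : Fin N → MvPolynomial (Fin n) ℂ) (e : MixedExp n) :
    coeff e (sqPoly F) =
      ∑ j, coeff (holPart e) (F j) * starRingEnd ℂ (coeff (antiPart e) (F j)) := by
  rw [sqPoly, coeff_sum]
  exact Finset.sum_congr rfl fun j _ => by rw [coeff_rename_mul_rename, coeff_map]

/-- The leading part of order `1/2` of a tuple of functions. -/
def leads (L : Fin n → ℚ) (g : Fin N → (Fin n → ℂ) → ℂ) : Fin N → MvPolynomial (Fin n) ℂ :=
  fun j => lead L (1 / 2) (g j)

/-- A term of weight one pairs two monomials of weight at least `1/2` each, so both weigh exactly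
`1/2`. -/
theorem leadingPoly_sumSq {L : Fin n → ℚ} (hL : ∀ i, 0 < L i) {g : Fin N → (Fin n → ℂ) → ℂ}
    (hg : ∀ j, AnalyticAt ℂ (g j) 0) (hord : ∀ j, OrdGE L (1 / 2) (g j)) :
    leadingPoly (sumSq g) L = sqPoly (leads L g) := by
  ext e
  rw [coeff_leadingPoly _ hL, coeff_sqPoly, taylorCoeff_sumSq hg]
  simp only [leads, coeff_lead hL]
  rw [mixedWeight_eq]
  split_ifs with h1 h2 h3 h3 h2 h3
  · rfl
  · exact absurd (by linarith) h3
  · exact absurd (by linarith) h2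
  · rw [Finset.sum_eq_zero (f := fun j => 0 * (starRingEnd ℂ) 0) (by simp)]
    refine Finset.sum_eq_zero fun j _ => ?_
    by_contra hne
    have h4 := hord j _ (left_ne_zero_of_mul hne)
    have h5 := hord j (antiPart e) (by
      have := right_ne_zero_of_mul hne
      intro h0; simp [h0] at this)
    exact h2 (by linarith)
  · exact absurd (by linarith) h1
  · simp
  · simp
  · simp

theorem mem_vars_sqPoly_inl (F : Fin N → MvPolynomial (Fin n) ℂ) {j : Fin N} {i : Fin n}
    (h : pderiv i (F j) ≠ 0) : Sum.inl i ∈ (sqPoly F).vars := by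
  rw [← mem_vars_iff_pderiv_ne_zero, mem_vars_iff_mem_support] at h
  obtain ⟨α, hα, hi⟩ := h
  refine (mem_vars_iff_mem_support _).2 ⟨mkExp α α, ?_, by simpa using hi⟩
  rw [mem_support_iff, coeff_sqPoly]
  simp only [holPart_mkExp, antiPart_mkExp, Complex.mul_conj]
  norm_cast
  refine (Finset.sum_pos' (fun i _ => Complex.normSq_nonneg _) ⟨j, Finset.mem_univ _, ?_⟩).ne'
  exact Complex.normSq_pos.2 (mem_support_iff.1 hα)

theorem dependsOn_sqPoly (F : Fin N → MvPolynomial (Fin n) ℂ) (i : Fin n) :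
    (sqPoly F).DependsOn i ↔ ∃ j, pderiv i (F j) ≠ 0 := by
  refine ⟨fun h => ?_, fun ⟨j, hj⟩ => Or.inl (mem_vars_sqPoly_inl F hj)⟩
  by_contra hcon
  push Not at hcon
  rcases h with h | h
  · obtain ⟨e, he, hi⟩ := (mem_vars_iff_mem_support _).1 h
    refine mem_support_iff.1 he ?_
    rw [coeff_sqPoly]
    refine Finset.sum_eq_zero fun j _ => ?_
    rw [coeff_eq_zero_of_pderiv (hcon j) (α := holPart e) (by simpa using hi), zero_mul]
  · obtain ⟨e, he, hi⟩ := (mem_vars_iff_mem_support _).1 h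
    refine mem_support_iff.1 he ?_
    rw [coeff_sqPoly]
    refine Finset.sum_eq_zero fun j _ => ?_
    rw [coeff_eq_zero_of_pderiv (hcon j) (α := antiPart e) (by simpa using hi), map_zero, mul_zero]

theorem numFree_sqPoly (F : Fin N → MvPolynomial (Fin n) ℂ) :
    (sqPoly F).numFree = freeCount F := by
  unfold MixedPoly.numFree freeCount
  congr 1
  ext i
  simp [dependsOn_sqPoly]

theorem isSumOfSquares_sqPoly (F : Fin N → MvPolynomial (Fin n) ℂ) {k : ℕ}
    (h : ∀ j i, pderiv i (F j) ≠ 0 → i.val < k) : (sqPoly F).IsSumOfSquares k :=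
  ⟨N, F, fun j i hi => h j i ((mem_vars_iff_pderiv_ne_zero _ _).1 hi), rfl⟩

/-! ### Reductions -/

theorem polyMap_weightNonneg {L : Fin n → ℚ} {ψ : Fin n → MvPolynomial (Fin n) ℂ}
    (hψ : ∀ i, (ψ i).IsWeightedHomogeneous L (L i)) : WeightNonneg L (polyMap ψ) := by
  intro i α hα
  have h1 : coeffAt (fun z => polyMap ψ z i) α = coeff α (ψ i) := coeffAt_eval _ _
  rw [h1] at hα
  exact (hψ i hα).ge

theorem leadMap_polyMap {L : Fin n → ℚ} (hL : ∀ i, 0 < L i) {ψ : Fin n → MvPolynomial (Fin n) ℂ}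
    (hψ : ∀ i, (ψ i).IsWeightedHomogeneous L (L i)) : leadMap L (polyMap ψ) = ψ := by
  funext i
  ext α
  have h1 : coeffAt (fun z => polyMap ψ z i) α = coeff α (ψ i) := coeffAt_eval _ _
  rw [leadMap, coeff_lead hL, h1]
  split_ifs with h
  · rfl
  · by_contra h0
    exact h (hψ i (Ne.symm h0))

theorem leads_comp {L : Fin n → ℚ} (hL : ∀ i, 0 < L i) {g : Fin N → (Fin n → ℂ) → ℂ}
    (hg : ∀ j, AnalyticAt ℂ (g j) 0) (hord : ∀ j, OrdGE L (1 / 2) (g j))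
    {b : (Fin n → ℂ) → Fin n → ℂ} (hb : AnalyticAt ℂ b 0) (hb0 : b 0 = 0)
    (hbL : WeightNonneg L b) :
    (∀ j, OrdGE L (1 / 2) (g j ∘ b)) ∧
    leads L (fun j => g j ∘ b) = fun j => bind₁ (leadMap L b) (leads L g j) :=
  ⟨fun j => ((hord j).comp hL (hg j) hb hb0 hbL).1,
    funext fun j => ((hord j).comp hL (hg j) hb hb0 hbL).2⟩

theorem leads_polyMap {L : Fin n → ℚ} (hL : ∀ i, 0 < L i) {g : Fin N → (Fin n → ℂ) → ℂ}
    (hg : ∀ j, AnalyticAt ℂ (g j) 0) (hord : ∀ j, OrdGE L (1 / 2) (g j))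
    {ψ : Fin n → MvPolynomial (Fin n) ℂ} (hψ : ∀ i, (ψ i).IsWeightedHomogeneous L (L i)) :
    (∀ j, AnalyticAt ℂ (g j ∘ polyMap ψ) 0) ∧ (∀ j, OrdGE L (1 / 2) (g j ∘ polyMap ψ)) ∧
    leads L (fun j => g j ∘ polyMap ψ) = fun j => bind₁ ψ (leads L g j) := by
  have h0 := polyMap_zero_of_homogeneous hL hψ
  have h := leads_comp hL hg hord (analyticAt_polyMap ψ 0) h0 (polyMap_weightNonneg hψ)
  rw [leadMap_polyMap hL hψ] at h
  exact ⟨fun j => AnalyticAt.comp (by rw [h0]; exact hg j) (analyticAt_polyMap ψ 0), h⟩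

/-- The change of variables `ψ` reduces the number of variables of `F` as much as possible. -/
def Reduces (L : Fin n → ℚ) (F : Fin N → MvPolynomial (Fin n) ℂ)
    (ψ : Fin n → MvPolynomial (Fin n) ℂ) : Prop :=
  IsHomogeneousChange L ψ ∧
  (∀ ψ', IsHomogeneousChange L ψ' →
    freeCount (fun j => bind₁ ψ' (F j)) ≤ freeCount (fun j => bind₁ ψ (F j))) ∧
  ∀ i : Fin n, (∃ j, pderiv i (bind₁ ψ (F j)) ≠ 0) →
    i.val < n - freeCount (fun j => bind₁ ψ (F j))

theorem leadingPoly_sumSq_polyMap {L : Fin n → ℚ} (hL : ∀ i, 0 < L i)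
    {g : Fin N → (Fin n → ℂ) → ℂ}
    (hg : ∀ j, AnalyticAt ℂ (g j) 0) (hord : ∀ j, OrdGE L (1 / 2) (g j))
    {ψ : Fin n → MvPolynomial (Fin n) ℂ} (hψ : ∀ i, (ψ i).IsWeightedHomogeneous L (L i)) :
    leadingPoly (sumSq g ∘ polyMap ψ) L = sqPoly fun j => bind₁ ψ (leads L g j) := by
  obtain ⟨h1, h2, h3⟩ := leads_polyMap hL hg hord hψ
  rw [← h3, ← leadingPoly_sumSq hL h1 h2]
  rfl

theorem isReduction_iff {L : Fin n → ℚ} (hL : ∀ i, 0 < L i) {g : Fin N → (Fin n → ℂ) → ℂ}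
    (hg : ∀ j, AnalyticAt ℂ (g j) 0) (hord : ∀ j, OrdGE L (1 / 2) (g j))
    (ψ : Fin n → MvPolynomial (Fin n) ℂ) :
    IsReduction (sumSq g) L ψ ↔ Reduces L (leads L g) ψ := by
  have key : ∀ ψ, IsHomogeneousChange L ψ → leadingPoly (sumSq g ∘ polyMap ψ) L =
      sqPoly fun j => bind₁ ψ (leads L g j) :=
    fun ψ hψ => leadingPoly_sumSq_polyMap hL hg hord hψ.1
  unfold IsReduction Reduces
  refine and_congr_right fun hψ => ?_
  rw [key ψ hψ, numFree_sqPoly]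
  simp only [dependsOn_sqPoly]
  refine and_congr_left fun _ => forall_congr' fun ψ' => forall_congr' fun hψ' => ?_
  rw [key ψ' hψ', numFree_sqPoly]

theorem isHomogeneousChange_perm {L : Fin n → ℚ} (σ : Equiv.Perm (Fin n))
    (hσ : ∀ i, L (σ i) = L i) : IsHomogeneousChange L fun i => X (σ i) := by
  refine ⟨fun i => hσ i ▸ isWeightedHomogeneous_X _ _ (σ i), fun i => X (σ.symm i), fun i => ?_,
    fun i => by simp, fun i => by simp⟩
  have h := hσ (σ.symm i)
  rw [Equiv.apply_symm_apply] at h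
  rw [h]
  exact isWeightedHomogeneous_X _ _ _

theorem freeCount_add_ncard (F : Fin N → MvPolynomial (Fin n) ℂ) :
    freeCount F + {i | ∃ j, pderiv i (F j) ≠ 0}.ncard = n := by
  have h := Set.ncard_add_ncard_compl {i : Fin n | ∀ j, pderiv i (F j) = 0}
  rw [Nat.card_eq_fintype_card, Fintype.card_fin] at h
  have h2 : {i : Fin n | ∀ j, pderiv i (F j) = 0}ᶜ = {i | ∃ j, pderiv i (F j) ≠ 0} := by
    ext i; simp
  rw [h2] at h
  exact h

/-- The maximum of `freeCount` is attained since it is at most `n`. It remains to move the surviving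
variables to the front. By `NoNegField.depends` the first `k` survive, so a permutation of the other
ones is enough; these all have weight `τ`, and the permutation is a homogeneous change. -/
theorem exists_reduces {k : ℕ} {τ : ℚ} {L : Fin n → ℚ} (h : TailConst k τ L) (hτ : 0 < τ)
    {F : Fin N → MvPolynomial (Fin n) ℂ} (hF : NoNegField k L F) : ∃ ψ, Reduces L F ψ := by
  classical
  have hbdd : BddAbove {m | ∃ ψ, IsHomogeneousChange L ψ ∧
      freeCount (fun j => bind₁ ψ (F j)) = m} := by
    refine ⟨n, ?_⟩
    rintro m ⟨ψ, -, rfl⟩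
    have := freeCount_add_ncard fun j => bind₁ ψ (F j)
    omega
  have hne : {m | ∃ ψ, IsHomogeneousChange L ψ ∧
      freeCount (fun j => bind₁ ψ (F j)) = m}.Nonempty := ⟨_, X, isHomogeneousChange_id L, rfl⟩
  obtain ⟨ψ, hψ, hmax⟩ := Nat.sSup_mem hne hbdd
  have hle : ∀ ψ', IsHomogeneousChange L ψ' →
      freeCount (fun j => bind₁ ψ' (F j)) ≤ freeCount (fun j => bind₁ ψ (F j)) := by
    intro ψ' hψ'
    rw [hmax]
    exact le_csSup hbdd ⟨ψ', hψ', rfl⟩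
  set G : Fin N → MvPolynomial (Fin n) ℂ := fun j => bind₁ ψ (F j) with hG
  let D : Finset (Fin n) := Finset.univ.filter fun i => ∃ j, pderiv i (G j) ≠ 0
  have hcard : freeCount G + D.card = n := by
    have := freeCount_add_ncard G
    rwa [Set.ncard_eq_toFinset_card', Set.toFinset_ofPred] at this
  have hhead : ∀ i : Fin n, i.val < k → i ∈ D := fun i hi => by
    simpa [D] using (hF.bind₁ h hτ hψ).depends h hτ hi
  let T : Finset (Fin n) := Finset.univ.filter fun i => i.val < D.card
  have hTcard : T.card = D.card := by
    have := Fin.card_filter_val_lt (n := n) (m := D.card)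
    simp only [T, this]
    omega
  have hkD : ∀ i : Fin n, i.val < k → i.val < D.card := by
    intro i hi
    have h1 : (Finset.univ.filter fun l : Fin n => l.val < i.val + 1) ⊆ D := fun l hl => by
      simp only [Finset.mem_filter, Finset.mem_univ, true_and] at hl
      exact hhead l (by omega)
    have h2 := Finset.card_le_card h1
    rw [Fin.card_filter_val_lt] at h2
    have := i.2
    omega
  -- A bijection from the surviving variables `D` onto the initial segment `T` of the same size,
  -- fixing the first `k`.
  obtain ⟨e, he⟩ := Finset.exists_equiv_extend_of_card_eq (α := D) (β := Fin n) (t := T)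
    (by rw [Fintype.card_coe, hTcard]) (s := Finset.univ.filter fun i => i.1.val < k)
    (f := fun i => i.1) (by
      intro i hi
      obtain ⟨l, hl, rfl⟩ := Finset.mem_image.1 hi
      simp only [Finset.mem_filter, Finset.mem_univ, true_and] at hl
      simpa [T] using hkD _ hl) (Subtype.val_injective.injOn)
  let σ : Equiv.Perm (Fin n) := Equiv.extendSubtype (p := (· ∈ D)) (q := (· ∈ T)) e
  have hσD : ∀ i, i ∈ D ↔ σ i ∈ T := by
    intro i
    refine ⟨fun hi => Equiv.extendSubtype_mem e i hi, fun hi => ?_⟩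
    by_contra hni
    exact Equiv.extendSubtype_not_mem e i hni hi
  have hσhead : ∀ i : Fin n, i.val < k → σ i = i := by
    intro i hi
    have h1 : σ i = e ⟨i, hhead i hi⟩ := Equiv.extendSubtype_apply_of_mem e i (hhead i hi)
    rw [h1]
    exact he ⟨i, hhead i hi⟩ (by simp [hi])
  have hσtail : ∀ i : Fin n, k ≤ i.val → k ≤ (σ i).val := by
    intro i hi
    by_contra hlt
    have h1 := hσhead (σ i) (not_le.1 hlt)
    have h2 := σ.injective h1
    rw [h2] at hlt
    exact hlt hi
  have hσL : ∀ i, L (σ i) = L i := by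
    intro i
    rcases lt_or_ge i.val k with hi | hi
    · rw [hσhead i hi]
    · rw [h.1 i hi, h.1 _ (hσtail i hi)]
  have hchange := hψ.comp (isHomogeneousChange_perm σ hσL)
  have hbind : ∀ j, bind₁ (fun i => bind₁ (fun i => X (σ i)) (ψ i)) (F j) =
      bind₁ (fun i => X (σ i)) (G j) := fun j => (bind₁_bind₁ _ _ _).symm
  have hinj : Function.Injective (bind₁ fun i => (X (σ i) : MvPolynomial (Fin n) ℂ)) := by
    refine Function.LeftInverse.injective (g := bind₁ fun i => X (σ.symm i)) fun p => ?_
    rw [bind₁_bind₁]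
    simp
  have hpd : ∀ i j, pderiv (σ i) (bind₁ (fun i => X (σ i)) (G j)) = 0 ↔ pderiv i (G j) = 0 := by
    intro i j
    rw [pderiv_bind₁, Finset.sum_eq_single i]
    · rw [pderiv_X_self, mul_one, map_eq_zero_iff _ hinj]
    · intro l _ hl
      rw [pderiv_X_of_ne (fun h => hl (σ.injective h)), mul_zero]
    · simp
  have hcount : freeCount (fun j => bind₁ (fun i => X (σ i)) (G j)) = freeCount G := by
    unfold freeCount
    rw [← Set.ncard_image_of_injective {i | ∀ j, pderiv i (G j) = 0} σ.injective]
    congr 1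
    ext i
    constructor
    · intro hi
      refine ⟨σ.symm i, fun j => ?_, σ.apply_symm_apply i⟩
      rw [← hpd, σ.apply_symm_apply]
      exact hi j
    · rintro ⟨l, hl, rfl⟩ j
      exact (hpd l j).2 (hl j)
  refine ⟨_, hchange, ?_, ?_⟩
  · simp only [hbind, hcount]
    exact hle
  · simp only [hbind, hcount]
    rintro i ⟨j, hj⟩
    have h1 : σ.symm i ∈ D := by
      simp only [D, Finset.mem_filter, Finset.mem_univ, true_and]
      refine ⟨j, fun h0 => hj ?_⟩
      rw [← hpd, σ.apply_symm_apply] at h0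
      exact h0
    rw [hσD, σ.apply_symm_apply] at h1
    simp only [T, Finset.mem_filter, Finset.mem_univ, true_and] at h1
    omega

end

section

variable {n N : ℕ}

/-! ### Comparison of adapted coordinates -/

/-- The weight which agrees with `L` for the first `k` variables and is `σ` for the others. -/
def withTail (k : ℕ) (L : Fin n → ℚ) (σ : ℚ) : Fin n → ℚ := fun i => if i.val < k then L i else σ

/-- The degree in the variables from the `k`-th on. -/
def tailDeg (k : ℕ) (α : Fin n →₀ ℕ) : ℚ :=
  Finsupp.weight (fun i : Fin n => if i.val < k then (0 : ℚ) else 1) α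

theorem weight_withTail (k : ℕ) (L : Fin n → ℚ) (σ : ℚ) (α : Fin n →₀ ℕ) :
    Finsupp.weight (withTail k L σ) α = Finsupp.weight (headW k L) α + σ * tailDeg k α := by
  rw [tailDeg, weight_eq_sum', weight_eq_sum', weight_eq_sum', Finset.mul_sum,
    ← Finset.sum_add_distrib]
  refine Finset.sum_congr rfl fun i _ => ?_
  unfold withTail headW
  split_ifs <;> ring

theorem tailDeg_nonneg (k : ℕ) (α : Fin n →₀ ℕ) : 0 ≤ tailDeg k α :=
  weight_nonneg (fun i => by split_ifs <;> norm_num) α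

theorem exists_of_tailDeg_pos {k : ℕ} {α : Fin n →₀ ℕ} (h : 0 < tailDeg k α) :
    ∃ i : Fin n, k ≤ i.val ∧ α i ≠ 0 := by
  by_contra hcon
  push Not at hcon
  refine h.ne' ?_
  rw [tailDeg, weight_eq_sum']
  refine Finset.sum_eq_zero fun i _ => ?_
  split_ifs with hi
  · rw [mul_zero]
  · rw [hcon i (not_lt.1 hi)]; simp

theorem tailDeg_eq_zero {k : ℕ} {α : Fin n →₀ ℕ} (h : ∀ i : Fin n, k ≤ i.val → α i = 0) :
    tailDeg k α = 0 := by
  by_contra h0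
  obtain ⟨i, hi, hne⟩ := exists_of_tailDeg_pos (lt_of_le_of_ne (tailDeg_nonneg k α) (Ne.symm h0))
  exact hne (h i hi)

/-- Lower the tail weight from `τ` until some monomial of `b` is about to become too light, say at
`σ > τ'`. There the leading part of `b` is a homogeneous change that involves a tail variable in a
head component. Yet it turns the leading tuple `F` into polynomials free of tail variables, since
the competitor `μ` is strictly smaller than `σ` on the tail. Transporting a tail coordinate field
then yields a nonzero field of negative weight in head directions that annihilates `F`. -/
theorem weightNonneg_next {k : ℕ} {τ τ' : ℚ} {L : Fin n → ℚ} (hτ' : 0 < τ') (hττ : τ' < τ)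
    (hLτ : ∀ i, τ ≤ L i) (hLt : ∀ i : Fin n, k ≤ i.val → L i = τ)
    {g : Fin N → (Fin n → ℂ) → ℂ} (hg : ∀ j, AnalyticAt ℂ (g j) 0)
    (hord : ∀ j, OrdGE (withTail k L τ') (1 / 2) (g j))
    (hfree : ∀ j, ∀ i : Fin n, k ≤ i.val → pderiv i (leads L g j) = 0)
    (hno : NoNegField k L (leads L g))
    {b : (Fin n → ℂ) → Fin n → ℂ} (hb : AnalyticAt ℂ b 0) (hb0 : b 0 = 0)
    (hbij : Function.Bijective (fderiv ℂ b 0)) (hbL : WeightNonneg L b)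
    {μ : Fin n → ℚ} (hμ : ∀ j, OrdGE μ (1 / 2) (g j ∘ b))
    (hμh : ∀ i : Fin n, i.val < k → μ i = L i) (hμt : ∀ i : Fin n, k ≤ i.val → μ i ≤ τ') :
    WeightNonneg (withTail k L τ') b := by
  classical
  have hL : ∀ i, 0 < L i := fun i => (hτ'.trans hττ).trans_le (hLτ i)
  have hLpos : ∀ σ, 0 < σ → ∀ i, 0 < withTail k L σ i := by
    intro σ hσ i; unfold withTail; split_ifs
    · exact hL i
    · exact hσ
  have hLeq : withTail k L τ = L := by
    funext i; unfold withTail; split_ifs with h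
    · rfl
    · exact (hLt i (not_lt.1 h)).symm
  by_contra hcon
  have hoff : ∃ x : Fin n × (Fin n →₀ ℕ), x.1.val < k ∧ coeffAt (fun z => b z x.1) x.2 ≠ 0 ∧
      Finsupp.weight (withTail k L τ') x.2 < L x.1 := by
    unfold WeightNonneg OrdGE at hcon
    push Not at hcon
    obtain ⟨i, α, hα, hlt⟩ := hcon
    have hik : i.val < k := by
      by_contra hge
      have h0 : α ≠ 0 := by
        rintro rfl
        rw [coeffAt_zero (analyticAt_apply hb i), hb0] at hα
        exact hα rfl
      obtain ⟨l, hl⟩ := Finsupp.ne_iff.1 h0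
      have h1 := mul_le_weight (fun i => (hLpos τ' hτ' i).le) α l
      have h2 : (1 : ℚ) ≤ α l := by exact_mod_cast Nat.one_le_iff_ne_zero.2 hl
      have h3 : τ' ≤ withTail k L τ' l := by
        unfold withTail; split_ifs
        · exact hττ.le.trans (hLτ l)
        · exact le_rfl
      have h4 : withTail k L τ' i = τ' := if_neg hge
      rw [h4] at hlt
      nlinarith
    refine ⟨(i, α), hik, hα, ?_⟩
    have : withTail k L τ' i = L i := if_pos hik
    rwa [this] at hlt
  have hfin : {x : Fin n × (Fin n →₀ ℕ) | x.1.val < k ∧ coeffAt (fun z => b z x.1) x.2 ≠ 0 ∧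
      Finsupp.weight (withTail k L τ') x.2 < L x.1}.Finite := by
    obtain ⟨C, hC⟩ : ∃ C, ∀ i, L i ≤ C := by
      obtain ⟨C, hC⟩ := (Set.finite_range L).bddAbove
      exact ⟨C, fun i => hC ⟨i, rfl⟩⟩
    refine ((Set.finite_univ (α := Fin n)).prod (finite_weight_le (hLpos τ' hτ') C)).subset ?_
    rintro ⟨i, α⟩ ⟨-, -, h⟩
    exact ⟨Set.mem_univ _, (h.trans_le (hC i)).le⟩
  -- The tail weight at which the monomial `x.2` has weight exactly `L x.1`; it lies in `(τ', τ]`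
  -- for an offending monomial. At the largest such value `b` does not yet decrease weights.
  let s : Fin n × (Fin n →₀ ℕ) → ℚ := fun x =>
    (L x.1 - Finsupp.weight (headW k L) x.2) / tailDeg k x.2
  have htd : ∀ x : Fin n × (Fin n →₀ ℕ), (x.1.val < k ∧ coeffAt (fun z => b z x.1) x.2 ≠ 0 ∧
      Finsupp.weight (withTail k L τ') x.2 < L x.1) → 0 < tailDeg k x.2 ∧ τ' < s x ∧ s x ≤ τ := by
    rintro ⟨i, α⟩ ⟨-, h2, h3⟩
    have h4 := hbL i α h2
    rw [← hLeq, weight_withTail, hLeq] at h4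
    simp only at h3 ⊢
    rw [weight_withTail] at h3
    have h5 : 0 < tailDeg k α := by
      have := tailDeg_nonneg k α
      rcases this.eq_or_lt with h0 | h0
      · rw [← h0] at h3 h4; linarith
      · exact h0
    refine ⟨h5, ?_, ?_⟩
    · simp only [s]; rw [lt_div_iff₀ h5]; linarith
    · simp only [s]; rw [div_le_iff₀ h5]; linarith
  obtain ⟨⟨i₁, α₁⟩, hx, hmax⟩ := Set.exists_max_image _ s hfin hoff
  obtain ⟨htd₁, hs1, hs2⟩ := htd _ hx
  set σ := s (i₁, α₁) with hσ
  have hσpos : 0 < σ := hτ'.trans hs1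
  let M := withTail k L σ
  have hMpos : ∀ i, 0 < M i := hLpos σ hσpos
  have hMle : ∀ i, withTail k L τ' i ≤ M i := by
    intro i; simp only [M, withTail]; split_ifs
    · exact le_rfl
    · exact hs1.le
  have hbM : WeightNonneg M b := by
    intro i α hα
    by_contra hlt
    rw [not_le] at hlt
    rcases lt_or_ge i.val k with hi | hi
    · have hMi : M i = L i := if_pos hi
      rw [hMi] at hlt
      have hmem : (i.val < k ∧ coeffAt (fun z => b z i) α ≠ 0 ∧
        Finsupp.weight (withTail k L τ') α < L i) := ⟨hi, hα, (weight_mono hMle α).trans_lt hlt⟩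
      obtain ⟨h1, -, -⟩ := htd (i, α) hmem
      have h2 := hmax (i, α) hmem
      simp only [M, weight_withTail] at hlt
      have h3 : σ < s (i, α) := by
        simp only [s]; rw [lt_div_iff₀ h1]; linarith
      exact absurd h2 (not_le.2 h3)
    · have hMi : M i = σ := if_neg (not_lt.2 hi)
      rw [hMi] at hlt
      have h0 : α ≠ 0 := by
        rintro rfl
        rw [coeffAt_zero (analyticAt_apply hb i), hb0] at hα
        exact hα rfl
      obtain ⟨l, hl⟩ := Finsupp.ne_iff.1 h0
      have h1 := mul_le_weight (fun i => (hMpos i).le) α l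
      have h2 : (1 : ℚ) ≤ α l := by exact_mod_cast Nat.one_le_iff_ne_zero.2 hl
      have h3 : σ ≤ M l := by
        simp only [M, withTail]; split_ifs
        · exact hs2.trans (hLτ l)
        · exact le_rfl
      nlinarith
  have hordM : ∀ j, OrdGE M (1 / 2) (g j) := fun j α hα => (hord j α hα).trans (weight_mono hMle α)
  have hlead : leads M g = leads L g := by
    funext j
    ext α
    simp only [leads]
    rw [coeff_lead hMpos, coeff_lead hL]
    by_cases hα : coeffAt (g j) α = 0
    · simp [hα]
    have key : ∀ h : (∀ i : Fin n, k ≤ i.val → α i = 0),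
        Finsupp.weight M α = Finsupp.weight L α := fun h => by
      rw [← hLeq, weight_withTail, weight_withTail, tailDeg_eq_zero h, mul_zero, mul_zero]
    by_cases hM : Finsupp.weight M α = 1 / 2
    · have h1 : ∀ i : Fin n, k ≤ i.val → α i = 0 := fun i hi =>
        eq_zero_of_weight_le hMle (hM.le.trans (hord j α hα)) (by
          simp only [M, withTail, if_neg (not_lt.2 hi)]; exact hs1)
      rw [if_pos hM, if_pos ((key h1).symm.trans hM)]
    · rw [if_neg hM]
      split_ifs with hLα
      · exfalso
        refine hM ((key fun i hi => ?_).trans hLα)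
        by_contra h0
        have h1 := coeff_eq_zero_of_pderiv (hfree j i hi) h0
        simp only [leads] at h1
        rw [coeff_lead hL, if_pos hLα] at h1
        exact hα h1
      · rfl
  obtain ⟨hordb, hleadb⟩ := leads_comp hMpos hg hordM hb hb0 hbM
  obtain ⟨hβ, χ, hχ, hχ1, hχ2⟩ := isHomogeneousChange_leadMap hMpos hb hbij hbM
  rw [hlead] at hleadb
  have hμM : ∀ i, μ i ≤ M i := by
    intro i
    simp only [M, withTail]
    split_ifs with hi
    · exact (hμh i hi).le
    · exact (hμt i (not_lt.1 hi)).trans hs1.le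
  -- `μ ≤ M` with strict inequality on the tail: a monomial of `M`-weight `1/2` with a tail variable
  -- would have `μ`-weight less than `1/2`.
  have hzero : ∀ l, ∀ i : Fin n, k ≤ i.val →
      pderiv i (bind₁ (leadMap M b) (leads L g l)) = 0 := by
    intro l i hi
    rw [← congrFun hleadb l]
    refine pderiv_eq_zero_of_coeff fun α hα => ?_
    simp only [leads]
    rw [coeff_lead hMpos]
    split_ifs with hw
    · by_contra hne
      refine hα (eq_zero_of_weight_le hμM (hw.le.trans (hμ l α hne)) ?_)
      simp only [M, withTail, if_neg (not_lt.2 hi)]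
      exact (hμt i hi).trans_lt hs1
    · rfl
  obtain ⟨j, hj, hjα⟩ := exists_of_tailDeg_pos htd₁
  have hMj : M j = σ := if_neg (not_lt.2 hj)
  -- The head components of the field `∂/∂z_j` transported by the leading part of `b`. Component `i`
  -- has `M`-weight `λ_i - σ`, so its head weight is less than `λ_i`; the tail components play no
  -- role since `F` is free of tail variables.
  let Y : Fin n → MvPolynomial (Fin n) ℂ := fun i =>
    if i.val < k then bind₁ χ (pderiv j (leadMap M b i)) else 0
  have hY := hno Y (fun i hi => if_neg (not_lt.2 hi)) (fun i => by
      simp only [Y]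
      split_ifs with hi
      · intro α hα
        have h1 := isWeightedHomogeneous_bind₁ hχ (isWeightedHomogeneous_pderiv (hβ i) j)
          (mem_support_iff.1 hα)
        have hMi : M i = L i := if_pos hi
        rw [hMi, hMj, weight_withTail] at h1
        have := mul_nonneg hσpos.le (tailDeg_nonneg k α)
        linarith
      · intro α hα; simp at hα) (fun l => by
      have h1 := congrArg (bind₁ χ) (hzero l j hj)
      rw [pderiv_bind₁, map_sum, map_zero] at h1
      rw [← h1]
      refine Finset.sum_congr rfl fun i _ => ?_
      have hX : (fun i => bind₁ χ (leadMap M b i)) = X := funext hχ2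
      rw [map_mul, bind₁_bind₁, hX, bind₁_X_left, AlgHom.id_apply]
      simp only [Y]
      split_ifs with hi
      · rw [mul_comm]
      · rw [hfree l i (not_lt.1 hi)]; simp) i₁
  simp only [Y, if_pos hx.1] at hY
  have hX : (fun i => bind₁ (leadMap M b) (χ i)) = X := funext hχ1
  have h1 := congrArg (bind₁ (leadMap M b)) hY
  rw [bind₁_bind₁, hX, bind₁_X_left, AlgHom.id_apply, map_zero] at h1
  have h2 := coeff_eq_zero_of_pderiv h1 hjα
  simp only [leadMap] at h2
  have hMi : M i₁ = L i₁ := if_pos hx.1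
  rw [coeff_lead hMpos, if_pos] at h2
  · exact hx.2.1 h2
  · rw [hMi, weight_withTail, hσ]
    simp only [s]
    rw [div_mul_cancel₀ _ htd₁.ne']
    ring

end

section

variable {n N : ℕ}

/-! ### The invariant of the algorithm -/

/-- `φ` is bijective, and `φ` and its inverse are holomorphic at the fixed point `0`. -/
structure IsAut (φ : (Fin n → ℂ) → Fin n → ℂ) : Prop where
  analyticAt : AnalyticAt ℂ φ 0
  map_zero : φ 0 = 0
  exists_inv : ∃ φ' : (Fin n → ℂ) → Fin n → ℂ, AnalyticAt ℂ φ' 0 ∧ φ' 0 = 0 ∧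
    (∀ z, φ' (φ z) = z) ∧ ∀ z, φ (φ' z) = z

theorem isAut_id : IsAut (id : (Fin n → ℂ) → Fin n → ℂ) :=
  ⟨analyticAt_id, rfl, id, analyticAt_id, rfl, fun _ => rfl, fun _ => rfl⟩

theorem IsAut.comp {φ ψ : (Fin n → ℂ) → Fin n → ℂ} (hφ : IsAut φ) (hψ : IsAut ψ) :
    IsAut (φ ∘ ψ) := by
  obtain ⟨h1, h2, φ', h3, h4, h5, h6⟩ := hφ
  obtain ⟨k1, k2, ψ', k3, k4, k5, k6⟩ := hψ
  refine ⟨AnalyticAt.comp (by rwa [k2]) k1, by simp [k2, h2], ψ' ∘ φ',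
    AnalyticAt.comp (by rwa [h4]) h3, by simp [k4, h4], fun z => by simp [h5, k5],
    fun z => by simp [h6, k6]⟩

theorem IsAut.bijective_fderiv {φ : (Fin n → ℂ) → Fin n → ℂ} (hφ : IsAut φ) :
    Function.Bijective (fderiv ℂ φ 0) := by
  obtain ⟨h1, h2, φ', h3, h4, h5, h6⟩ := hφ
  have hd := h1.differentiableAt.hasFDerivAt
  have hd' := h3.differentiableAt.hasFDerivAt
  have e1 : (fderiv ℂ φ' 0).comp (fderiv ℂ φ 0) = ContinuousLinearMap.id ℂ _ := by
    have := HasFDerivAt.comp (0 : Fin n → ℂ) (g := φ') (by rw [h2]; exact hd') hd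
    exact (this.congr_of_eventuallyEq (Eventually.of_forall fun z => (h5 z).symm)).unique
      (hasFDerivAt_id 0)
  have e2 : (fderiv ℂ φ 0).comp (fderiv ℂ φ' 0) = ContinuousLinearMap.id ℂ _ := by
    have := HasFDerivAt.comp (0 : Fin n → ℂ) (g := φ) (by rw [h4]; exact hd) hd'
    exact (this.congr_of_eventuallyEq (Eventually.of_forall fun z => (h6 z).symm)).unique
      (hasFDerivAt_id 0)
  refine Function.bijective_iff_has_inverse.2 ⟨fderiv ℂ φ' 0, fun v => ?_, fun v => ?_⟩
  · exact DFunLike.congr_fun e1 v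
  · exact DFunLike.congr_fun e2 v

theorem polyMap_comp_eq {ψ χ : Fin n → MvPolynomial (Fin n) ℂ}
    (h : ∀ i, bind₁ χ (ψ i) = X i) (z : Fin n → ℂ) : polyMap ψ (polyMap χ z) = z := by
  have h1 := congrFun (polyMap_bind₁ χ ψ) z
  rw [show (fun i => bind₁ χ (ψ i)) = X from funext h] at h1
  rw [Function.comp_apply] at h1
  rw [← h1]
  funext i
  simp [polyMap]

theorem IsHomogeneousChange.isAut {L : Fin n → ℚ} (hL : ∀ i, 0 < L i)
    {ψ : Fin n → MvPolynomial (Fin n) ℂ} (hψ : IsHomogeneousChange L ψ) : IsAut (polyMap ψ) := by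
  obtain ⟨h1, χ, h2, h3, h4⟩ := hψ
  exact ⟨analyticAt_polyMap ψ 0, polyMap_zero_of_homogeneous hL h1, polyMap χ,
    analyticAt_polyMap χ 0, polyMap_zero_of_homogeneous hL h2, polyMap_comp_eq h3,
    polyMap_comp_eq h4⟩

/-- `a` is a germ of a biholomorphism such that all terms of `f_j ∘ a` have `μ`-weight at least
`1/2`. -/
structure Admissible (f : Fin N → (Fin n → ℂ) → ℂ) (μ : Fin n → ℚ)
    (a : (Fin n → ℂ) → Fin n → ℂ) : Prop where
  analyticAt : AnalyticAt ℂ a 0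
  map_zero : a 0 = 0
  bijective : Function.Bijective (fderiv ℂ a 0)
  antitone : Antitone μ
  ord : ∀ j, OrdGE μ (1 / 2) (f j ∘ a)

/-- `a` factors through `φ` by a germ of a biholomorphism that does not decrease weights. -/
def Factors (L : Fin n → ℚ) (φ a : (Fin n → ℂ) → Fin n → ℂ) : Prop :=
  ∃ b : (Fin n → ℂ) → Fin n → ℂ, AnalyticAt ℂ b 0 ∧ b 0 = 0 ∧ Function.Bijective (fderiv ℂ b 0) ∧
    φ ∘ b = a ∧ WeightNonneg L b

/-- What is known about the weight and the coordinates in which the first `k` variables are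
settled. -/
structure KolarInv (f : Fin N → (Fin n → ℂ) → ℂ) (k : ℕ) (τ : ℚ) (L : Fin n → ℚ)
    (φ : (Fin n → ℂ) → Fin n → ℂ) : Prop where
  lt : k < n
  pos : 0 < τ
  tail : TailConst k τ L
  weight : IsWeight L
  aut : IsAut φ
  ord : ∀ j, OrdGE L (1 / 2) (f j ∘ φ)
  noField : NoNegField k L (leads L fun j => f j ∘ φ)
  compare : ∀ μ a, Admissible f μ a → toLex L < toLex μ ∨
    (∀ i : Fin n, i.val < k → μ i = L i) ∧ (∀ i : Fin n, k ≤ i.val → μ i ≤ τ) ∧ Factors L φ a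

theorem KolarInv.pos' {f : Fin N → (Fin n → ℂ) → ℂ} {k : ℕ} {τ : ℚ} {L : Fin n → ℚ}
    {φ : (Fin n → ℂ) → Fin n → ℂ} (h : KolarInv f k τ L φ) (i : Fin n) : 0 < L i :=
  h.pos.trans_le (h.tail.le i)

theorem analyticAt_comp_aut {f : Fin N → (Fin n → ℂ) → ℂ} (hf : ∀ j, AnalyticAt ℂ (f j) 0)
    {φ : (Fin n → ℂ) → Fin n → ℂ} (hφ : IsAut φ) (j : Fin N) : AnalyticAt ℂ (f j ∘ φ) 0 :=
  AnalyticAt.comp (by rw [hφ.map_zero]; exact hf j) hφ.analyticAt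

/-- What is known after the reduction of step `t`, when the first `k'` variables are settled. -/
structure ReducedInv (f : Fin N → (Fin n → ℂ) → ℂ) (k k' : ℕ) (τ : ℚ) (L : Fin n → ℚ)
    (φ : (Fin n → ℂ) → Fin n → ℂ) : Prop where
  aut : IsAut φ
  ord : ∀ j, OrdGE L (1 / 2) (f j ∘ φ)
  free : ∀ j, ∀ i : Fin n, k' ≤ i.val → pderiv i (leads L (fun j => f j ∘ φ) j) = 0
  le : k ≤ k'
  noField : NoNegField k' L (leads L fun j => f j ∘ φ)
  compare : ∀ μ a, Admissible f μ a → toLex L < toLex μ ∨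
    (∀ i : Fin n, i.val < k' → μ i = L i) ∧ (∀ i : Fin n, k ≤ i.val → μ i ≤ τ) ∧ Factors L φ a

/-- Maximality of the number of free variables gives both halves: rigidity for the newly settled
variables through `NoNegField.of_irreducible`, and equality of the entries of a competing `μ` with
those of `L`. -/
theorem KolarInv.reduced {f : Fin N → (Fin n → ℂ) → ℂ} (hf : ∀ j, AnalyticAt ℂ (f j) 0) {k : ℕ}
    {τ : ℚ} {L : Fin n → ℚ} {φ : (Fin n → ℂ) → Fin n → ℂ} (h : KolarInv f k τ L φ)
    {ψ : Fin n → MvPolynomial (Fin n) ℂ} (hψ : Reduces L (leads L fun j => f j ∘ φ) ψ) :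
    ReducedInv f k (n - freeCount (leads L fun j => f j ∘ (φ ∘ polyMap ψ))) τ L
      (φ ∘ polyMap ψ) := by
  have hL := h.pos'
  obtain ⟨hch, hmax, hdep⟩ := hψ
  obtain ⟨h1, h2, h3⟩ := leads_polyMap hL (analyticAt_comp_aut hf h.aut) h.ord hch.1
  have h3' : leads L (fun j => f j ∘ (φ ∘ polyMap ψ)) =
    fun j => bind₁ ψ (leads L (fun j => f j ∘ φ) j) := h3
  have haut := h.aut.comp (hch.isAut hL)
  rw [h3']
  set G : Fin N → MvPolynomial (Fin n) ℂ := fun j => bind₁ ψ (leads L (fun j => f j ∘ φ) j) with hG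
  have hno : NoNegField k L G := h.noField.bind₁ h.tail h.pos hch
  have hn := freeCount_add_ncard G
  have hfree : ∀ j, ∀ i : Fin n, n - freeCount G ≤ i.val → pderiv i (G j) = 0 := by
    intro j i hi
    by_contra hne
    exact absurd (hdep i ⟨j, hne⟩) (not_lt.2 hi)
  have hirr : ∀ ψ', IsHomogeneousChange L ψ' →
      freeCount (fun j => bind₁ ψ' (G j)) ≤ freeCount G := by
    intro ψ' hψ'
    have := hmax _ (hch.comp hψ')
    simp only [← bind₁_bind₁] at this
    exact this
  have hkk : k ≤ n - freeCount G := by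
    by_contra hlt
    have hkn := h.lt
    have := (hno.depends h.tail h.pos (i := ⟨n - freeCount G, by omega⟩) (not_le.1 hlt))
    obtain ⟨j, hj⟩ := this
    exact hj (hfree j _ le_rfl)
  refine ⟨haut, h2, fun j i hi => ?_, hkk, ?_, ?_⟩
  · rw [h3']; exact hfree j i hi
  · rw [h3']
    refine NoNegField.of_irreducible h.tail h.pos hkk (Nat.sub_le _ _) (w := 1 / 2) (fun j => ?_)
      hfree hno fun ψ' hψ' => ?_
    · exact isWeightedHomogeneous_bind₁ hch.1 (isWeightedHomogeneous_lead hL _ _)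
    · have := hirr ψ' hψ'
      omega
  · intro μ a ha
    rcases h.compare μ a ha with hlt | ⟨hμh, hμt, b, hb, hb0, hbij, hba, hbL⟩
    · exact Or.inl hlt
    right
    obtain ⟨hψ1, χ, hχ, hχ1, hχ2⟩ := id hch
    have hχaut : IsAut (polyMap χ) :=
      IsHomogeneousChange.isAut (L := L) hL ⟨hχ, ψ, hψ1, hχ2, hχ1⟩
    have hb' : AnalyticAt ℂ (polyMap χ ∘ b) 0 := (analyticAt_polyMap χ _).comp hb
    have hb'0 : (polyMap χ ∘ b) 0 = 0 := by rw [Function.comp_apply, hb0, hχaut.map_zero]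
    have hb'bij : Function.Bijective (fderiv ℂ (polyMap χ ∘ b) 0) := by
      rw [fderiv_comp _ (analyticAt_polyMap χ _).differentiableAt hb.differentiableAt, hb0]
      exact hχaut.bijective_fderiv.comp hbij
    have hb'a : (φ ∘ polyMap ψ) ∘ (polyMap χ ∘ b) = a := by
      rw [← hba]
      funext z
      simp only [Function.comp_apply, polyMap_comp_eq hχ2]
    have hb'L : WeightNonneg L (polyMap χ ∘ b) := fun i =>
      ((polyMap_weightNonneg hχ i).comp hL (analyticAt_apply (analyticAt_polyMap χ 0) i)
        hb hb0 hbL).1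
    refine ⟨?_, hμt, polyMap χ ∘ b, hb', hb'0, hb'bij, hb'a, hb'L⟩
    -- If `μ s < τ` for some newly settled `s`, all later entries are also less than `τ`. Then the
    -- leading part of the factor frees `z_s` and all variables after it, which are more than the
    -- maximum.
    by_contra hcon
    push Not at hcon
    obtain ⟨s, hs, hsne⟩ := hcon
    have hsk : k ≤ s.val := by
      by_contra hlt; exact hsne (hμh s (not_le.1 hlt))
    have hslt : μ s < τ := lt_of_le_of_ne (hμt s hsk) (by rwa [← h.tail.1 s hsk])
    obtain ⟨-, hlead⟩ := leads_comp hL h1 h2 hb' hb'0 hb'L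
    rw [h3] at hlead
    have hμL : ∀ i, μ i ≤ L i := by
      intro i
      rcases lt_or_ge i.val k with hi | hi
      · exact (hμh i hi).le
      · rw [h.tail.1 i hi]; exact hμt i hi
    have hzero : ∀ i : Fin n, s.val ≤ i.val → ∀ j,
        pderiv i (bind₁ (leadMap L (polyMap χ ∘ b)) (G j)) = 0 := by
      intro i hi j
      rw [← congrFun hlead j]
      refine pderiv_eq_zero_of_coeff fun α hα => ?_
      simp only [leads]
      rw [coeff_lead hL]
      split_ifs with hw
      · by_contra hne
        have hfa : (fun j => ((f j ∘ φ) ∘ polyMap ψ) ∘ (polyMap χ ∘ b)) = fun j => f j ∘ a := by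
          rw [← hb'a]; rfl
        rw [congrFun hfa j] at hne
        refine hα (eq_zero_of_weight_le hμL (hw.le.trans (ha.ord j α hne)) ?_)
        rw [h.tail.1 i (hsk.trans hi)]
        exact (ha.antitone hi).trans_lt hslt
      · rfl
    have h5 := le_freeCount s.2.le hzero
    have h6 := hirr _ (isHomogeneousChange_leadMap hL hb' hb'bij hb'L)
    omega

/-! ### Passing to the next weight -/

theorem headWeight_eq (k : ℕ) (L : Fin n → ℚ) (e : MixedExp n) :
    headWeight k L e =
      Finsupp.weight (headW k L) (holPart e) + Finsupp.weight (headW k L) (antiPart e) := by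
  rw [← mixedWeight_eq, headWeight, mixedWeight, Finset.sum_filter]
  refine Finset.sum_congr rfl fun i _ => ?_
  unfold headW
  split_ifs <;> simp

theorem tailDegree_eq (k : ℕ) (e : MixedExp n) :
    (tailDegree k e : ℚ) = tailDeg k (holPart e) + tailDeg k (antiPart e) := by
  unfold tailDeg
  rw [← mixedWeight_eq, tailDegree, mixedWeight, Finset.sum_filter]
  push_cast
  refine Finset.sum_congr rfl fun i _ => ?_
  by_cases hi : i.val < k
  · simp [hi]
  · simp [hi, not_lt.1 hi]

theorem mixedWeight_withTail (k : ℕ) (L : Fin n → ℚ) (σ : ℚ) (e : MixedExp n) :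
    mixedWeight (withTail k L σ) e = headWeight k L e + σ * tailDegree k e := by
  rw [mixedWeight_eq, weight_withTail, weight_withTail, headWeight_eq, tailDegree_eq]
  ring

theorem withTail_eq {k : ℕ} {τ : ℚ} {L : Fin n → ℚ} (h : ∀ i : Fin n, k ≤ i.val → L i = τ) :
    withTail k L τ = L := by
  funext i
  unfold withTail
  split_ifs with hi
  · rfl
  · exact (h i (not_lt.1 hi)).symm

/-- `W` is the tail weight at which the term has weight one. The term weighs more than one for the
tail weight `τ`, so its tail degree is positive and `W < τ`. -/
theorem theta_facts {ρ : (Fin n → ℂ) → ℝ} {k : ℕ} {τ : ℚ} {L : Fin n → ℚ}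
    (h : ∀ i : Fin n, k ≤ i.val → L i = τ) {e : MixedExp n} (he : e ∈ Theta ρ k L) :
    (0 : ℚ) < tailDegree k e ∧ 0 < Wvalue k L e ∧ Wvalue k L e < τ := by
  obtain ⟨-, h1, h2⟩ := he
  rw [← withTail_eq h, mixedWeight_withTail] at h1
  have h3 : (0 : ℚ) < tailDegree k e := by
    have h0 : (0 : ℚ) ≤ tailDegree k e := Nat.cast_nonneg _
    rcases h0.eq_or_lt with h0 | h0
    · rw [← h0] at h1; linarith
    · exact h0
  refine ⟨h3, div_pos (by linarith) h3, ?_⟩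
  rw [Wvalue, div_lt_iff₀ h3]
  linarith

section Next

variable {f : Fin N → (Fin n → ℂ) → ℂ} {k k' : ℕ} {τ : ℚ} {L L' : Fin n → ℚ}
  {φ₀ φ : (Fin n → ℂ) → Fin n → ℂ}

theorem ReducedInv.tail' (h₀ : KolarInv f k τ L φ₀) (h : ReducedInv f k k' τ L φ) :
    ∀ i : Fin n, k' ≤ i.val → L i = τ := fun i hi => h₀.tail.1 i (h.le.trans hi)

/-- The diagonal term `(α, α)` occurs in `ρ` and weighs at least one. If it weighed exactly one, `α`
would occur in the leading tuple, hence be free of tail variables, and its head weight would be one.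
-/
theorem ReducedInv.mem_Theta (hf : ∀ j, AnalyticAt ℂ (f j) 0) (h₀ : KolarInv f k τ L φ₀)
    (h : ReducedInv f k k' τ L φ) {j : Fin N} {α : Fin n →₀ ℕ}
    (hα : coeffAt (f j ∘ φ) α ≠ 0) (hw : headWeight k' L (mkExp α α) < 1) :
    mkExp α α ∈ Theta (sumSq f ∘ φ) k' L := by
  have hL := h₀.pos'
  refine ⟨taylorCoeff_sumSq_diag_ne_zero (g := fun j => f j ∘ φ) (analyticAt_comp_aut hf h.aut) hα,
    ?_, hw⟩
  have h1 := h.ord j α hα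
  have h2 : mixedWeight L (mkExp α α) = 2 * Finsupp.weight L α := by
    rw [mixedWeight_eq, holPart_mkExp, antiPart_mkExp]; ring
  refine lt_of_le_of_ne (by linarith) fun heq => ?_
  have hw2 : Finsupp.weight L α = 1 / 2 := by linarith
  have hα0 : ∀ i : Fin n, k' ≤ i.val → α i = 0 := by
    intro i hi
    by_contra hne
    have h3 := coeff_eq_zero_of_pderiv (h.free j i hi) hne
    simp only [leads] at h3
    rw [coeff_lead hL, if_pos hw2] at h3
    exact hα h3
  rw [headWeight_eq, holPart_mkExp, antiPart_mkExp, weight_headW_of_tail L hα0] at hw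
  linarith

theorem headWeight_single_of_le {i : Fin n} (hi : k' ≤ i.val) (l : ℕ) :
    headWeight k' L (mkExp (Finsupp.single i l) (Finsupp.single i l)) = 0 := by
  rw [headWeight_eq, holPart_mkExp, antiPart_mkExp, Finsupp.weight_single, headW,
    if_neg (not_lt.2 hi)]
  simp

/-- A pure power of a tail variable makes `Θ` nonempty. `Θ` may be infinite, but its terms with `W`
at least that of the given `e₀` weigh at most one for the tail weight `W(e₀) > 0`, so they are
finitely many and the maximum exists. -/
theorem ReducedInv.exists_next (hf : ∀ j, AnalyticAt ℂ (f j) 0) (h₀ : KolarInv f k τ L φ₀)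
    (h : ReducedInv f k k' τ L φ) {i : Fin n} (hi : k' ≤ i.val) {j : Fin N} {l : ℕ}
    (hl : coeffAt (f j ∘ φ) (Finsupp.single i l) ≠ 0) :
    ∃ L', IsNextWeight (sumSq f ∘ φ) k' L L' := by
  have hL := h₀.pos'
  have hmem := h.mem_Theta hf h₀ hl (by rw [headWeight_single_of_le hi]; norm_num)
  set e₀ := mkExp (Finsupp.single i l) (Finsupp.single i l)
  obtain ⟨-, hW0, -⟩ := theta_facts (h.tail' h₀) hmem
  have hfin : {e | e ∈ Theta (sumSq f ∘ φ) k' L ∧ Wvalue k' L e₀ ≤ Wvalue k' L e}.Finite := by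
    refine (finite_mixedWeight_le (L := withTail k' L (Wvalue k' L e₀)) (fun i => ?_) 1).subset ?_
    · unfold withTail; split_ifs
      · exact hL i
      · exact hW0
    · rintro e ⟨he, hle⟩
      obtain ⟨h1, -, -⟩ := theta_facts (h.tail' h₀) he
      have h2 := (le_div_iff₀ h1).1
        (show Wvalue k' L e₀ ≤ (1 - headWeight k' L e) / tailDegree k' e from hle)
      change mixedWeight _ _ ≤ _
      rw [mixedWeight_withTail]
      linarith
  obtain ⟨e, he, hmax⟩ := Set.exists_max_image _ (Wvalue k' L) hfin ⟨e₀, hmem, le_rfl⟩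
  refine ⟨withTail k' L (Wvalue k' L e), fun i hi => if_pos hi, fun i hi => ?_⟩
  have : withTail k' L (Wvalue k' L e) i = Wvalue k' L e := if_neg (not_lt.2 hi)
  rw [this]
  refine ⟨⟨e, he.1, rfl⟩, ?_⟩
  rintro _ ⟨e', he', rfl⟩
  rcases le_total (Wvalue k' L e₀) (Wvalue k' L e') with h1 | h1
  · exact hmax e' ⟨he', h1⟩
  · exact h1.trans he.2

theorem ReducedInv.next (hf : ∀ j, AnalyticAt ℂ (f j) 0) (h₀ : KolarInv f k τ L φ₀)
    (h : ReducedInv f k k' τ L φ) (hk' : k' < n)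
    (hL' : IsNextWeight (sumSq f ∘ φ) k' L L') :
    ∃ τ', τ' < τ ∧ KolarInv f k' τ' L' φ := by
  have hL := h₀.pos'
  set τ' := L' ⟨k', hk'⟩ with hτ'
  have hgr := hL'.2 ⟨k', hk'⟩ le_rfl
  have htail : ∀ i : Fin n, k' ≤ i.val → L' i = τ' := fun i hi => (hL'.2 i hi).unique hgr
  obtain ⟨e, he, heW⟩ := hgr.1
  obtain ⟨htd, hW0, hWτ⟩ := theta_facts (h.tail' h₀) he
  rw [heW, ← hτ'] at hW0 hWτ
  have hLL' : withTail k' L τ' = L' := by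
    funext i; unfold withTail; split_ifs with hi
    · exact (hL'.1 i hi).symm
    · exact (htail i (not_lt.1 hi)).symm
  have hL'L : ∀ i, L' i ≤ L i := by
    intro i
    rcases lt_or_ge i.val k' with hi | hi
    · exact (hL'.1 i hi).le
    · rw [htail i hi, h.tail' h₀ i hi]; exact hWτ.le
  have hL'pos : ∀ i, 0 < L' i := by
    intro i
    rcases lt_or_ge i.val k' with hi | hi
    · rw [hL'.1 i hi]; exact hL i
    · rw [htail i hi]; exact hW0
  -- Diagonal terms suffice. Either the head part alone weighs at least one, or the term lies in `Θ`
  -- and `τ' ≥ W` gives weight at least one.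
  have hord : ∀ j, OrdGE L' (1 / 2) (f j ∘ φ) := by
    intro j α hα
    have h2 : mixedWeight L' (mkExp α α) = 2 * Finsupp.weight L' α := by
      rw [mixedWeight_eq, holPart_mkExp, antiPart_mkExp]; ring
    suffices H : 1 ≤ mixedWeight L' (mkExp α α) by linarith
    rw [← hLL', mixedWeight_withTail]
    by_cases hw : headWeight k' L (mkExp α α) < 1
    · have hmem := h.mem_Theta hf h₀ hα hw
      have h3 := hgr.2 ⟨_, hmem, rfl⟩
      obtain ⟨h4, -, -⟩ := theta_facts (h.tail' h₀) hmem
      rw [Wvalue, div_le_iff₀ h4] at h3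
      linarith
    · have : 0 ≤ τ' * (tailDegree k' (mkExp α α) : ℚ) := mul_nonneg hW0.le (Nat.cast_nonneg _)
      linarith
  have htc : TailConst k' τ' L' := ⟨htail, fun i hi => by
    rw [hL'.1 i hi]
    exact hWτ.trans_le (h₀.tail.le i)⟩
  refine ⟨τ', hWτ, hk', hW0, htc, ⟨fun i => (hL'pos i).le,
    fun i => (hL'L i).trans (h₀.weight.le_half i), ?_, fun t => Or.inr ?_⟩, h.aut, hord, ?_, ?_⟩
  · intro i l hil
    rcases lt_or_ge l.val k' with hl | hl
    · have hi : i.val < k' := lt_of_le_of_lt hil hl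
      rw [hL'.1 i hi, hL'.1 l hl]
      exact h₀.weight.antitone hil
    · rw [htail l hl]
      exact htc.le i
  · rcases lt_or_ge t.val k' with ht | ht
    · rcases h₀.weight.eq_one t with h1 | ⟨a, ha, hsum⟩
      · exact absurd h1 (hL t).ne'
      · refine ⟨a, ha, ?_⟩
        rw [← hsum]
        refine Finset.sum_congr rfl fun i hi => ?_
        have hit : i ≤ t := Finset.mem_Iic.1 hi
        rw [hL'.1 i ((Fin.le_def.1 hit).trans_lt ht)]
    -- The relation required of a weight comes from the term `e` where the maximum is attained: its
    -- head exponents, with the whole tail degree put on `t`.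
    · refine ⟨fun i => if i.val < k' then e (Sum.inl i) + e (Sum.inr i) else
        if i = t then tailDegree k' e else 0, ?_, ?_⟩
      · simp only [if_neg (not_lt.2 ht), if_pos]
        exact_mod_cast htd
      · have h1 : headWeight k' L e + τ' * tailDegree k' e = 1 := by
          rw [hτ', ← heW, Wvalue, div_mul_cancel₀ _ htd.ne']; ring
        rw [← h1, ← Finset.sum_filter_add_sum_filter_not _ (fun i : Fin n => i.val < k')]
        congr 1
        · rw [headWeight]
          refine Finset.sum_congr ?_ fun i hi => ?_
          · ext i
            simp only [Finset.mem_filter, Finset.mem_Iic, Finset.mem_univ, true_and]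
            refine ⟨fun h => h.2, fun h => ⟨?_, h⟩⟩
            exact Fin.le_def.2 (by omega)
          · have hi' : i.val < k' := (Finset.mem_filter.1 hi).2
            simp only [if_pos hi', hL'.1 i hi']
        · rw [Finset.sum_eq_single t]
          · simp only [if_neg (not_lt.2 ht), if_pos, htail t ht]
            exact mul_comm _ _
          · intro i hi hit
            have hi' := (Finset.mem_filter.1 hi).2
            simp only [if_neg hi', if_neg hit]; simp
          · intro h3
            simp [ht] at h3
  -- The leading tuple for `L'` may gain monomials with tail variables, but its tail-free part is
  -- the one for `L`.
  · refine h.noField.extend (fun i hi => hL'.1 i hi) (fun j α hα => ?_) h.free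
    simp only [leads]
    rw [coeff_lead hL'pos, coeff_lead hL]
    have : Finsupp.weight L' α = Finsupp.weight L α := weight_congr fun i hi => hL'.1 i (by
      by_contra hge; exact hi (hα i (not_lt.1 hge)))
    rw [this]
  · intro μ a ha
    rcases h.compare μ a ha with hlt | ⟨hμh, -, b, hb, hb0, hbij, hba, hbL⟩
    · exact Or.inl (lt_of_le_of_lt (Pi.toLex_monotone hL'L) hlt)
    -- `μ` and `L'` agree on the first `k'` entries, so the next entry decides: a larger one makes
    -- `L'` lexicographically smaller, otherwise monotonicity bounds the whole tail of `μ` by `τ'`.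
    rcases lt_or_ge τ' (μ ⟨k', hk'⟩) with hgt | hle
    · left
      refine ⟨⟨k', hk'⟩, fun i hi => ?_, ?_⟩
      · have hi' : i.val < k' := hi
        exact (hL'.1 i hi').trans (hμh i hi').symm
      · exact hgt
    · right
      have hμt : ∀ i : Fin n, k' ≤ i.val → μ i ≤ τ' := fun i hi =>
        (ha.antitone (show (⟨k', hk'⟩ : Fin n) ≤ i from hi)).trans hle
      refine ⟨fun i hi => (hμh i hi).trans (hL'.1 i hi).symm, hμt, b, hb, hb0, hbij, hba, ?_⟩
      rw [← hLL']
      refine weightNonneg_next hW0 hWτ (fun i => h₀.tail.le i) (h.tail' h₀)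
        (analyticAt_comp_aut hf h.aut) (by rw [hLL']; exact hord) h.free h.noField hb hb0 hbij hbL
        (μ := μ) (fun j => ?_) hμh hμt
      have := ha.ord j
      rwa [← hba] at this

end Next

end

section

variable {n N : ℕ}

/-! ### Consequences of finite type -/

theorem isBigO_along_axis {g : (Fin n → ℂ) → ℂ} (hg : AnalyticAt ℂ g 0) (i : Fin n) {K : ℕ}
    (h : ∀ l < K, coeffAt g (Finsupp.single i l) = 0) :
    (fun ζ : ℂ => g (Pi.single i ζ)) =O[𝓝 0] fun ζ => ‖ζ‖ ^ K := by
  obtain ⟨P, hP⟩ := exists_poly_isBigO hg K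
  have hlim : Tendsto (fun ζ : ℂ => (Pi.single i ζ : Fin n → ℂ)) (𝓝 0) (𝓝 0) := by
    have := (ContinuousLinearMap.single ℂ (fun _ : Fin n => ℂ) i).continuous.tendsto 0
    simpa using this
  have h1 : (fun ζ : ℂ => g (Pi.single i ζ) - eval (Pi.single i ζ) P) =O[𝓝 0]
      fun ζ => ‖ζ‖ ^ K := by
    refine (hP.comp_tendsto hlim).congr_right fun ζ => ?_
    simp [Pi.norm_single]
  have h2 : (fun ζ : ℂ => eval (Pi.single i ζ) P) =O[𝓝 0] fun ζ => ‖ζ‖ ^ K := by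
    simp only [eval_eq']
    refine IsBigO.fun_sum fun α hα => ?_
    by_cases hs : α = Finsupp.single i (α i)
    · have hK : K ≤ α i := by
        by_contra hlt
        have h3 := h _ (not_le.1 hlt)
        rw [coeffAt_eq_coeff hg hP (by rw [Finsupp.degree_single]; exact not_le.1 hlt), ← hs] at h3
        exact (mem_support_iff.1 hα) h3
      have h4 : ∀ ζ : ℂ, ∏ l, (Pi.single i ζ : Fin n → ℂ) l ^ α l = ζ ^ α i := by
        intro ζ
        rw [Finset.prod_eq_single i]
        · simp
        · intro l _ hl
          rw [hs, Finsupp.single_eq_of_ne hl, pow_zero]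
        · simp
      simp only [h4]
      refine IsBigO.const_mul_left ?_ _
      refine IsBigO.trans (IsBigO.of_bound 1 (Eventually.of_forall fun ζ => ?_))
        (isBigO_pow_of_le hK)
      simp
    · have : ∃ l, l ≠ i ∧ α l ≠ 0 := by
        by_contra hcon
        push Not at hcon
        refine hs (Finsupp.ext fun l => ?_)
        by_cases hl : l = i
        · subst hl; simp
        · rw [hcon l hl, Finsupp.single_eq_of_ne hl]
      obtain ⟨l, hl, hl0⟩ := this
      have h4 : ∀ ζ : ℂ, ∏ l, (Pi.single i ζ : Fin n → ℂ) l ^ α l = 0 := fun ζ =>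
        Finset.prod_eq_zero (Finset.mem_univ l) (by rw [Pi.single_eq_of_ne hl, zero_pow hl0])
      simp only [h4, mul_zero]
      exact isBigO_zero _ _
  simpa using h1.add h2

/-- The inverse of `φ` is `O(x)` at the origin, so `|ζ| = O(|φ(ζ e_i)|)`. -/
theorem vanishingOrder_axis_le {φ : (Fin n → ℂ) → Fin n → ℂ} (hφ : IsAut φ) (i : Fin n) :
    vanishingOrder (fun ζ : ℂ => ((φ (Pi.single i ζ), 0) : (Fin n → ℂ) × ℂ)) ≤ 1 := by
  obtain ⟨h1, h2, φ', h3, h4, h5, h6⟩ := hφ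
  refine iSup₂_le fun k hk => ?_
  by_contra hlt
  have hk1 : 1 < k := by
    by_contra h; exact hlt (by exact_mod_cast not_lt.1 h)
  have hlim : Tendsto (fun ζ : ℂ => (Pi.single i ζ : Fin n → ℂ)) (𝓝 0) (𝓝 0) := by
    have := (ContinuousLinearMap.single ℂ (fun _ : Fin n => ℂ) i).continuous.tendsto 0
    simpa using this
  have hlim' : Tendsto (fun ζ : ℂ => φ (Pi.single i ζ)) (𝓝 0) (𝓝 0) := by
    have := h1.continuousAt.tendsto.comp hlim
    rwa [h2] at this
  have h7 : φ' =O[𝓝 0] fun x => x := by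
    simpa [h4] using h3.differentiableAt.isBigO_sub
  have h8 : (fun ζ : ℂ => (Pi.single i ζ : Fin n → ℂ)) =O[𝓝 0] fun ζ => φ (Pi.single i ζ) :=
    (h7.comp_tendsto hlim').congr_left fun ζ => h5 _
  have h9 : (fun ζ : ℂ => ζ) =O[𝓝 0] fun ζ : ℂ => (Pi.single i ζ : Fin n → ℂ) :=
    IsBigO.of_bound 1 (Eventually.of_forall fun ζ => by simp [Pi.norm_single])
  have h10 : (fun ζ : ℂ => φ (Pi.single i ζ)) =O[𝓝 0] fun ζ : ℂ => ‖ζ‖ ^ k :=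
    isBigO_fst_prod.trans hk
  have h11 := ((h9.trans h8).trans h10).trans_isLittleO (isLittleO_norm_pow_id hk1)
  refine isLittleO_irrefl ?_ h11
  have h12 : ∀ᶠ ζ : ℂ in 𝓝[≠] 0, ζ ∈ ({0}ᶜ : Set ℂ) := eventually_mem_nhdsWithin
  exact h12.frequently.filter_mono nhdsWithin_le_nhds

/-- The test curve is `ζ ↦ (φ(ζ e_i), 0)`, of order at most one. If no pure power `z_i^l` with `l <
K` occurred in any `f_j ∘ φ`, its contact with the hypersurface would be at least `K`, more than the
type. The bound does not depend on `φ`. -/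
theorem exists_type_bound {f : Fin N → (Fin n → ℂ) → ℂ} (hf : ∀ j, AnalyticAt ℂ (f j) 0)
    (htype : dAngeloOneType (definingFunction f) < ⊤) :
    ∃ K : ℕ, ∀ φ, IsAut φ → ∀ i : Fin n, ∃ j, ∃ l < K,
      coeffAt (f j ∘ φ) (Finsupp.single i l) ≠ 0 := by
  obtain ⟨K, hK⟩ := ENNReal.exists_nat_gt htype.ne
  refine ⟨K, fun φ hφ i => ?_⟩
  by_contra hcon
  push Not at hcon
  refine absurd hK (not_lt.2 ?_)
  have hlin : AnalyticAt ℂ (fun ζ : ℂ => (Pi.single i ζ : Fin n → ℂ)) 0 :=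
    (ContinuousLinearMap.single ℂ (fun _ : Fin n => ℂ) i).analyticAt 0
  have hγ : AnalyticAt ℂ (fun ζ : ℂ => ((φ (Pi.single i ζ), 0) : (Fin n → ℂ) × ℂ)) 0 := by
    refine AnalyticAt.prod (AnalyticAt.fun_comp (g := φ) ?_ hlin) analyticAt_const
    simpa using hφ.analyticAt
  have hvan := vanishingOrder_axis_le hφ i
  set γ : ℂ → (Fin n → ℂ) × ℂ := fun ζ => (φ (Pi.single i ζ), 0) with hγdef
  have hγ0 : γ 0 = 0 := by simp [hγdef, hφ.map_zero]
  have hne : ¬ ∀ᶠ ζ in 𝓝 0, γ ζ = 0 := by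
    intro hev
    obtain ⟨φ', -, h4, h5, -⟩ := hφ.exists_inv
    have h6 : ∀ᶠ ζ : ℂ in 𝓝[≠] 0, False := by
      filter_upwards [hev.filter_mono nhdsWithin_le_nhds, eventually_mem_nhdsWithin] with ζ h7 h8
      have h9 : φ (Pi.single i ζ) = 0 := congrArg Prod.fst h7
      have h10 := h5 (Pi.single i ζ)
      rw [h9, h4] at h10
      have := congrFun h10 i
      simp only [Pi.zero_apply, Pi.single_eq_same] at this
      exact h8 this.symm
    exact h6.exists.elim fun _ h => h
  have hr : (definingFunction f ∘ γ) =O[𝓝 0] fun ζ : ℂ => ‖ζ‖ ^ K := by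
    have : (definingFunction f ∘ γ) = fun ζ => ∑ j, ‖f j (φ (Pi.single i ζ))‖ ^ 2 := by
      funext ζ; simp [definingFunction, sumSq, hγdef]
    rw [this]
    refine IsBigO.fun_sum fun j _ => ?_
    have h1 := isBigO_along_axis (analyticAt_comp_aut hf hφ j) i (hcon j)
    have h2 := (h1.norm_left.pow 2).congr_right fun ζ => (pow_mul ‖ζ‖ K 2).symm
    exact h2.trans (isBigO_pow_of_le (by omega))
  calc (K : ℝ≥0∞) ≤ (vanishingOrder (definingFunction f ∘ γ) : ℝ≥0∞) := by
        have : (K : ℕ∞) ≤ vanishingOrder (definingFunction f ∘ γ) := le_iSup₂_of_le K hr le_rfl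
        exact_mod_cast ENat.toENNReal_le.2 this
    _ ≤ (vanishingOrder (definingFunction f ∘ γ) : ℝ≥0∞) / (vanishingOrder γ : ℝ≥0∞) := by
        have h1 : (vanishingOrder γ : ℝ≥0∞) ≤ 1 := by
          have := ENat.toENNReal_le.2 hvan; simpa using this
        calc _ = (vanishingOrder (definingFunction f ∘ γ) : ℝ≥0∞) / 1 := by simp
          _ ≤ _ := ENNReal.div_le_div_left h1 _
    _ ≤ dAngeloOneType (definingFunction f) :=
        le_iSup₂ (f := fun (γ : ℂ → (Fin n → ℂ) × ℂ)
          (_ : AnalyticAt ℂ γ 0 ∧ γ 0 = 0 ∧ ¬ ∀ᶠ ζ in 𝓝 0, γ ζ = 0) =>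
          (vanishingOrder (definingFunction f ∘ γ) : ℝ≥0∞) / (vanishingOrder γ : ℝ≥0∞))
          γ ⟨hγ, hγ0, hne⟩

/-! ### The first weight -/

theorem apply_zero_of_definingFunction {f : Fin N → (Fin n → ℂ) → ℂ}
    (h0 : definingFunction f 0 = 0) (j : Fin N) : f j 0 = 0 := by
  have h1 : ∑ j, ‖f j 0‖ ^ 2 = 0 := by simpa [definingFunction, sumSq] using h0
  have := (Finset.sum_eq_zero_iff_of_nonneg fun j _ => by positivity).1 h1 j (Finset.mem_univ j)
  simpa using this

theorem degree_eq_add (e : MixedExp n) : e.degree = (holPart e).degree + (antiPart e).degree := by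
  simp [Finsupp.degree_eq_sum]

theorem weight_const (c : ℚ) (α : Fin n →₀ ℕ) :
    Finsupp.weight (fun _ : Fin n => c) α = α.degree * c := by
  rw [weight_eq_sum', Finsupp.degree_eq_sum, ← Finset.sum_mul]
  push_cast; rfl

theorem one_le_degree_of_coeffAt {g : (Fin n → ℂ) → ℂ} (hg : AnalyticAt ℂ g 0) (h0 : g 0 = 0)
    {α : Fin n →₀ ℕ} (hα : coeffAt g α ≠ 0) : 1 ≤ α.degree := by
  rw [Nat.one_le_iff_ne_zero]
  intro h
  rw [Finsupp.degree_eq_zero_iff] at h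
  rw [h, coeffAt_zero hg, h0] at hα
  exact hα rfl

/-- With no settled variable rigidity is vacuous, and for equal weights any map fixing the origin
does not decrease weights, so `a` is its own factor. Since the `f_j` vanish at `0`, both parts of a
term are nonconstant; thus `m ≥ 2` and the entries are at most `1/2`. -/
theorem kolarInv_first (hn : 0 < n) {f : Fin N → (Fin n → ℂ) → ℂ}
    (hf : ∀ j, AnalyticAt ℂ (f j) 0) (hf0 : ∀ j, f j 0 = 0) {m : ℕ}
    (hm : IsLeast {k | ∃ e : MixedExp n, taylorCoeff (sumSq f) e ≠ 0 ∧ e.degree = k} m) :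
    KolarInv f 0 (1 / m) (fun _ => 1 / m) id := by
  have hm2 : 2 ≤ m := by
    obtain ⟨e, he, rfl⟩ := hm.1
    rw [taylorCoeff_sumSq hf] at he
    obtain ⟨j, -, hj⟩ := Finset.exists_ne_zero_of_sum_ne_zero he
    have h1 := one_le_degree_of_coeffAt (hf j) (hf0 j) (left_ne_zero_of_mul hj)
    have h2 := one_le_degree_of_coeffAt (hf j) (hf0 j)
      ((map_ne_zero (starRingEnd ℂ)).1 (right_ne_zero_of_mul hj))
    rw [degree_eq_add]
    omega
  have hm2' : (2 : ℚ) ≤ m := by exact_mod_cast hm2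
  have hmpos : (0 : ℚ) < m := by linarith
  have hinv : (0 : ℚ) < 1 / m := by positivity
  refine ⟨hn, hinv, ⟨fun _ _ => rfl, fun i hi => absurd hi (Nat.not_lt_zero _)⟩,
    ⟨fun _ => hinv.le, fun _ => one_div_le_one_div_of_le two_pos hm2', fun _ _ _ => le_rfl,
      fun t => Or.inr ⟨fun j => if j = t then m else 0, by simp; omega, ?_⟩⟩,
    isAut_id, fun j α hα => ?_, fun Y hY _ _ i => hY i (Nat.zero_le _), fun μ a ha => ?_⟩
  · rw [Finset.sum_eq_single t]
    · simp [hmpos.ne']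
    · intro j _ hj; simp [hj]
    · simp
  · have h1 := hm.2 ⟨_, taylorCoeff_sumSq_diag_ne_zero hf hα, rfl⟩
    rw [degree_eq_add, holPart_mkExp, antiPart_mkExp] at h1
    have h2 : (m : ℚ) ≤ α.degree + α.degree := by exact_mod_cast h1
    rw [weight_const, mul_one_div, div_le_div_iff₀ two_pos hmpos]
    linarith
  · rcases lt_or_ge (1 / (m : ℚ)) (μ ⟨0, hn⟩) with h1 | h1
    · exact Or.inl ⟨⟨0, hn⟩, fun i hi => absurd hi (Nat.not_lt_zero _), h1⟩
    · refine Or.inr ⟨fun i hi => absurd hi (Nat.not_lt_zero _), fun i _ =>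
        (ha.antitone (Fin.le_def.2 (Nat.zero_le _))).trans h1, a, ha.analyticAt, ha.map_zero,
        ha.bijective, rfl, fun i α hα => ?_⟩
      have h2 := one_le_degree_of_coeffAt (analyticAt_apply ha.analyticAt i)
        (by rw [ha.map_zero]; rfl) hα
      have h3 : (1 : ℚ) ≤ α.degree := by exact_mod_cast h2
      rw [weight_const]
      exact le_mul_of_one_le_left hinv.le h3

theorem exists_kolarStep_one {f : Fin N → (Fin n → ℂ) → ℂ} (hf : ∀ j, AnalyticAt ℂ (f j) 0)
    {j : Fin N} {α : Fin n →₀ ℕ} (h : coeffAt (f j) α ≠ 0) :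
    ∃ L, KolarStep (sumSq f) 1 L id := by
  classical
  have hne : {k | ∃ e : MixedExp n, taylorCoeff (sumSq f) e ≠ 0 ∧ e.degree = k}.Nonempty :=
    ⟨_, mkExp α α, taylorCoeff_sumSq_diag_ne_zero hf h, rfl⟩
  exact ⟨_, KolarStep.first _ ⟨Nat.sInf_mem hne, fun k hk => Nat.sInf_le hk⟩⟩

/-! ### The invariant along the algorithm -/

section Steps

variable {f : Fin N → (Fin n → ℂ) → ℂ} {k : ℕ} {τ : ℚ} {L L' : Fin n → ℚ}
  {φ : (Fin n → ℂ) → Fin n → ℂ}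

theorem KolarInv.reduces (hf : ∀ j, AnalyticAt ℂ (f j) 0) (h : KolarInv f k τ L φ)
    {ψ : Fin n → MvPolynomial (Fin n) ℂ} (hψ : IsReduction (sumSq f ∘ φ) L ψ) :
    Reduces L (leads L fun j => f j ∘ φ) ψ :=
  (isReduction_iff (g := fun j => f j ∘ φ) h.pos' (analyticAt_comp_aut hf h.aut) h.ord ψ).1 hψ

theorem leadingPoly_of_ord (hf : ∀ j, AnalyticAt ℂ (f j) 0) (hL : ∀ i, 0 < L i) (hφ : IsAut φ)
    (hord : ∀ j, OrdGE L (1 / 2) (f j ∘ φ)) :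
    leadingPoly (sumSq f ∘ φ) L = sqPoly (leads L fun j => f j ∘ φ) :=
  leadingPoly_sumSq (g := fun j => f j ∘ φ) hL (analyticAt_comp_aut hf hφ) hord

theorem KolarInv.reducedInv (hf : ∀ j, AnalyticAt ℂ (f j) 0) (h : KolarInv f k τ L φ)
    {ψ : Fin n → MvPolynomial (Fin n) ℂ} (hψ : IsReduction (sumSq f ∘ φ) L ψ) :
    ReducedInv f k (n - (leadingPoly (sumSq f ∘ φ ∘ polyMap ψ) L).numFree) τ L (φ ∘ polyMap ψ) := by
  have h1 := h.reduced hf (h.reduces hf hψ)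
  rwa [leadingPoly_of_ord hf h.pos' h1.aut h1.ord, numFree_sqPoly]

theorem exists_kolarInv (hn : 0 < n) (hf : ∀ j, AnalyticAt ℂ (f j) 0) (hf0 : ∀ j, f j 0 = 0)
    {t : ℕ} (h : KolarStep (sumSq f) t L φ) : ∃ k τ, KolarInv f k τ L φ := by
  induction h with
  | first m hm => exact ⟨0, _, kolarInv_first hn hf hf0 hm⟩
  | next t L L' φ ψ _ hψ hd hL' ih =>
    obtain ⟨k, τ, h⟩ := ih
    obtain ⟨τ', -, h'⟩ := (h.reducedInv hf hψ).next hf h (by omega) hL'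
    exact ⟨_, τ', h'⟩

theorem KolarInv.le_tail {K : ℕ} (hK : ∀ φ, IsAut φ → ∀ i : Fin n, ∃ j, ∃ l < K,
    coeffAt (f j ∘ φ) (Finsupp.single i l) ≠ 0) (h : KolarInv f k τ L φ) (i : Fin n) :
    1 / (2 * K : ℚ) ≤ L i := by
  obtain ⟨j, l, hl, hne⟩ := hK φ h.aut i
  have h1 := h.ord j _ hne
  rw [Finsupp.weight_single, nsmul_eq_mul] at h1
  have h2 : (l : ℚ) ≤ K := by exact_mod_cast hl.le
  have h3 : (0 : ℚ) < K := by exact_mod_cast (Nat.zero_le _).trans_lt hl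
  rw [div_le_iff₀ (by positivity)]
  have := mul_le_mul_of_nonneg_right h2 (h.pos' i).le
  linarith

end Steps

/-- Entries at least `ε` bound the coefficients `a_j` by `1/ε`. This leaves finitely many triangular
systems `∑_{j ≤ t} a_j λ_j = 1`, each with at most one solution because `a_t > 0`. -/
theorem finite_isWeight {ε : ℚ} (hε : 0 < ε) :
    {L : Fin n → ℚ | IsWeight L ∧ ∀ i, ε ≤ L i}.Finite := by
  set B := ⌊1 / ε⌋₊
  have hM : {A : Fin n → Fin n → ℕ | ∀ t j, A t j ≤ B}.Finite := by
    have := Set.Finite.pi' (t := fun _ : Fin n => {a : Fin n → ℕ | ∀ j, a j ≤ B}) fun _ =>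
      Set.Finite.pi' (t := fun _ : Fin n => Set.Iic B) fun _ => Set.finite_Iic _
    exact this
  refine (hM.biUnion (t := fun A => {L : Fin n → ℚ | ∀ t, 0 < A t t ∧
    ∑ j ∈ Finset.Iic t, (A t j : ℚ) * L j = 1}) fun A _ => Set.Subsingleton.finite ?_).subset ?_
  · intro L hL L' hL'
    funext t
    induction t using WellFoundedLT.induction with
    | ind t ih =>
      have h1 := (hL t).2
      have h2 := (hL' t).2
      rw [← Finset.Iio_insert, Finset.sum_insert (by simp)] at h1 h2
      rw [Finset.sum_congr rfl fun j hj => by rw [ih j (Finset.mem_Iio.1 hj)]] at h1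
      have h3 : (0 : ℚ) < A t t := by exact_mod_cast (hL t).1
      exact mul_left_cancel₀ h3.ne' (by linarith)
  · rintro L ⟨hL, hLε⟩
    have : ∀ t, ∃ a : Fin n → ℕ, (∀ j, a j ≤ B) ∧ 0 < a t ∧
        ∑ j ∈ Finset.Iic t, (a j : ℚ) * L j = 1 := by
      intro t
      rcases hL.eq_one t with h | ⟨a, ha, hsum⟩
      · exact absurd h (hε.trans_le (hLε t)).ne'
      · refine ⟨fun j => if j ≤ t then a j else 0, fun j => ?_, by simpa using ha, ?_⟩
        · dsimp only
          split_ifs with hj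
          · refine Nat.le_floor ?_
            rw [le_div_iff₀ hε, ← hsum]
            refine le_trans (mul_le_mul_of_nonneg_left (hLε j) (Nat.cast_nonneg _)) ?_
            exact Finset.single_le_sum (f := fun j => (a j : ℚ) * L j)
              (fun i _ => mul_nonneg (Nat.cast_nonneg _) (hL.nonneg i)) (Finset.mem_Iic.2 hj)
          · exact Nat.zero_le _
        · rw [← hsum]
          exact Finset.sum_congr rfl fun j hj => by simp only [if_pos (Finset.mem_Iic.1 hj)]
    choose A h1 h2 h3 using this
    exact Set.mem_biUnion (x := A) h1 fun t => ⟨h2 t, h3 t⟩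

/-- The last entry of the weight strictly decreases at each step and all weights lie in a fixed
finite set `S`. So the step number is at most the number of elements of `S` whose last entry is at
least the current one. -/
theorem exists_steps_le (hn : 0 < n) {f : Fin N → (Fin n → ℂ) → ℂ}
    (hf : ∀ j, AnalyticAt ℂ (f j) 0) (hf0 : ∀ j, f j 0 = 0) {K : ℕ}
    (hK : ∀ φ, IsAut φ → ∀ i : Fin n, ∃ j, ∃ l < K,
      coeffAt (f j ∘ φ) (Finsupp.single i l) ≠ 0) :
    ∃ T, ∀ t L φ, KolarStep (sumSq f) t L φ → t ≤ T := by
  have hKpos : (0 : ℚ) < K := by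
    obtain ⟨j, l, hl, -⟩ := hK id isAut_id ⟨0, hn⟩
    exact_mod_cast (Nat.zero_le _).trans_lt hl
  have hS := finite_isWeight (n := n) (ε := 1 / (2 * K)) (by positivity)
  set S := {L : Fin n → ℚ | IsWeight L ∧ ∀ i, 1 / (2 * K : ℚ) ≤ L i} with hSdef
  have hmem : ∀ {t L φ}, KolarStep (sumSq f) t L φ → L ∈ S := fun h => by
    obtain ⟨k, τ, h'⟩ := exists_kolarInv hn hf hf0 h
    exact ⟨h'.weight, h'.le_tail hK⟩
  set e : Fin n := ⟨n - 1, by omega⟩ with he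
  suffices H : ∀ t L φ, KolarStep (sumSq f) t L φ → t ≤ {M ∈ S | L e ≤ M e}.ncard from
    ⟨S.ncard, fun t L φ h => (H t L φ h).trans (Set.ncard_le_ncard (Set.sep_subset _ _) hS)⟩
  intro t L φ h
  induction h with
  | first m hm =>
    refine (Set.ncard_pos (hS.subset (Set.sep_subset _ _))).2 ?_
    exact ⟨_, hmem (KolarStep.first m hm), le_rfl⟩
  | next t L L' φ ψ hst hψ hd hL' ih =>
    have hst' := KolarStep.next t L L' φ ψ hst hψ hd hL'
    obtain ⟨k, τ, h⟩ := exists_kolarInv hn hf hf0 hst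
    have hr := h.reducedInv hf hψ
    obtain ⟨τ', hττ, h'⟩ := hr.next hf h (by omega) hL'
    have h1 : L' e = τ' := h'.tail.1 e (by simp only [he]; have := h'.lt; omega)
    have h2 : L e = τ := h.tail.1 e (by simp only [he]; have := h.lt; omega)
    refine Nat.succ_le_of_lt (ih.trans_lt (Set.ncard_lt_ncard ?_ (hS.subset (Set.sep_subset _ _))))
    refine ⟨fun M hM => ⟨hM.1, le_trans (by rw [h1, h2]; exact hττ.le) hM.2⟩, fun hsub => ?_⟩
    have h3 := (hsub ⟨hmem hst', le_rfl⟩).2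
    rw [h1, h2] at h3
    exact absurd h3 (not_le.2 hττ)

end

section

variable {n N : ℕ}

/-! ### The final weight is distinguished -/

theorem contDiffAt_fderiv_apply {E F : Type*} [NormedAddCommGroup E] [NormedSpace ℝ E]
    [NormedAddCommGroup F] [NormedSpace ℝ F] {R : E → F} {x : E} (hR : ContDiffAt ℝ ∞ R x) (v : E) :
    ContDiffAt ℝ ∞ (fun y => fderiv ℝ R y v) x :=
  (hR.fderiv_right (m := ∞) le_rfl).clm_apply contDiffAt_const

theorem iteratedFDeriv_succ_apply_eq {E F : Type*} [NormedAddCommGroup E] [NormedSpace ℝ E]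
    [NormedAddCommGroup F] [NormedSpace ℝ F] {R : E → F} {x : E} (hR : ContDiffAt ℝ ∞ R x) {k : ℕ}
    (m : Fin (k + 1) → E) :
    iteratedFDeriv ℝ (k + 1) R x m =
      iteratedFDeriv ℝ k (fun y => fderiv ℝ R y (m (Fin.last k))) x fun l => m l.castSucc := by
  rw [iteratedFDeriv_succ_apply_right]
  have h := (ContinuousLinearMap.apply ℝ F (m (Fin.last k))).iteratedFDeriv_comp_left
    (hR.fderiv_right (m := ∞) le_rfl) (i := k) (by exact_mod_cast le_top)
  have h2 := DFunLike.congr_fun h fun l => m l.castSucc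
  exact h2.symm

/-- Near the origin, `R(z, u) = Re ∑ g_l(z) conj(h_l(z))`, all the terms having weight larger
than `s`. -/
def IsHermitianSum (L : Fin n → ℚ) (s : ℚ) (R : (Fin n → ℂ) × ℝ → ℝ) : Prop :=
  ∃ (ι : Type) (_ : Fintype ι) (g h : ι → (Fin n → ℂ) → ℂ),
    (∀ l, AnalyticAt ℂ (g l) 0) ∧ (∀ l, AnalyticAt ℂ (h l) 0) ∧
    (∀ l α β, coeffAt (g l) α ≠ 0 → coeffAt (h l) β ≠ 0 →
      s < Finsupp.weight L α + Finsupp.weight L β) ∧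
    R =ᶠ[𝓝 0] fun p => (∑ l, g l p.1 * starRingEnd ℂ (h l p.1)).re

theorem contDiffAt_comp_fst {g : (Fin n → ℂ) → ℂ} (hg : AnalyticAt ℂ g 0) :
    ContDiffAt ℝ ∞ (fun p : (Fin n → ℂ) × ℝ => g p.1) 0 := by
  have : ContDiffAt ℝ ∞ g (Prod.fst (0 : (Fin n → ℂ) × ℝ)) := hg.contDiffAt.restrict_scalars ℝ
  exact this.comp (0 : (Fin n → ℂ) × ℝ) contDiffAt_fst

theorem IsHermitianSum.contDiffAt {L : Fin n → ℚ} {s : ℚ} {R : (Fin n → ℂ) × ℝ → ℝ}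
    (hR : IsHermitianSum L s R) : ContDiffAt ℝ ∞ R 0 := by
  obtain ⟨ι, _, g, h, hg, hh, -, hRe⟩ := hR
  refine ContDiffAt.congr_of_eventuallyEq ?_ hRe
  refine Complex.reCLM.contDiff.contDiffAt.comp (0 : (Fin n → ℂ) × ℝ) (ContDiffAt.sum fun l _ => ?_)
  exact (contDiffAt_comp_fst (hg l)).mul
    (Complex.conjCLE.contDiff.contDiffAt.comp (0 : (Fin n → ℂ) × ℝ) (contDiffAt_comp_fst (hh l)))

theorem IsHermitianSum.apply_zero {L : Fin n → ℚ} {s : ℚ} {R : (Fin n → ℂ) × ℝ → ℝ}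
    (hs : 0 ≤ s) (hR : IsHermitianSum L s R) : R 0 = 0 := by
  obtain ⟨ι, _, g, h, hg, hh, hw, hRe⟩ := hR
  rw [hRe.eq_of_nhds, Finset.sum_eq_zero, Complex.zero_re]
  intro l _
  by_contra hne
  have h1 := left_ne_zero_of_mul hne
  have h2 := (map_ne_zero (starRingEnd ℂ)).1 (right_ne_zero_of_mul hne)
  have := hw l 0 0 (by rw [coeffAt_zero (hg l)]; exact h1) (by rw [coeffAt_zero (hh l)]; exact h2)
  simp only [map_zero, add_zero] at this
  exact absurd hs (not_le.2 this)

/-- The class is stable under the derivatives in the definition of `o_Λ(1)`: a derivative along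
`z_i` lowers weights by `λ_i`, and the one along `u` vanishes as `R` does not involve `u`. Vanishing
of higher derivatives then reduces to the value at the origin. -/
theorem IsHermitianSum.fderiv {L : Fin n → ℚ} {s : ℚ} {R : (Fin n → ℂ) × ℝ → ℝ}
    (hR : IsHermitianSum L s R) (a : Option (Fin n)) (c : ℂ) :
    IsHermitianSum L (s - a.elim 1 L) fun y => fderiv ℝ R y (coordDir a c) := by
  obtain ⟨ι, _, g, h, hg, hh, hw, hRe⟩ := hR
  have hnear : Tendsto (Prod.fst : (Fin n → ℂ) × ℝ → Fin n → ℂ) (𝓝 0) (𝓝 0) :=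
    continuous_fst.tendsto 0
  have hder : ∀ᶠ y : (Fin n → ℂ) × ℝ in 𝓝 0, ∃ D : (Fin n → ℂ) →L[ℝ] ℂ,
      (∀ i c, D (Pi.single i c) = ∑ l, (c * pd i (g l) y.1 * starRingEnd ℂ (h l y.1) +
        g l y.1 * starRingEnd ℂ (c * pd i (h l) y.1))) ∧
      ∀ v, _root_.fderiv ℝ R y v = (D v.1).re := by
    filter_upwards [hRe.fderiv (𝕜 := ℝ),
      hnear.eventually (eventually_all.2 fun l => (hg l).eventually_analyticAt),
      hnear.eventually (eventually_all.2 fun l => (hh l).eventually_analyticAt)] with y h1 h2 h3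
    obtain ⟨D, hD, hD'⟩ := hasFDerivAt_sum_mul_conj h2 h3
    refine ⟨D, hD', fun v => ?_⟩
    have h4 := (Complex.reCLM.hasFDerivAt.comp y.1 hD).comp y (hasFDerivAt_fst (𝕜 := ℝ))
    rw [h1]
    exact DFunLike.congr_fun h4.fderiv v
  cases a with
  | none =>
    refine ⟨Empty, inferInstance, fun l => l.elim, fun l => l.elim, fun l => l.elim,
      fun l => l.elim, fun l => l.elim, ?_⟩
    filter_upwards [hder] with y ⟨D, _, hD⟩
    rw [hD]
    simp [coordDir]
  | some i =>
    refine ⟨ι ⊕ ι, inferInstance, Sum.elim (fun l z => c * pd i (g l) z) g,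
      Sum.elim h (fun l z => c * pd i (h l) z), ?_, ?_, ?_, ?_⟩
    · rintro (l | l)
      · exact analyticAt_const.mul (analyticAt_pd (hg l) i)
      · exact hg l
    · rintro (l | l)
      · exact hh l
      · exact analyticAt_const.mul (analyticAt_pd (hh l) i)
    · have key : ∀ {u : (Fin n → ℂ) → ℂ} {α : Fin n →₀ ℕ}, AnalyticAt ℂ u 0 →
          coeffAt (fun z => c * pd i u z) α ≠ 0 → coeffAt u (α + Finsupp.single i 1) ≠ 0 := by
        intro u α hu hne
        rw [coeffAt_const_mul (analyticAt_pd hu i), coeffAt_pd hu] at hne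
        exact left_ne_zero_of_mul (right_ne_zero_of_mul hne)
      rintro (l | l) α β h1 h2
      · have := hw l _ _ (key (hg l) h1) h2
        simp only [map_add, Finsupp.weight_single, one_smul] at this
        simp only [Option.elim_some]
        linarith
      · have := hw l _ _ h1 (key (hh l) h2)
        simp only [map_add, Finsupp.weight_single, one_smul] at this
        simp only [Option.elim_some]
        linarith
    · filter_upwards [hder] with y ⟨D, hD', hD⟩
      rw [hD]
      simp only [coordDir, Option.elim_some, hD', Finset.sum_add_distrib, Fintype.sum_sum_type,
        Sum.elim_inl, Sum.elim_inr]

theorem IsHermitianSum.iteratedFDeriv_eq_zero {L : Fin n → ℚ} (k : ℕ) {s : ℚ}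
    {R : (Fin n → ℂ) × ℝ → ℝ} (hR : IsHermitianSum L s R) (a : Fin k → Option (Fin n))
    (c : Fin k → ℂ) (h : ∑ l, (a l).elim 1 L ≤ s) :
    iteratedFDeriv ℝ k R 0 (fun l => coordDir (a l) (c l)) = 0 := by
  induction k generalizing s R with
  | zero =>
    rw [iteratedFDeriv_zero_apply]
    exact hR.apply_zero (by simpa using h)
  | succ k ih =>
    rw [iteratedFDeriv_succ_apply_eq hR.contDiffAt]
    rw [Fin.sum_univ_castSucc] at h
    exact ih (hR.fderiv (a (Fin.last k)) (c (Fin.last k))) (fun l => a l.castSucc)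
      (fun l => c l.castSucc) (by linarith)

theorem IsHermitianSum.isLittleOWeighted {L : Fin n → ℚ} {R : (Fin n → ℂ) × ℝ → ℝ}
    (hR : IsHermitianSum L 1 R) : IsLittleOWeighted L R :=
  ⟨hR.contDiffAt, fun k a c h => hR.iteratedFDeriv_eq_zero k a c h⟩

theorem value_sqPoly (F : Fin N → MvPolynomial (Fin n) ℂ) (z : Fin n → ℂ) :
    (sqPoly F).value z = ∑ j, eval z (F j) * starRingEnd ℂ (eval z (F j)) := by
  rw [MixedPoly.value, sqPoly, map_sum]
  refine Finset.sum_congr rfl fun j _ => ?_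
  rw [map_mul, eval_rename, eval_rename]
  congr 1
  rw [show (Sum.elim z fun i => starRingEnd ℂ (z i)) ∘ Sum.inr = starRingEnd ℂ ∘ z from rfl,
    MvPolynomial.eval_map]
  have h := eval₂_comp_left (starRingEnd ℂ) (RingHom.id ℂ) z (F j)
  rw [RingHom.comp_id] at h
  exact h.symm

/-- The coordinates are given by `φ` in the tangential variables and `z_{n+1} = i w / 2`, for which
`2 Re z_{n+1} = -v`; the equation becomes `v = ∑ |f_j ∘ φ|²`. Each term of `∑ |F_j|²` pairs two
monomials of weight `1/2`, so none is pluriharmonic. -/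
theorem isDistinguished_of_ord {f : Fin N → (Fin n → ℂ) → ℂ} (hf : ∀ j, AnalyticAt ℂ (f j) 0)
    {L : Fin n → ℚ} (hL : ∀ i, 0 < L i) (hLw : IsWeight L) {φ : (Fin n → ℂ) → Fin n → ℂ}
    (hφ : IsAut φ) (hord : ∀ j, OrdGE L (1 / 2) (f j ∘ φ)) :
    IsDistinguished (definingFunction f) L := by
  have hg := analyticAt_comp_aut hf hφ
  set F := leads L fun j => f j ∘ φ with hF
  have hcoeff : ∀ j α, coeff α (F j) ≠ 0 → Finsupp.weight L α = 1 / 2 := by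
    intro j α hα
    simp only [hF, leads, coeff_lead hL] at hα
    by_contra hne
    exact hα (if_neg hne)
  have hsupp : ∀ e ∈ (sqPoly F).support, Finsupp.weight L (holPart e) = 1 / 2 ∧
      Finsupp.weight L (antiPart e) = 1 / 2 := by
    intro e he
    rw [mem_support_iff, coeff_sqPoly] at he
    obtain ⟨j, -, hj⟩ := Finset.exists_ne_zero_of_sum_ne_zero he
    exact ⟨hcoeff j _ (left_ne_zero_of_mul hj),
      hcoeff j _ ((map_ne_zero (starRingEnd ℂ)).1 (right_ne_zero_of_mul hj))⟩
  have hpart : ∀ α : Fin n →₀ ℕ, Finsupp.weight L α = 1 / 2 → ∃ i, α i ≠ 0 := by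
    intro α hα
    by_contra hcon
    push Not at hcon
    rw [show α = 0 from Finsupp.ext hcon, map_zero] at hα
    norm_num at hα
  set c : ℂ := Complex.I / 2 with hc
  have hc0 : c ≠ 0 := by simp [hc]
  have hΦ1 : HasFDerivAt (fun p : (Fin n → ℂ) × ℂ => (φ p.1, c * p.2))
      (((fderiv ℂ φ 0).comp (ContinuousLinearMap.fst ℂ _ _)).prod
        (c • ContinuousLinearMap.snd ℂ (Fin n → ℂ) ℂ)) 0 := by
    have h1 : HasFDerivAt φ (fderiv ℂ φ 0) (Prod.fst (0 : (Fin n → ℂ) × ℂ)) :=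
      hφ.analyticAt.differentiableAt.hasFDerivAt
    exact (h1.comp (0 : (Fin n → ℂ) × ℂ) (hasFDerivAt_fst (𝕜 := ℂ))).prodMk
      ((hasFDerivAt_snd (𝕜 := ℂ)).const_mul c)
  refine ⟨hLw, fun p => (φ p.1, c * p.2), sqPoly F,
    fun p => sumSq f (φ p.1) - ((sqPoly F).value p.1).re, ?_, ?_, ?_, ?_, ?_, ?_, ?_, ?_⟩
  · refine AnalyticAt.prod (AnalyticAt.fun_comp (g := φ) hφ.analyticAt analyticAt_fst)
      (analyticAt_const.mul analyticAt_snd)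
  · simp [hφ.map_zero]
  · rw [hΦ1.fderiv]
    have hb := hφ.bijective_fderiv
    refine ⟨fun v w hvw => ?_, fun w => ?_⟩
    · have h1 : fderiv ℂ φ 0 v.1 = fderiv ℂ φ 0 w.1 := congrArg Prod.fst hvw
      have h2 : c * v.2 = c * w.2 := congrArg Prod.snd hvw
      exact Prod.ext (hb.1 h1) (mul_left_cancel₀ hc0 h2)
    · obtain ⟨v, hv⟩ := hb.2 w.1
      refine ⟨(v, w.2 / c), Prod.ext hv ?_⟩
      change c * (w.2 / c) = w.2
      field_simp
  · intro e he
    obtain ⟨h1, h2⟩ := hsupp e he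
    rw [mixedWeight_eq, h1, h2]; norm_num
  · intro e he
    obtain ⟨h1, h2⟩ := hsupp e he
    exact ⟨hpart _ h1, hpart _ h2⟩
  · intro z
    rw [value_sqPoly, Complex.im_sum]
    refine Finset.sum_eq_zero fun j _ => ?_
    rw [Complex.mul_conj, Complex.ofReal_im]
  -- The identity used is `|g|² - |F|² = (g - F) ḡ + F conj(g - F)`: one factor has weights larger
  -- than `1/2`, the other at least `1/2`.
  · refine IsHermitianSum.isLittleOWeighted ⟨Fin N ⊕ Fin N, inferInstance,
      Sum.elim (fun j z => (f j ∘ φ) z - eval z (F j)) (fun j z => eval z (F j)),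
      Sum.elim (fun j => f j ∘ φ) (fun j z => (f j ∘ φ) z - eval z (F j)), ?_, ?_, ?_, ?_⟩
    · rintro (j | j)
      · exact (hg j).sub (analyticAt_eval _ _)
      · exact analyticAt_eval _ _
    · rintro (j | j)
      · exact hg j
      · exact (hg j).sub (analyticAt_eval _ _)
    · have key : ∀ j α, coeffAt (fun z => (f j ∘ φ) z - eval z (F j)) α ≠ 0 →
          1 / 2 < Finsupp.weight L α := by
        intro j α hα
        rw [coeffAt_sub (hg j) (analyticAt_eval _ _), coeffAt_eval] at hα
        simp only [hF, leads, coeff_lead hL] at hα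
        split_ifs at hα with hw
        · exact absurd (sub_self _) hα
        · rw [sub_zero] at hα
          exact lt_of_le_of_ne (hord j α hα) (Ne.symm hw)
      rintro (j | j) α β h1 h2
      · have := key j α h1
        have := hord j β h2
        linarith
      · have h3 := key j β h2
        have h4 := hcoeff j α (by simpa [coeffAt_eval] using h1)
        linarith
    · refine Eventually.of_forall fun p => ?_
      simp only [value_sqPoly, sumSq, Fintype.sum_sum_type, Sum.elim_inl, Sum.elim_inr,
        ← Finset.sum_add_distrib, Complex.re_sum, ← Finset.sum_sub_distrib]
      refine Finset.sum_congr rfl fun j _ => ?_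
      rw [← Complex.ofReal_re (‖f j (φ p.1)‖ ^ 2), ← Complex.sub_re]
      congr 1
      rw [Complex.ofReal_pow, ← Complex.mul_conj', Function.comp_apply, map_sub]
      ring
  · refine Eventually.of_forall fun p => ?_
    have h1 : (c * p.2).re = -p.2.im / 2 := by simp [hc, Complex.mul_re]; ring
    simp only [definingFunction, h1]
    constructor <;> intro h <;> linarith

end

section

variable {n N : ℕ}

/-! ### Distinguished weights are admissible -/

theorem eventually_scale_mem {L : Fin n → ℚ} (hL : ∀ i, 0 < L i) (B : ℝ)
    {p : (Fin n → ℂ) × ℝ → Prop} (hp : ∀ᶠ y in 𝓝 0, p y) :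
    ∀ᶠ t : ℝ in 𝓝[>] 0, ∀ z : Fin n → ℂ, ‖z‖ ≤ B → p (scale L t z, 0) := by
  obtain ⟨m, hm, hmL⟩ := exists_pos_le hL
  obtain ⟨δ, hδ, hball⟩ := Metric.eventually_nhds_iff.1 hp
  have hlim : Tendsto (fun t : ℝ => t ^ (m : ℝ) * B) (𝓝[>] 0) (𝓝 0) := by
    simpa using (tendsto_rpow_nhdsGT (a := (m : ℝ)) (by exact_mod_cast hm)).mul_const B
  filter_upwards [hlim.eventually (gt_mem_nhds hδ), eventually_mem_nhdsWithin,
    (gt_mem_nhds (zero_lt_one' ℝ) : ∀ᶠ t : ℝ in 𝓝 0, t < 1).filter_mono nhdsWithin_le_nhds]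
    with t h1 h2 h3 z hz
  have h2' : 0 < t := h2
  refine hball ?_
  rw [dist_zero_right, Prod.norm_mk, norm_zero, max_eq_left (norm_nonneg _)]
  refine lt_of_le_of_lt (norm_scale_le hmL h2' h3.le z) (lt_of_le_of_lt ?_ h1)
  exact mul_le_mul_of_nonneg_left hz (by positivity)

theorem exists_bound_of_nonpos {L : Fin n → ℚ} (hL : ∀ i, 0 < L i) {B : ℝ} {s : ℚ} (hs : s ≤ 0)
    {R : (Fin n → ℂ) × ℝ → ℝ} (hR : ContinuousAt R 0) :
    ∃ C : ℝ, 0 ≤ C ∧ ∀ᶠ t : ℝ in 𝓝[>] 0, ∀ z : Fin n → ℂ, ‖z‖ ≤ B →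
      |R (scale L t z, 0)| ≤ C * t ^ (s : ℝ) := by
  refine ⟨|R 0| + 1, by positivity, ?_⟩
  have h1 : ∀ᶠ y in 𝓝 0, |R y| < |R 0| + 1 :=
    hR.abs.eventually (gt_mem_nhds (lt_add_one _))
  filter_upwards [eventually_scale_mem hL B h1, eventually_mem_nhdsWithin,
    (gt_mem_nhds (zero_lt_one' ℝ) : ∀ᶠ t : ℝ in 𝓝 0, t < 1).filter_mono nhdsWithin_le_nhds]
    with t h2 h3 h4 z hz
  have h5 : 1 ≤ t ^ (s : ℝ) := Real.one_le_rpow_of_pos_of_le_one_of_nonpos h3 h4.le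
    (by exact_mod_cast hs)
  exact (h2 z hz).le.trans (le_mul_of_one_le_right (by positivity) h5)

theorem scale_smul (L : Fin n → ℚ) (t θ : ℝ) (z : Fin n → ℂ) :
    scale L t (θ • z) = θ • scale L t z := by
  funext i
  simp only [scale, Pi.smul_apply, Complex.real_smul]
  ring

theorem clm_apply_eq_sum (D : (Fin n → ℂ) × ℝ →L[ℝ] ℝ) (x : Fin n → ℂ) :
    D (x, 0) = ∑ i, ((x i).re * D (coordDir (some i) 1) + (x i).im * D (coordDir (some i) Complex.I))
    := by
  have h1 : ((x, 0) : (Fin n → ℂ) × ℝ) = ∑ i, ((x i).re • coordDir (some i) 1 +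
      (x i).im • coordDir (some i) Complex.I) := by
    refine Prod.ext ?_ ?_
    · rw [Prod.fst_sum]
      funext l
      rw [Finset.sum_apply, Finset.sum_eq_single l]
      · simp [coordDir, Complex.re_add_im]
      · intro i _ hi
        simp [coordDir, Pi.single_eq_of_ne hi.symm]
      · simp
    · rw [Prod.snd_sum]
      simp [coordDir]
  rw [h1, map_sum]
  simp

/-- A weighted Taylor estimate, by induction through the mean value inequality on the segment from
the origin: the derivative along `z_i` satisfies the hypotheses with `s - λ_i`, and the coordinate
`x_i` supplies the missing `t ^ λ_i`. The condition `s ≤ k * m` guarantees that `k` differentiations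
bring `s` down to where continuity suffices. -/
theorem exists_bound_of_deriv_eq_zero {L : Fin n → ℚ} (hL : ∀ i, 0 < L i) {m : ℚ}
    (hm : ∀ i, m ≤ L i) {B : ℝ} (hB : 0 ≤ B) (k : ℕ) {s : ℚ} (hs : s ≤ k * m) {R : (Fin n → ℂ) × ℝ → ℝ}
    (hR : ContDiffAt ℝ ∞ R 0)
    (h : ∀ (k : ℕ) (a : Fin k → Option (Fin n)) (c : Fin k → ℂ), ∑ l, (a l).elim 1 L ≤ s →
      iteratedFDeriv ℝ k R 0 (fun l => coordDir (a l) (c l)) = 0) :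
    ∃ C : ℝ, 0 ≤ C ∧ ∀ᶠ t : ℝ in 𝓝[>] 0, ∀ z : Fin n → ℂ, ‖z‖ ≤ B →
      |R (scale L t z, 0)| ≤ C * t ^ (s : ℝ) := by
  induction k generalizing s R with
  | zero => exact exists_bound_of_nonpos hL (by simpa using hs) hR.continuousAt
  | succ k ih =>
    rcases lt_or_ge s 0 with hs0 | hs0
    · exact exists_bound_of_nonpos hL hs0.le hR.continuousAt
    have hR0 : R 0 = 0 := by
      have := h 0 Fin.elim0 Fin.elim0 (by simpa using hs0)
      rwa [iteratedFDeriv_zero_apply] at this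
    have hpart : ∀ i c, ∃ C : ℝ, 0 ≤ C ∧ ∀ᶠ t : ℝ in 𝓝[>] 0, ∀ z : Fin n → ℂ, ‖z‖ ≤ B →
        |fderiv ℝ R (scale L t z, 0) (coordDir (some i) c)| ≤ C * t ^ ((s - L i : ℚ) : ℝ) := by
      intro i c
      refine ih (s := s - L i) (R := fun y => fderiv ℝ R y (coordDir (some i) c)) ?_
        (contDiffAt_fderiv_apply hR _) fun k' a c' ha => ?_
      · push_cast at hs
        linarith [hm i]
      · have h1 := h (k' + 1) (Fin.snoc a (some i)) (Fin.snoc c' c) (by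
          rw [Fin.sum_univ_castSucc]
          simp only [Fin.snoc_castSucc, Fin.snoc_last, Option.elim_some]
          linarith)
        rw [iteratedFDeriv_succ_apply_eq hR] at h1
        simpa only [Fin.snoc_last, Fin.snoc_castSucc] using h1
    choose C hC0 hC using hpart
    refine ⟨∑ i, B * (C i 1 + C i Complex.I), ?_⟩
    refine ⟨Finset.sum_nonneg fun i _ => mul_nonneg hB (add_nonneg (hC0 _ _) (hC0 _ _)), ?_⟩
    have hdiff : ∀ᶠ y in 𝓝 0, DifferentiableAt ℝ R y := by
      have : ContDiffAt ℝ 1 R 0 := hR.of_le (by exact_mod_cast le_top)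
      filter_upwards [this.eventually (by simp)] with y hy
      exact hy.differentiableAt one_ne_zero
    filter_upwards [eventually_scale_mem hL B hdiff, eventually_all.2 fun i => hC i 1,
      eventually_all.2 fun i => hC i Complex.I, eventually_mem_nhdsWithin] with t h1 h2 h3 h4 z hz
    have ht : 0 < t := h4
    set x := scale L t z with hx
    have hθz : ∀ θ ∈ Set.Icc (0 : ℝ) 1, ‖θ • z‖ ≤ B := by
      intro θ hθ
      rw [norm_smul, Real.norm_of_nonneg hθ.1]
      exact (mul_le_of_le_one_left (norm_nonneg _) hθ.2).trans hz
    -- Dilations commute with real homotheties, so the segment stays among the dilated points to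
    -- which the bounds apply.
    have hline : ∀ θ : ℝ, θ • ((x, 0) : (Fin n → ℂ) × ℝ) = (scale L t (θ • z), 0) := by
      intro θ
      rw [scale_smul, Prod.smul_mk, smul_zero]
    have hmv := norm_image_sub_le_of_norm_deriv_le_segment_01'
      (f := fun θ : ℝ => R (θ • ((x, 0) : (Fin n → ℂ) × ℝ)))
      (f' := fun θ => fderiv ℝ R (scale L t (θ • z), 0) (x, 0))
      (C := (∑ i, B * (C i 1 + C i Complex.I)) * t ^ (s : ℝ)) ?_ ?_
    · simpa [hR0] using hmv
    · intro θ hθ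
      have h5 := h1 (θ • z) (hθz θ hθ)
      have h6 : HasDerivAt (fun θ : ℝ => θ • ((x, 0) : (Fin n → ℂ) × ℝ)) (x, 0) θ := by
        simpa using (hasDerivAt_id θ).smul_const ((x, 0) : (Fin n → ℂ) × ℝ)
      have h7 : HasFDerivAt R (fderiv ℝ R (scale L t (θ • z), 0))
          (θ • ((x, 0) : (Fin n → ℂ) × ℝ)) := by
        rw [hline]; exact h5.hasFDerivAt
      exact (h7.comp_hasDerivAt θ h6).hasDerivWithinAt
    · intro θ hθ
      have hθ' := hθz θ (Set.Ico_subset_Icc_self hθ)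
      rw [clm_apply_eq_sum, Finset.sum_mul, Real.norm_eq_abs]
      refine (Finset.abs_sum_le_sum_abs _ _).trans (Finset.sum_le_sum fun i _ => ?_)
      have hxi : ‖x i‖ ≤ t ^ (L i : ℝ) * B := by
        rw [hx, scale, norm_mul, Complex.norm_real, Real.norm_of_nonneg (by positivity)]
        exact mul_le_mul_of_nonneg_left ((norm_le_pi_norm z i).trans hz) (by positivity)
      have hts : t ^ (L i : ℝ) * t ^ ((s - L i : ℚ) : ℝ) = t ^ (s : ℝ) := by
        rw [← Real.rpow_add ht]; congr 1; push_cast; ring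
      have h5 := h2 i _ hθ'
      have h6 := h3 i _ hθ'
      refine (abs_add_le _ _).trans ?_
      rw [abs_mul, abs_mul]
      have h7 := mul_le_mul ((Complex.abs_re_le_norm (x i)).trans hxi) h5 (abs_nonneg _)
        (by positivity)
      have h8 := mul_le_mul ((Complex.abs_im_le_norm (x i)).trans hxi) h6 (abs_nonneg _)
        (by positivity)
      refine (add_le_add h7 h8).trans (le_of_eq ?_)
      rw [← hts]; ring

theorem norm_eval_scale_monomial (L : Fin n → ℚ) {t : ℝ} (ht : 0 < t) (z : Fin n → ℂ)
    (α : Fin n →₀ ℕ) :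
    ∏ i, ‖scale L t z i‖ ^ α i = t ^ ((Finsupp.weight L α : ℚ) : ℝ) * ∏ i, ‖z i‖ ^ α i := by
  rw [← prod_rpow_weight L ht, ← Finset.prod_mul_distrib]
  refine Finset.prod_congr rfl fun i _ => ?_
  rw [scale, norm_mul, Complex.norm_real, Real.norm_of_nonneg (by positivity), mul_pow]

theorem exists_bound_value {L : Fin n → ℚ} {P : MixedPoly n}
    (hP : ∀ e ∈ P.support, 1 ≤ mixedWeight L e) (z : Fin n → ℂ) :
    ∃ C : ℝ, ∀ t : ℝ, 0 < t → t ≤ 1 → ‖P.value (scale L t z)‖ ≤ C * t := by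
  refine ⟨∑ e ∈ P.support, ‖coeff e P‖ * ((∏ i, ‖z i‖ ^ holPart e i) * ∏ i, ‖z i‖ ^ antiPart e i),
    fun t ht ht1 => ?_⟩
  rw [MixedPoly.value, eval_eq', Finset.sum_mul]
  refine (norm_sum_le _ _).trans (Finset.sum_le_sum fun e he => ?_)
  rw [norm_mul, mul_assoc]
  refine mul_le_mul_of_nonneg_left ?_ (norm_nonneg _)
  rw [Fintype.prod_sum_type, norm_mul, norm_prod, norm_prod]
  simp only [Sum.elim_inl, Sum.elim_inr, norm_pow, RCLike.norm_conj]
  have h1 := norm_eval_scale_monomial L ht z (holPart e)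
  have h2 := norm_eval_scale_monomial L ht z (antiPart e)
  simp only [holPart_apply, antiPart_apply] at h1 h2 ⊢
  rw [h1, h2]
  have h3 : t ^ ((Finsupp.weight L (holPart e) : ℚ) : ℝ) *
      t ^ ((Finsupp.weight L (antiPart e) : ℚ) : ℝ) ≤ t := by
    rw [← Real.rpow_add ht]
    calc _ ≤ t ^ (1 : ℝ) := Real.rpow_le_rpow_of_exponent_ge ht ht1 (by
          have := hP e he
          rw [mixedWeight_eq] at this
          exact_mod_cast this)
      _ = t := Real.rpow_one t
  have h4 : 0 ≤ (∏ i, ‖z i‖ ^ e (Sum.inl i)) * ∏ i, ‖z i‖ ^ e (Sum.inr i) := by positivity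
  calc _ = (t ^ ((Finsupp.weight L (holPart e) : ℚ) : ℝ) *
      t ^ ((Finsupp.weight L (antiPart e) : ℚ) : ℝ)) *
        ((∏ i, ‖z i‖ ^ e (Sum.inl i)) * ∏ i, ‖z i‖ ^ e (Sum.inr i)) := by ring
    _ ≤ t * ((∏ i, ‖z i‖ ^ e (Sum.inl i)) * ∏ i, ‖z i‖ ^ e (Sum.inr i)) :=
        mul_le_mul_of_nonneg_right h3 h4
    _ = _ := by ring

/-- A polynomial which vanishes at the origin and whose real part is nowhere positive is zero. -/
theorem eq_zero_of_re_nonpos {Q : MvPolynomial (Fin n) ℂ} (h0 : eval 0 Q = 0)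
    (h : ∀ z, (eval z Q).re ≤ 0) : Q = 0 := by
  -- `Re (1 - Q) ≥ 1`, so `1 / (1 - Q)` is entire and bounded, and Liouville's theorem applies.
  have hne : ∀ z, 1 ≤ ‖1 - eval z Q‖ := fun z => by
    refine le_trans ?_ ((le_abs_self _).trans (Complex.abs_re_le_norm _))
    simp only [Complex.sub_re, Complex.one_re]
    linarith [h z]
  have hne' : ∀ z, 1 - eval z Q ≠ 0 := fun z hz => by
    have := hne z
    rw [hz, norm_zero] at this
    linarith
  have hd : Differentiable ℂ fun z => (1 - eval z Q)⁻¹ := fun z =>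
    ((differentiableAt_const _).sub (analyticAt_eval Q z).differentiableAt).inv (hne' z)
  have hb : Bornology.IsBounded (Set.range fun z => (1 - eval z Q)⁻¹) := by
    refine (Metric.isBounded_closedBall (x := (0 : ℂ)) (r := 1)).subset ?_
    rintro _ ⟨z, rfl⟩
    rw [mem_closedBall_zero_iff, norm_inv]
    exact inv_le_one_of_one_le₀ (hne z)
  refine poly_eq_of_eval fun z => ?_
  have h1 := hd.apply_eq_apply_of_bounded hb z 0
  simp only [h0, sub_zero, inv_one] at h1
  rw [map_zero]
  linear_combination -inv_eq_one.1 h1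

/-- If `2 Re b + ∑ |g_j|²` is of weighted order one, then so is `b`, and the `g_j` are of weighted
order `1/2`. -/
theorem ordGE_of_isBigO {L : Fin n → ℚ} (hL : ∀ i, 0 < L i) {b : (Fin n → ℂ) → ℂ}
    {g : Fin N → (Fin n → ℂ) → ℂ} (hb : AnalyticAt ℂ b 0) (hb0 : b 0 = 0)
    (hg : ∀ j, AnalyticAt ℂ (g j) 0)
    (h : ∀ z, ∃ C : ℝ, ∀ᶠ t : ℝ in 𝓝[>] 0,
      |2 * (b (scale L t z)).re + ∑ j, ‖g j (scale L t z)‖ ^ 2| ≤ C * t) :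
    OrdGE L 1 b ∧ ∀ j, OrdGE L (1 / 2) (g j) := by
  by_contra hcon
  set S : Set (Fin n →₀ ℕ) := {α | coeffAt b α ≠ 0 ∧ Finsupp.weight L α < 1} with hS
  set S' : Set (Fin n →₀ ℕ) := {α | (∃ j, coeffAt (g j) α ≠ 0) ∧ Finsupp.weight L α < 1 / 2}
    with hS'
  set W : Set ℚ := Finsupp.weight L '' S ∪ (fun α => 2 * Finsupp.weight L α) '' S' with hW
  have hfin : W.Finite := by
    refine Set.Finite.union (Set.Finite.image _ ?_) (Set.Finite.image _ ?_)
    · exact (finite_weight_le hL 1).subset fun α hα => hα.2.le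
    · exact (finite_weight_le hL (1 / 2)).subset fun α hα => hα.2.le
  have hne : W.Nonempty := by
    by_contra hem
    rw [Set.not_nonempty_iff_eq_empty, hW, Set.union_empty_iff, Set.image_eq_empty,
      Set.image_eq_empty] at hem
    refine hcon ⟨fun α hα => ?_, fun j α hα => ?_⟩
    · by_contra hlt
      exact (Set.eq_empty_iff_forall_notMem.1 hem.1) α ⟨hα, not_le.1 hlt⟩
    · by_contra hlt
      exact (Set.eq_empty_iff_forall_notMem.1 hem.2) α ⟨⟨j, hα⟩, not_le.1 hlt⟩
  obtain ⟨w, hwW, hwmin⟩ := Set.exists_min_image W id hfin hne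
  simp only [id] at hwmin
  have hw1 : w < 1 := by
    rcases hwW with ⟨α, hα, rfl⟩ | ⟨α, hα, rfl⟩
    · exact hα.2
    · have := hα.2
      change 2 * Finsupp.weight L α < 1
      linarith
  have hob : OrdGE L w b := fun α hα => by
    rcases lt_or_ge (Finsupp.weight L α) 1 with h1 | h1
    · exact hwmin _ (Or.inl ⟨α, ⟨hα, h1⟩, rfl⟩)
    · exact hw1.le.trans h1
  have hog : ∀ j, OrdGE L (w / 2) (g j) := fun j α hα => by
    rcases lt_or_ge (Finsupp.weight L α) (1 / 2) with h1 | h1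
    · have := hwmin _ (Or.inr ⟨α, ⟨⟨j, hα⟩, h1⟩, rfl⟩)
      change w ≤ 2 * Finsupp.weight L α at this
      linarith
    · linarith
  -- At the least offending weight `w < 1`, the expression divided by `t ^ w` tends to the left-hand
  -- side, while it is bounded by `C * t ^ (1 - w)`.
  have hlim : ∀ z, 2 * (eval z (lead L w b)).re + ∑ j, ‖eval z (lead L (w / 2) (g j))‖ ^ 2 = 0 := by
    intro z
    have h1 := hob.tendsto_at hL hb z
    have h2 := fun j => (hog j).tendsto_at hL (hg j) z
    have h3 := (((Complex.continuous_re.tendsto _).comp h1).const_mul 2).add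
      (tendsto_finsetSum Finset.univ fun j _ => (h2 j).norm.pow 2)
    obtain ⟨C, hC⟩ := h z
    have h4 : Tendsto (fun t : ℝ => C * t ^ ((1 - w : ℚ) : ℝ)) (𝓝[>] 0) (𝓝 0) := by
      have : (0 : ℝ) < ((1 - w : ℚ) : ℝ) := by exact_mod_cast sub_pos.2 hw1
      simpa using (tendsto_rpow_nhdsGT this).const_mul C
    refine tendsto_nhds_unique h3 (squeeze_zero_norm' ?_ h4)
    filter_upwards [hC, eventually_mem_nhdsWithin] with t ht ht0
    have ht0' : 0 < t := ht0
    have h5 : ∀ j, ‖((t ^ (-((w / 2 : ℚ) : ℝ)) : ℝ) : ℂ) * g j (scale L t z)‖ ^ 2 =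
        t ^ (-(w : ℝ)) * ‖g j (scale L t z)‖ ^ 2 := by
      intro j
      rw [norm_mul, mul_pow, Complex.norm_real, Real.norm_of_nonneg (by positivity),
        ← Real.rpow_natCast, ← Real.rpow_mul ht0'.le]
      congr 2
      push_cast; ring
    have h6 : 2 * (((t ^ (-(w : ℝ)) : ℝ) : ℂ) * b (scale L t z)).re +
        ∑ j, ‖((t ^ (-((w / 2 : ℚ) : ℝ)) : ℝ) : ℂ) * g j (scale L t z)‖ ^ 2 =
        t ^ (-(w : ℝ)) * (2 * (b (scale L t z)).re + ∑ j, ‖g j (scale L t z)‖ ^ 2) := by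
      simp only [h5, ← Finset.mul_sum, Complex.re_ofReal_mul]
      ring
    rw [Function.comp_apply, h6, norm_mul, Real.norm_of_nonneg (by positivity), Real.norm_eq_abs]
    have h7 : t ^ ((1 - w : ℚ) : ℝ) = t ^ (-(w : ℝ)) * t := by
      rw [← Real.rpow_add_one ht0'.ne']; congr 1; push_cast; ring
    rw [h7]
    calc _ ≤ t ^ (-(w : ℝ)) * (C * t) := mul_le_mul_of_nonneg_left ht (by positivity)
      _ = _ := by ring
  have hlead0 : eval 0 (lead L w b) = 0 := by
    rw [eval_zero, constantCoeff_eq, coeff_lead hL, coeffAt_zero hb, hb0, ite_self]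
  have hsum : ∀ z, 0 ≤ ∑ j, ‖eval z (lead L (w / 2) (g j))‖ ^ 2 := fun z =>
    Finset.sum_nonneg fun j _ => by positivity
  have hB := eq_zero_of_re_nonpos hlead0 fun z => by linarith [hlim z, hsum z]
  have hG : ∀ j, lead L (w / 2) (g j) = 0 := by
    intro j
    refine poly_eq_of_eval fun z => ?_
    have h1 := hlim z
    rw [hB, map_zero, Complex.zero_re, mul_zero, zero_add] at h1
    have := (Finset.sum_eq_zero_iff_of_nonneg fun j _ => by positivity).1 h1 j (Finset.mem_univ j)
    simpa using this
  rcases hwW with ⟨α, hα, hαw⟩ | ⟨α, ⟨⟨j, hj⟩, hα⟩, hαw⟩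
  · have := congrArg (coeff α) hB
    rw [coeff_lead hL, if_pos hαw, coeff_zero] at this
    exact hα.1 this
  · have := congrArg (coeff α) (hG j)
    rw [coeff_lead hL, if_pos (by rw [← hαw]; ring), coeff_zero] at this
    exact hj this

/-- The zero entries of `μ` are replaced by `ε`. -/
def fillZeros (ε : ℚ) (μ : Fin n → ℚ) : Fin n → ℚ := fun i => if μ i = 0 then ε else μ i

section Distinguished

variable {f : Fin N → (Fin n → ℂ) → ℂ} {μ : Fin n → ℚ} {Φ : (Fin n → ℂ) × ℂ → (Fin n → ℂ) × ℂ}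

theorem contDiffAt_definingFunction_comp (hf : ∀ j, AnalyticAt ℂ (f j) 0) (hΦ : AnalyticAt ℂ Φ 0)
    (hΦ0 : Φ 0 = 0) : ContDiffAt ℝ 1 (fun p => definingFunction f (Φ p)) 0 := by
  have h1 : ContDiffAt ℝ 1 Φ 0 := hΦ.contDiffAt.restrict_scalars ℝ
  have h2 : ContDiffAt ℝ 1 (fun p => (Φ p).2.re) 0 :=
    Complex.reCLM.contDiff.contDiffAt.comp (0 : (Fin n → ℂ) × ℂ) h1.snd
  refine (contDiffAt_const.mul h2).add (ContDiffAt.sum fun j _ => ?_)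
  have h3 : ContDiffAt ℝ 1 (f j) (Φ 0).1 := by
    rw [hΦ0]; exact (hf j).contDiffAt.restrict_scalars ℝ
  exact ContDiffAt.norm_sq ℂ (h3.comp (0 : (Fin n → ℂ) × ℂ) h1.fst)

/-- The point with the same `z` and `w = i V`, `V = Re P + R`, lies on the hypersurface, at distance
`|V| = O(t)` from the point with `w = 0`. As `r ∘ Φ` is Lipschitz and vanishes at the former, it is
`O(t)` at the latter. -/
theorem exists_bound_definingFunction {L : Fin n → ℚ} (hL : ∀ i, 0 < L i)
    (hf : ∀ j, AnalyticAt ℂ (f j) 0) (hΦ : AnalyticAt ℂ Φ 0)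
    (hΦ0 : Φ 0 = 0) {P : MixedPoly n} {R : (Fin n → ℂ) × ℝ → ℝ}
    (hP : ∀ e ∈ P.support, 1 ≤ mixedWeight L e) (hR : IsLittleOWeighted L R)
    (h : ∀ᶠ p : (Fin n → ℂ) × ℂ in 𝓝 0, definingFunction f (Φ p) = 0 ↔
      p.2.im = (P.value p.1).re + R (p.1, p.2.re)) (z : Fin n → ℂ) :
    ∃ C : ℝ, ∀ᶠ t : ℝ in 𝓝[>] 0, |definingFunction f (Φ (scale L t z, 0))| ≤ C * t := by
  obtain ⟨m, hm, hmL⟩ := exists_pos_le hL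
  obtain ⟨k, hk⟩ := exists_nat_ge (1 / m)
  obtain ⟨C₁, hC₁0, hC₁⟩ := exists_bound_of_deriv_eq_zero hL hmL (norm_nonneg z) k (s := 1)
    ((div_le_iff₀ hm).1 hk) hR.1 hR.2
  obtain ⟨C₂, hC₂⟩ := exists_bound_value hP z
  obtain ⟨K, U, hU, hlip⟩ := (contDiffAt_definingFunction_comp hf hΦ hΦ0).exists_lipschitzOnWith
  set V : ℝ → ℝ := fun t => (P.value (scale L t z)).re + R (scale L t z, 0) with hV
  have hlt1 : ∀ᶠ t : ℝ in 𝓝[>] 0, t < 1 :=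
    (gt_mem_nhds (zero_lt_one' ℝ) : ∀ᶠ t : ℝ in 𝓝 0, t < 1).filter_mono nhdsWithin_le_nhds
  have hVb : ∀ᶠ t : ℝ in 𝓝[>] 0, |V t| ≤ (C₂ + C₁) * t := by
    filter_upwards [hC₁, eventually_mem_nhdsWithin, hlt1] with t h1 h2 h3
    have h4 := h1 z le_rfl
    rw [Rat.cast_one, Real.rpow_one] at h4
    have h5 := (Complex.abs_re_le_norm _).trans (hC₂ t h2 h3.le)
    rw [add_mul]
    exact (abs_add_le _ _).trans (add_le_add h5 h4)
  have ht0 : Tendsto (fun t : ℝ => t) (𝓝[>] 0) (𝓝 0) := tendsto_id.mono_left nhdsWithin_le_nhds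
  have hV0 : Tendsto V (𝓝[>] 0) (𝓝 0) :=
    squeeze_zero_norm' hVb (by simpa using ht0.const_mul (C₂ + C₁))
  have hsc : Tendsto (fun t : ℝ => scale L t z) (𝓝[>] 0) (𝓝 0) := by
    have h1 : Tendsto (fun t : ℝ => (t, z)) (𝓝[>] 0) (𝓝[>] 0 ×ˢ 𝓝 z) :=
      tendsto_id.prodMk tendsto_const_nhds
    simpa only [Function.comp_def] using (tendsto_scale hL z).comp h1
  have hp1 : Tendsto (fun t : ℝ => ((scale L t z, (0 : ℂ)) : (Fin n → ℂ) × ℂ)) (𝓝[>] 0) (𝓝 0) := by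
    rw [← Prod.mk_zero_zero]
    exact hsc.prodMk_nhds tendsto_const_nhds
  have hp2 : Tendsto (fun t : ℝ => ((scale L t z, Complex.I * (V t : ℂ)) : (Fin n → ℂ) × ℂ))
      (𝓝[>] 0) (𝓝 0) := by
    rw [← Prod.mk_zero_zero]
    refine hsc.prodMk_nhds ?_
    have := ((Complex.continuous_ofReal.tendsto 0).comp hV0).const_mul Complex.I
    simpa using this
  refine ⟨K * (C₂ + C₁), ?_⟩
  filter_upwards [hVb, hp1.eventually hU, hp2.eventually hU, hp2.eventually h] with t h1 h2 h3 h4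
  have h5 : definingFunction f (Φ (scale L t z, Complex.I * (V t : ℂ))) = 0 := by
    rw [h4]; simp [hV]
  have h6 := hlip.dist_le_mul _ h2 _ h3
  simp only [h5, dist_zero_right, Real.norm_eq_abs] at h6
  have h7 : dist ((scale L t z, (0 : ℂ)) : (Fin n → ℂ) × ℂ) (scale L t z, Complex.I * (V t : ℂ)) =
      |V t| := by
    simp [dist_eq_norm]
  rw [h7] at h6
  calc _ ≤ K * |V t| := h6
    _ ≤ K * ((C₂ + C₁) * t) := mul_le_mul_of_nonneg_left h1 K.2
    _ = _ := by ring

/-- `a` and `b` are the components of `Φ(z, 0)`. Dilations need positive weights, so zero entries of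
`μ` are first replaced by a small `ε`. -/
theorem IsDistinguished.exists_admissible (hf : ∀ j, AnalyticAt ℂ (f j) 0)
    (h : IsDistinguished (definingFunction f) μ) : ∃ a, Admissible f μ a := by
  obtain ⟨hμ, Φ, P, R, hΦ, hΦ0, hbij, hP, -, -, hR, hM⟩ := h
  set ι : (Fin n → ℂ) →L[ℂ] (Fin n → ℂ) × ℂ := ContinuousLinearMap.inl ℂ _ _ with hι
  have hΦι : AnalyticAt ℂ (fun z => Φ (ι z)) 0 :=
    AnalyticAt.fun_comp (by rw [map_zero]; exact hΦ) (ι.analyticAt 0)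
  have ha : AnalyticAt ℂ (fun z => (Φ (ι z)).1) 0 := analyticAt_fst.fun_comp hΦι
  have hb : AnalyticAt ℂ (fun z => (Φ (ι z)).2) 0 := analyticAt_snd.fun_comp hΦι
  set a : (Fin n → ℂ) → Fin n → ℂ := fun z => (Φ (ι z)).1 with haΦ
  set b : (Fin n → ℂ) → ℂ := fun z => (Φ (ι z)).2 with hbΦ
  have ha0 : a 0 = 0 := by simp [haΦ, hΦ0]
  have hb0 : b 0 = 0 := by simp [hbΦ, hΦ0]
  have hg : ∀ j, AnalyticAt ℂ (f j ∘ a) 0 := fun j =>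
    AnalyticAt.comp (by rw [ha0]; exact hf j) ha
  have hfill : ∀ ε : ℚ, 0 < ε →
      OrdGE (fillZeros ε μ) 1 b ∧ ∀ j, OrdGE (fillZeros ε μ) (1 / 2) (f j ∘ a) := by
    intro ε hε
    have hle : ∀ i, μ i ≤ fillZeros ε μ i := fun i => by
      unfold fillZeros; split_ifs with h1
      · rw [h1]; exact hε.le
      · exact le_rfl
    have hpos : ∀ i, 0 < fillZeros ε μ i := fun i => by
      unfold fillZeros; split_ifs with h1
      · exact hε
      · exact lt_of_le_of_ne (hμ.nonneg i) (Ne.symm h1)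
    refine ordGE_of_isBigO hpos hb hb0 hg fun z => ?_
    refine exists_bound_definingFunction hpos hf hΦ hΦ0 (P := P) (R := R) (fun e he => ?_)
      ⟨hR.1, fun k c d hc => hR.2 k c d (le_trans (Finset.sum_le_sum fun l _ => ?_) hc)⟩ hM z
    · rw [← hP e he, mixedWeight_eq, mixedWeight_eq]
      exact add_le_add (weight_mono hle _) (weight_mono hle _)
    · cases c l with
      | none => exact le_rfl
      | some i => exact hle i
  refine ⟨a, ha, ha0, ?_, hμ.antitone, fun j α hα => ?_⟩
  -- `b` has order at least one while a linear monomial weighs at most `1/2`. So `db = 0` at the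
  -- origin, and the injectivity of `dΦ` passes to `da`.
  · have hdb : fderiv ℂ b 0 = 0 := by
      refine ContinuousLinearMap.ext fun v => ?_
      have hpd : ∀ i, fderiv ℂ b 0 (Pi.single i 1) = 0 := by
        intro i
        have h1 := coeffAt_pd hb i 0
        rw [coeffAt_zero (analyticAt_pd hb i)] at h1
        have h2 : coeffAt b (0 + Finsupp.single i 1) = 0 := by
          by_contra hne
          have h3 := (hfill (1 / 2) (by norm_num)).1 _ hne
          rw [zero_add, Finsupp.weight_single, one_smul, fillZeros] at h3
          split_ifs at h3
          · norm_num at h3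
          · linarith [hμ.le_half i]
        rw [h2, zero_mul] at h1
        exact h1
      have h4 : v = ∑ i, v i • (Pi.single i 1 : Fin n → ℂ) := by
        funext l
        simp [Finset.sum_apply, Pi.single_apply]
      rw [h4, map_sum]
      simp [hpd]
    have hΦd : HasFDerivAt Φ (fderiv ℂ Φ 0) (ι 0) := by
      rw [map_zero]; exact hΦ.differentiableAt.hasFDerivAt
    have hcomp := hΦd.comp (0 : Fin n → ℂ) ι.hasFDerivAt
    have hd1 : ∀ v, fderiv ℂ a 0 v = (fderiv ℂ Φ 0 (ι v)).1 := DFunLike.congr_fun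
      ((ContinuousLinearMap.fst ℂ (Fin n → ℂ) ℂ).hasFDerivAt.comp (0 : Fin n → ℂ) hcomp).fderiv
    have hd2 : ∀ v, fderiv ℂ b 0 v = (fderiv ℂ Φ 0 (ι v)).2 := DFunLike.congr_fun
      ((ContinuousLinearMap.snd ℂ (Fin n → ℂ) ℂ).hasFDerivAt.comp (0 : Fin n → ℂ) hcomp).fderiv
    have hinj : Function.Injective (fderiv ℂ a 0) := by
      refine (injective_iff_map_eq_zero _).2 fun v hv => ?_
      have h5 : fderiv ℂ Φ 0 (ι v) = fderiv ℂ Φ 0 0 := by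
        rw [map_zero]
        refine Prod.ext ?_ ?_
        · rw [← hd1, hv]; rfl
        · rw [← hd2, hdb]; rfl
      exact congrArg Prod.fst (hbij.1 h5)
    exact ⟨hinj, LinearMap.injective_iff_surjective (f := (fderiv ℂ a 0).toLinearMap).1 hinj⟩
  -- For a fixed `α`, filling the zeros with `δ / (|α| + 1)` raises its weight by at most `δ`.
  · refine le_of_forall_pos_le_add fun δ hδ => ?_
    have hε : 0 < δ / (α.degree + 1) := by positivity
    have h1 := (hfill _ hε).2 j α hα
    refine h1.trans ?_
    have h2 : Finsupp.weight (fillZeros (δ / (α.degree + 1)) μ) α ≤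
        Finsupp.weight μ α + Finsupp.weight (fun _ : Fin n => δ / (α.degree + 1 : ℚ)) α := by
      simp only [weight_eq_sum', ← Finset.sum_add_distrib, ← mul_add]
      refine Finset.sum_le_sum fun i _ => mul_le_mul_of_nonneg_left ?_ (Nat.cast_nonneg _)
      unfold fillZeros
      split_ifs with h3
      · rw [h3, zero_add]
      · linarith
    refine h2.trans (add_le_add_right ?_ _)
    rw [weight_const, mul_div_assoc', div_le_iff₀ (by positivity)]
    nlinarith

end Distinguished

end

/-! ### The multitype and the main theorem -/

section

variable {n N : ℕ}

/-- With all `n` variables settled, the comparison reads `L < μ` or `L = μ` for every distinguished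
`μ`. Since `L` is distinguished, the greatest lower bound is a minimum. -/
theorem ReducedInv.isMultitypeWeight {f : Fin N → (Fin n → ℂ) → ℂ}
    (hf : ∀ j, AnalyticAt ℂ (f j) 0) {k : ℕ} {τ : ℚ} {L : Fin n → ℚ}
    {φ : (Fin n → ℂ) → Fin n → ℂ} (hL : ∀ i, 0 < L i) (hLw : IsWeight L)
    (h : ReducedInv f k n τ L φ) : IsMultitypeWeight (definingFunction f) L := by
  refine IsLeast.isGLB ⟨isDistinguished_of_ord hf hL hLw h.aut h.ord, fun M hM => ?_⟩
  obtain ⟨a, ha⟩ := IsDistinguished.exists_admissible hf hM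
  rcases h.compare _ a ha with hlt | ⟨heq, -, -⟩
  · exact hlt.le
  · have : L = ofLex M := funext fun i => (heq i i.2).symm
    rw [this]
    exact le_rfl

end

end SumOfSquares

end

open SumOfSquares in
theorem theorem5 {n N : ℕ} (hn : 0 < n) (f : Fin N → (Fin n → ℂ) → ℂ)
    (hf : ∀ j, AnalyticAt ℂ (f j) 0) (h0 : definingFunction f 0 = 0)
    (htype : dAngeloOneType (definingFunction f) < ⊤) :
    -- at every step the leading polynomial is a sum of squares, before and after the reduction
    (∀ t Λ φ, KolarStep (sumSq f) t Λ φ →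
      (leadingPoly (sumSq f ∘ φ) Λ).IsSumOfSquares n) ∧
    (∀ t Λ φ, KolarOutcome (sumSq f) t Λ φ →
      (leadingPoly (sumSq f ∘ φ) Λ).IsSumOfSquares
        (n - (leadingPoly (sumSq f ∘ φ) Λ).numFree)) ∧
    -- the algorithm starts, never gets stuck, and stops after a bounded number of steps
    (∃ Λ, KolarStep (sumSq f) 1 Λ id) ∧
    (∀ t Λ φ, KolarStep (sumSq f) t Λ φ → ∃ ψ, IsReduction (sumSq f ∘ φ) Λ ψ) ∧
    (∀ t Λ φ, KolarOutcome (sumSq f) t Λ φ → (leadingPoly (sumSq f ∘ φ) Λ).numFree ≠ 0 →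
      ∃ Λ', KolarStep (sumSq f) (t + 1) Λ' φ) ∧
    (∃ T, ∀ t Λ φ, KolarStep (sumSq f) t Λ φ → t ≤ T) ∧
    -- the final weight is the multitype weight and the final leading polynomial, in all the
    -- variables, is a sum of squares
    (∀ t Λ φ, KolarOutcome (sumSq f) t Λ φ → (leadingPoly (sumSq f ∘ φ) Λ).numFree = 0 →
      IsMultitypeWeight (definingFunction f) Λ ∧
      (leadingPoly (sumSq f ∘ φ) Λ).IsSumOfSquares n) := by
  have hf0 := apply_zero_of_definingFunction h0
  obtain ⟨K, hK⟩ := exists_type_bound hf htype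
  have hstep : ∀ {t Λ φ}, KolarStep (sumSq f) t Λ φ → ∃ k τ, KolarInv f k τ Λ φ :=
    exists_kolarInv hn hf hf0
  have hout : ∀ t Λ φ, KolarOutcome (sumSq f) t Λ φ →
      (leadingPoly (sumSq f ∘ φ) Λ).IsSumOfSquares
        (n - (leadingPoly (sumSq f ∘ φ) Λ).numFree) := by
    rintro t Λ _ ⟨φ₀, ψ, hst, hψ, rfl⟩
    obtain ⟨k, τ, h⟩ := hstep hst
    have hr := h.reducedInv hf hψ
    have hfree := hr.free
    rw [leadingPoly_of_ord hf h.pos' hr.aut hr.ord] at hfree ⊢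
    refine isSumOfSquares_sqPoly _ fun j i hi => ?_
    by_contra hlt
    exact hi (hfree j i (not_lt.1 hlt))
  refine ⟨fun t Λ φ hst => ?_, hout, ?_, fun t Λ φ hst => ?_, ?_, exists_steps_le hn hf hf0 hK, ?_⟩
  · obtain ⟨k, τ, h⟩ := hstep hst
    rw [leadingPoly_of_ord hf h.pos' h.aut h.ord]
    exact isSumOfSquares_sqPoly _ fun _ i _ => i.2
  · obtain ⟨j, l, -, hl⟩ := hK id isAut_id ⟨0, hn⟩
    exact exists_kolarStep_one hf hl
  · obtain ⟨k, τ, h⟩ := hstep hst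
    obtain ⟨ψ, hψ⟩ := exists_reduces h.tail h.pos h.noField
    exact ⟨ψ, (isReduction_iff (g := fun j => f j ∘ φ) h.pos' (analyticAt_comp_aut hf h.aut)
      h.ord ψ).2 hψ⟩
  · rintro t Λ _ ⟨φ₀, ψ, hst, hψ, rfl⟩ hd
    obtain ⟨k, τ, h⟩ := hstep hst
    have hr := h.reducedInv hf hψ
    -- Since `numFree ≠ 0`, the last variable is among the unsettled ones; a pure power of it starts
    -- the search for the next weight.
    obtain ⟨j, l, -, hl⟩ := hK _ hr.aut ⟨n - 1, by omega⟩
    obtain ⟨Λ', hΛ'⟩ := hr.exists_next hf h (by simp only; omega) hl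
    exact ⟨Λ', KolarStep.next t Λ Λ' φ₀ ψ hst hψ hd hΛ'⟩
  · intro t Λ φ ho hd
    have hsq := hout t Λ φ ho
    rw [hd, Nat.sub_zero] at hsq
    refine ⟨?_, hsq⟩
    obtain ⟨φ₀, ψ, hst, hψ, rfl⟩ := ho
    obtain ⟨k, τ, h⟩ := hstep hst
    have hr := h.reducedInv hf hψ
    rw [show (leadingPoly (sumSq f ∘ φ₀ ∘ polyMap ψ) Λ).numFree = 0 from hd, Nat.sub_zero] at hr
    exact hr.isMultitypeWeight hf h.pos' h.weight
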